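/- **Theorem.** Consider a Markov decision process with state space $\mathcal S$, action space $\mathcal A$, transition law $\mathcal P(\cdot\mid s,a)$, reward $\mathcal R(s,a)$, initial law $\rho_0$ and discount $\gamma\in(0,1)$, and policies $\pi_\theta(a\mid s)$ with $\theta\in\mathbb R^M$. Let $J(\theta)=\mathbb E[\sum_{k\ge0}\gamma^k\mathcal R(s_k,a_k)]$ with $s_0\sim\rho_0$, $a_k\sim\pi_\theta(\cdot\mid s_k)$, $s_{k+1}\sim\mathcal P(\cdot\mid s_k,a_k)$. Vanilla policy gradient with horizon $H$ and step size $\mu$ starts at an arbitrary $\theta_0$ and iterates $\theta_{t+1}=\theta_t+\mu\,\hat G(\theta_t;\tau_t)$, where $\tau_t=(s_0,a_0,\dots,s_{H-1},a_{H-1})$ is sampled under $\pi_{\theta_t}$ with $s_0\sim\rho_0$, and $$\hat G(\theta;\tau)=\sum_{h=0}^{H-1}\nabla\log\pi_\theta(a_h\mid s_h)\sum_{i=h}^{H-1}\gamma^i\mathcal R(s_i,a_i).$$ Let $\mathcal R_{\max},G,B,\sigma_l,\chi,\beta_R>0$, $\iota\in\mathbb R$, $0<\nu\le4$, $\delta\in(0,1)$,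 and put $$L=\tfrac{\mathcal R_{\max}B}{(1-\gamma)^2}+\tfrac{(1+\gamma)\mathcal R_{\max}G^2}{(1-\gamma)^3},\quad \sigma=\tfrac{G\mathcal R_{\max}}{(1-\gamma)^2},\quad D=\tfrac{G\mathcal R_{\max}}{1-\gamma},\quad \ell=L\sigma^2-D^2\mu,\quad \omega=\sqrt{\chi\epsilon}.$$ Assume: 1. For all $s,a,\theta$: $|\mathcal R(s,a)|\le\mathcal R_{\max}$; $\pi_\theta(a\mid s)>0$ and $\log\pi_\theta(a\mid s)$ is twice differentiable in $\theta$; $\|\nabla\log\pi_\theta(a\mid s)\|\le G$; $\|\nabla^2\log\pi_\theta(a\mid s)\|<B$; and $\nabla^2\log\pi_\theta(a\mid s)$ is $\iota$-Lipschitz in $\theta$. 2. With $\xi(\theta;\tau)=\hat G(\theta;\tau)-\mathbb E_\tau[\hat G(\theta;\tau)]$ and $R_\xi(\theta)=\mathbb E_\tau[\xi\xi^{\top}]$ ($\tau$ sampled under $\pi_\theta$): $\|R_\xi(\theta_1)-R_\xi(\theta_2)\|\le\beta_R\|\theta_1-\theta_2\|^{\nu}$ for all $\theta_1,\theta_2$.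 3. At every $\theta$ with $\|\nabla J(\theta)\|^2<\mu\ell(1+1/\delta)$ and $\lambda_{\max}(\nabla^2J(\theta))\ge\omega$, one has $v^\top R_\xi(\theta)v\ge\sigma_l^2\|v\|^2$ for all $v$ in the span of the eigenvectors of $\nabla^2J(\theta)$ with positive eigenvalue. Then there is a constant $C_H$ depending only on $\gamma$, and for every $c\in(0,1)$ there are constants $C,k$ depending only on $c$, $M$, $\gamma$, $G$, $\mathcal R_{\max}$, $L$, $\sigma_l$, $\chi$, $\delta$, such that for all sufficiently small $\epsilon>0$ (how small may depend on these parameters and on $\iota,\beta_R,\nu$), every step size $\mu$ with $$c\,\frac{\epsilon^2\delta}{L\sigma^2+D^2}\le\mu<\frac{\epsilon^2\delta}{L\sigma^2+D^2}$$ and every horizon $H\ge C_H\log(\epsilon^{-2})$ (so $H=O(\log\epsilon^{-2})$ suffices), the following holds: with probability at least $1-\delta$ there is an iterate $\theta_t$ with $t\le C\,\epsilon^{-6.5}\log^k(1/\epsilon)$, i.e. within $\tilde O(\epsilon^{-6.5})$ iterations, that is an $\epsilon$-second-order stationary point: $J$ is twice continuously differentiable, $\|\nabla J(\theta_t)\|\le\epsilon$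 and $\lambda_{\max}(\nabla^2J(\theta_t))\le\sqrt{\chi\epsilon}$. Here $\chi>0$ is arbitrary; in particular it may be a Lipschitz constant of $\nabla^2J$. -/

import Mathlib

open MeasureTheory ProbabilityTheory
open scoped Gradient RealInnerProductSpace

noncomputable section

namespace PolicyGradient

/-- The parameter space `ℝ^M` with its Euclidean norm. -/
abbrev Param (M : ℕ) : Type := EuclideanSpace ℝ (Fin M)

/-- A Markov decision process: transition probabilities, reward function and initial state
distribution. The state and action spaces are arbitrary measurable spaces, so that finite,
countable and continuous ones are all covered. -/
structure MDP (S A : Type*) [MeasurableSpace S] [MeasurableSpace A] where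
  /-- `transition (s, a)` is the law of the next state -/
  transition : Kernel (S × A) S
  markov_transition : IsMarkovKernel transition
  /-- the reward of action `a` in state `s` -/
  reward : S → A → ℝ
  measurable_reward : Measurable (Function.uncurry reward)
  /-- the initial state distribution -/
  init : Measure S
  prob_init : IsProbabilityMeasure init

attribute [instance] MDP.markov_transition MDP.prob_init

/-- A parametrized stochastic policy: `density θ s a` is `π_θ(a | s)`, a probability density with
respect to a fixed reference measure on the actions (the counting measure for discrete actions,
Lebesgue measure for, say, Gaussian policies). -/
structure Policy (M : ℕ) (S A : Type*) [MeasurableSpace S] [MeasurableSpace A] where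
  base : Measure A
  sigmaFinite_base : SigmaFinite base
  density : Param M → S → A → ℝ
  density_nonneg : ∀ θ s a, 0 ≤ density θ s a
  measurable_density : ∀ θ, Measurable (Function.uncurry (density θ))
  lintegral_density : ∀ θ s, ∫⁻ a, ENNReal.ofReal (density θ s a) ∂base = 1

attribute [instance] Policy.sigmaFinite_base

section

variable {M : ℕ} {S A : Type*} [MeasurableSpace S] [MeasurableSpace A]

/-- The policy `π_θ` as a kernel: the law of the action taken in state `s`. -/
def Policy.kernel (π : Policy M S A) (θ : Param M) : Kernel S A :=
  (Kernel.const S π.base).withDensity fun s a => ENNReal.ofReal (π.density θ s a)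

instance (π : Policy M S A) (θ : Param M) : IsMarkovKernel (π.kernel θ) := by
  refine ⟨fun s => ⟨?_⟩⟩
  have hm : Measurable (Function.uncurry fun s a => ENNReal.ofReal (π.density θ s a)) :=
    (π.measurable_density θ).ennreal_ofReal
  rw [Policy.kernel, Kernel.withDensity_apply' _ hm, setLIntegral_univ, Kernel.const_apply]
  exact π.lintegral_density θ s

/-- The score function `∇_θ log π_θ(a | s)`. -/
def Policy.score (π : Policy M S A) (θ : Param M) (s : S) (a : A) : Param M :=
  ∇ (fun η => Real.log (π.density η s a)) θ

/-- One step of the state-action chain: `s' ∼ P(· | s, a)`, then `a' ∼ π_θ(· | s')`. -/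
def stepKernel (E : MDP S A) (π : Policy M S A) (θ : Param M) : Kernel (S × A) (S × A) :=
  E.transition ⊗ₖ Kernel.prodMkLeft (S × A) (π.kernel θ)

instance (E : MDP S A) (π : Policy M S A) (θ : Param M) : IsMarkovKernel (stepKernel E π θ) := by
  unfold stepKernel; infer_instance

/-- The step kernel as a function of the whole past `(s_0, a_0), …, (s_n, a_n)`. -/
def pastKernel (E : MDP S A) (π : Policy M S A) (θ : Param M) (n : ℕ) :
    Kernel (Finset.Iic n → S × A) (S × A) :=
  (stepKernel E π θ).comap (fun x => x ⟨n, Finset.mem_Iic.2 le_rfl⟩) (measurable_pi_apply _)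

instance (E : MDP S A) (π : Policy M S A) (θ : Param M) (n : ℕ) :
    IsMarkovKernel (pastKernel E π θ n) := by
  unfold pastKernel; infer_instance

/-- The law of the infinite trajectory `s_0, a_0, s_1, a_1, …` under `π_θ`, with `s_0 ∼ ρ_0`. -/
def pathLaw (E : MDP S A) (π : Policy M S A) (θ : Param M) : Measure (ℕ → S × A) :=
  Kernel.trajMeasure (X := fun _ => S × A) (E.init ⊗ₘ π.kernel θ) (pastKernel E π θ)

/-- The law of the trajectory `s_0, a_0, …, s_{H-1}, a_{H-1}` of length `H` under `π_θ`. -/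
def trajLaw (E : MDP S A) (π : Policy M S A) (H : ℕ) (θ : Param M) : Measure (Fin H → S × A) :=
  (pathLaw E π θ).map fun τ h => τ h

/-- The expected infinite-horizon discounted reward `J`. -/
def objective (E : MDP S A) (π : Policy M S A) (γ : ℝ) (θ : Param M) : ℝ :=
  ∫ τ, ∑' k : ℕ, γ ^ k * E.reward (τ k).1 (τ k).2 ∂(pathLaw E π θ)

/-- The GPOMDP ("vanilla") policy gradient estimator computed from a trajectory of length `H`. -/
def gpomdp (E : MDP S A) (π : Policy M S A) (γ : ℝ) (H : ℕ) (θ : Param M)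
    (τ : Fin H → S × A) : Param M :=
  ∑ h : Fin H,
    (∑ i ∈ Finset.Ici h, γ ^ (i : ℕ) * E.reward (τ i).1 (τ i).2) • π.score θ (τ h).1 (τ h).2

/-- The gradient noise: the estimator minus its expectation over the sampled trajectory. -/
def noise (E : MDP S A) (π : Policy M S A) (γ : ℝ) (H : ℕ) (θ : Param M)
    (τ : Fin H → S × A) : Param M :=
  gpomdp E π γ H θ τ - ∫ τ', gpomdp E π γ H θ τ' ∂(trajLaw E π H θ)

/-- The covariance `E[ξ ξᵀ]` of the gradient noise at `θ`, as an operator on `ℝ^M`. -/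
def noiseCov (E : MDP S A) (π : Policy M S A) (γ : ℝ) (H : ℕ) (θ : Param M) :
    Param M →L[ℝ] Param M :=
  ∫ τ, InnerProductSpace.rankOne ℝ (noise E π γ H θ τ) (noise E π γ H θ τ) ∂(trajLaw E π H θ)

/-- The Hessian `∇²J(θ)` as an operator on `ℝ^M`. -/
def hessian (J : Param M → ℝ) (θ : Param M) : Param M →L[ℝ] Param M :=
  fderiv ℝ (∇ J) θ

/-- The largest (real) eigenvalue; used for Hessians, which are symmetric. -/
def lambdaMax (T : Param M →L[ℝ] Param M) : ℝ :=
  sSup {a : ℝ | Module.End.HasEigenvalue (T : Param M →ₗ[ℝ] Param M) a}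

/-- `θ` is an `ε`-second-order stationary point of the twice differentiable function `J`, for the
Hessian-Lipschitz parameter `χ`. -/
def IsSecondOrderStationary (J : Param M → ℝ) (χ ε : ℝ) (θ : Param M) : Prop :=
  ContDiff ℝ 2 J ∧ ‖∇ J θ‖ ≤ ε ∧ lambdaMax (hessian J θ) ≤ √(χ * ε)

/-- The region of large gradient, `‖∇J(θ)‖² ≥ μ ℓ (1 + 1/δ)`. -/
def largeGradient (J : Param M → ℝ) (μ l δ : ℝ) : Set (Param M) :=
  {θ | μ * l * (1 + 1 / δ) ≤ ‖∇ J θ‖ ^ 2}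

/-- The approximate strict saddle points: small gradient and `λ_max(∇²J(θ)) ≥ ω`. -/
def strictSaddle (J : Param M → ℝ) (μ l δ ω : ℝ) : Set (Param M) :=
  {θ | θ ∉ largeGradient J μ l δ ∧ ω ≤ lambdaMax (hessian J θ)}

/-- Bounded rewards, and a score function that is bounded by `G` and whose Jacobian is bounded by
`B` and `ι`-Lipschitz. -/
structure Regular (E : MDP S A) (π : Policy M S A) (Rmax G B ι : ℝ) : Prop where
  reward_le : ∀ s a, |E.reward s a| ≤ Rmax
  density_pos : ∀ θ s a, 0 < π.density θ s a
  log_differentiable : ∀ s a, Differentiable ℝ fun θ => Real.log (π.density θ s a)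
  score_le : ∀ θ s a, ‖π.score θ s a‖ ≤ G
  score_differentiable : ∀ s a, Differentiable ℝ fun θ => π.score θ s a
  jacobian_lt : ∀ θ s a, ‖fderiv ℝ (fun η => π.score η s a) θ‖ < B
  jacobian_lipschitz : ∀ θ₁ θ₂ s a,
    ‖fderiv ℝ (fun η => π.score η s a) θ₁ - fderiv ℝ (fun η => π.score η s a) θ₂‖
      ≤ ι * ‖θ₁ - θ₂‖

/-- The covariance of the gradient noise is Lipschitz (with exponent `ν`). -/
def CovLipschitz (E : MDP S A) (π : Policy M S A) (γ : ℝ) (H : ℕ) (β ν : ℝ) : Prop :=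
  ∀ θ₁ θ₂, ‖noiseCov E π γ H θ₁ - noiseCov E π γ H θ₂‖ ≤ β * ‖θ₁ - θ₂‖ ^ ν

/-- Correlated curvature: at every approximate strict saddle point `θ`, the compression of the
noise covariance to the span of the eigenvectors of `∇²J(θ)` with positive eigenvalue has smallest
eigenvalue at least `σl²`. -/
def CorrelatedCurvature (E : MDP S A) (π : Policy M S A) (γ : ℝ) (H : ℕ)
    (μ l δ ω σl : ℝ) : Prop :=
  ∀ θ ∈ strictSaddle (objective E π γ) μ l δ ω,
    ∀ v ∈ ⨆ (a : ℝ) (_ : 0 < a), Module.End.eigenspace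
        (hessian (objective E π γ) θ : Param M →ₗ[ℝ] Param M) a,
      σl ^ 2 * ‖v‖ ^ 2 ≤ ⟪v, noiseCov E π γ H θ v⟫

/-- `θ t`, `τ t` are the iterates and the sampled trajectories of policy gradient with the GPOMDP
estimator, horizon `H`, step size `μ` and initial parameter `θ₀`: given `θ_0, …, θ_t`, the
trajectory `τ_t` is sampled from the law of trajectories of length `H` under the policy `π_{θ_t}`,
and `θ_{t+1} = θ_t + μ Ĝ(θ_t; τ_t)`. -/
structure IsRun (E : MDP S A) (π : Policy M S A) (γ : ℝ) (H : ℕ) (μ : ℝ) (θ₀ : Param M)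
    {Ω : Type*} [MeasurableSpace Ω] (P : Measure Ω)
    (θ : ℕ → Ω → Param M) (τ : ℕ → Ω → Fin H → S × A) : Prop where
  measurable_param : ∀ t, Measurable (θ t)
  measurable_traj : ∀ t, Measurable (τ t)
  init : ∀ ω, θ 0 ω = θ₀
  sample : ∀ t (C : Set (Fin H → S × A)), MeasurableSet C →
    P⟦τ t ⁻¹' C | ⨆ i ∈ Set.Iic t, MeasurableSpace.comap (θ i) inferInstance⟧
      =ᵐ[P] fun ω => (trajLaw E π H (θ t ω)).real C
  update : ∀ t ω, θ (t + 1) ω = θ t ω + μ • gpomdp E π γ H (θ t ω) (τ t ω)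

end

/-- The smoothness constant `L` of the objective. -/
def smoothConst (Rmax G B γ : ℝ) : ℝ :=
  Rmax * B / (1 - γ) ^ 2 + (1 + γ) * Rmax * G ^ 2 / (1 - γ) ^ 3

/-- The bound `σ` on the gradient estimator. -/
def sigmaConst (Rmax G γ : ℝ) : ℝ := G * Rmax / (1 - γ) ^ 2

/-- The constant `D` of the truncation bias. -/
def biasConst (Rmax G γ : ℝ) : ℝ := G * Rmax / (1 - γ)

/-- The upper bound `ε² δ / (L σ² + D²)` on the step size. -/
def stepBound (Rmax G B γ δ ε : ℝ) : ℝ :=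
  ε ^ 2 * δ / (smoothConst Rmax G B γ * sigmaConst Rmax G γ ^ 2 + biasConst Rmax G γ ^ 2)

/-- The parameter `ℓ = L σ² - D² μ` of the large-gradient region. -/
def ellConst (Rmax G B γ μ : ℝ) : ℝ :=
  smoothConst Rmax G B γ * sigmaConst Rmax G γ ^ 2 - biasConst Rmax G γ ^ 2 * μ

end PolicyGradient

end

/-! The iterates form a Markov chain and `J` is a bounded Lyapunov function for it. Suppose that
from every non-stationary point the chain gains, up to some bounded stopping time, at least `κ`
units of `J` per step in expectation. Then the expected number of steps before the first stationary
point is at most `(2 Rmax / (1 - γ) + 1) / κ`, and Markov's inequality turns this into a bound with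
probability `1 - δ`. `HasEpisode` is the certificate for such a gain, and
`expectedStay_le_of_hasEpisode` draws the conclusion by backward induction instead of optional
stopping.

Likelihood ratios and the score-function identity show that `J` is `C²` with Hessian norm at most
`L` and Lipschitz Hessian. The estimator is bounded by `σ`, and its bias is a tail of the gradient
series, of order `ε ^ 4` once `H` is logarithmic.

There are two kinds of episodes. Where the gradient is large, one step suffices: `μ ‖∇J‖²` beats the
second-order loss `L μ² σ²`. At a strict saddle `a` the episode has about `K / (μ s)` steps. In an
eigenbasis of the Hessian the quadratic model splits into functions `q y = g y + λ y² / 2`. One step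
of size `μ` changes `q` in expectation to at least `(1 + μ λ) q + μ g² / 2 + μ² λ Var / 2`, minus a
bias term. Weighting direction `i` by `(1 + μ λ_i) ^ m` when `m` steps remain makes this recursion
telescope. Over the whole episode each negative direction loses at most `μ σ² / 2`, however long the
episode is.

The gain comes from the noise along the top eigenvector or from the gradient at `a`. The rate `s ≥
λ_top` decides between them: it keeps `∑ g_i² / (s + |λ_i|)` at most `C μ`, with equality unless `s
= λ_top`. In the first case the drift pays, in the second the noise. Model errors and an early exit
from the region `ρ ‖x - a‖ ≤ s` are absorbed by the penalty `κ₀ (1 + ‖d‖² / m₀²)³`, whose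
expectation grows by a factor of at most `1 + 61 μ s` per step. This needs `μ` small against `s³`,
which holds since `μ` is of order `ε²` and `s ≥ √(χ ε)`.

The guaranteed gain per step is of order `μ² √(χ ε)`, that is `ε ^ (9/2)`. Hence `O(ε ^ (-9/2))`
iterations suffice, well within the claimed bound, and no logarithm is needed. The constants `ρ` and
`β` affect only how small `ε` must be. -/

noncomputable section

namespace PolicyGradient

/-! ### Lyapunov bound for the time a Markov chain spends in a set. -/

section Chain

variable {X : Type*} [MeasurableSpace X]

/-- The expected number of steps, among the first `n`, that a Markov chain started at `x` makes
before it leaves `N`. -/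
def expectedStay (Q : Kernel X X) (N : Set X) : ℕ → X → ℝ
  | 0 => fun _ => 0
  | n + 1 => N.indicator fun x => 1 + ∫ y, expectedStay Q N n y ∂(Q x)

lemma measurable_expectedStay (Q : Kernel X X) [IsMarkovKernel Q] {N : Set X}
    (hN : MeasurableSet N) (n : ℕ) : Measurable (expectedStay Q N n) := by
  induction n with
  | zero => exact measurable_const
  | succ n ih =>
    refine Measurable.indicator ?_ hN
    exact measurable_const.add (ih.stronglyMeasurable.integral_kernel (κ := Q)).measurable

lemma expectedStay_bounds (Q : Kernel X X) [IsMarkovKernel Q] (N : Set X)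
    (n : ℕ) (x : X) :
    0 ≤ expectedStay Q N n x ∧ expectedStay Q N n x ≤ n := by
  induction n generalizing x with
  | zero => simp [expectedStay]
  | succ n ih =>
    by_cases hx : x ∈ N
    · simp only [expectedStay, Set.indicator_of_mem hx]
      have h1 : 0 ≤ ∫ y, expectedStay Q N n y ∂(Q x) := integral_nonneg fun y => (ih y).1
      have h2 : ∫ y, expectedStay Q N n y ∂(Q x) ≤ ∫ y, (n : ℝ) ∂(Q x) := by
        refine integral_mono_of_nonneg (.of_forall fun y => (ih y).1) (integrable_const _)
          (.of_forall fun y => (ih y).2)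
      rw [integral_const, probReal_univ, one_smul] at h2
      push_cast
      constructor <;> linarith
    · simp only [expectedStay, Set.indicator_of_notMem hx]
      push_cast
      exact ⟨le_rfl, by positivity⟩

lemma integrable_expectedStay (Q : Kernel X X) [IsMarkovKernel Q] {N : Set X}
    (hN : MeasurableSet N) (n : ℕ) (P : Measure X) [IsFiniteMeasure P] :
    Integrable (expectedStay Q N n) P := by
  refine Integrable.of_bound (measurable_expectedStay Q hN n).aestronglyMeasurable n
    (.of_forall fun x => ?_)
  rw [Real.norm_eq_abs, abs_of_nonneg (expectedStay_bounds Q N n x).1]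
  exact (expectedStay_bounds Q N n x).2

/-- A certificate that the chain started at `a` gains at least `κ` units of `f` per step in
expectation until a bounded time at which it is stopped: `Ψ m` bounds the value of the stopped
chain from below when `m` steps remain, and the chain is stopped when it leaves `D`. -/
def HasEpisode (Q : Kernel X X) (f : X → ℝ) (κ B : ℝ) (a : X) : Prop :=
  ∃ (T : ℕ) (D : Set X) (Ψ : ℕ → X → ℝ), a ∈ D ∧ (∀ m, ∀ x ∈ D, Integrable (Ψ m) (Q x)) ∧
    f a ≤ Ψ (T + 1) a ∧ (∀ m ≤ T, ∀ x ∈ D, Ψ (m + 1) x + κ ≤ ∫ y, Ψ m y ∂(Q x)) ∧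
    (∀ x, Ψ 0 x ≤ f x) ∧ (∀ m ≤ T, ∀ x, x ∉ D → Ψ m x ≤ f x) ∧ ∀ m ≤ T, ∀ x ∈ D, Ψ m x ≤ B

/-- Were the chain stopped at the end of each episode, the gain of `κ` per step and the bound `f ≤
B` would limit the total time. The induction on the number of steps does this without stopping
times: when an episode ends, the remaining time is shorter and the claim for `f` is already
available. -/
theorem expectedStay_le_of_hasEpisode (Q : Kernel X X) [IsMarkovKernel Q] {N : Set X}
    (hN : MeasurableSet N) {f : X → ℝ} {κ B : ℝ} (hf : ∀ x, f x ≤ B)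
    (h : ∀ a ∈ N, HasEpisode Q f κ B a) (n : ℕ) (x : X) :
    κ * expectedStay Q N n x + f x ≤ B := by
  have key : ∀ n, ∀ j ≤ n, ∀ x, κ * expectedStay Q N j x + f x ≤ B := by
    intro n
    induction n with
    | zero =>
      intro j hj x
      obtain rfl : j = 0 := by omega
      simpa [expectedStay] using hf x
    | succ n ih =>
      intro j hj x
      rcases Nat.lt_or_ge j (n + 1) with hlt | hge
      · exact ih j (by omega) x
      obtain rfl : j = n + 1 := by omega
      by_cases hx : x ∈ N
      swap
      · simpa [expectedStay, hx] using hf x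
      obtain ⟨T, D, Ψ, haD, hint, hstart, hstep, hend, hexit, hbd⟩ := h x hx
      have step : ∀ j, ∀ m ≤ T, (∀ y, κ * expectedStay Q N j y ≤ B - Ψ m y) →
          ∀ y ∈ D, κ * (1 + ∫ z, expectedStay Q N j z ∂(Q y)) ≤ B - Ψ (m + 1) y := by
        intro j m hm hy y hyD
        have h1 : ∫ z, κ * expectedStay Q N j z ∂(Q y) ≤ ∫ z, (B - Ψ m z) ∂(Q y) :=
          integral_mono ((integrable_expectedStay Q hN j _).const_mul κ)
            ((integrable_const _).sub (hint m y hyD)) hy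
        rw [integral_const_mul, integral_sub (integrable_const _) (hint m y hyD), integral_const,
          probReal_univ, one_smul] at h1
        linarith [hstep m hm y hyD]
      -- During the episode `Ψ m` plays the role of `f`. Four cases occur: the clock has run out or
      -- the chain has left `D` (then `Ψ ≤ f` and the outer induction applies), the chain is still
      -- in `N` (one step, gain `κ`), or it has left `N` (nothing more is counted, and `Ψ ≤ B`).
      have claim : ∀ m ≤ T, ∀ j ≤ n, ∀ y, κ * expectedStay Q N j y ≤ B - Ψ m y := by
        intro m
        induction m with
        | zero => intro _ j hj y; linarith [ih j hj y, hend y]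
        | succ m ihm =>
          intro hm j hj y
          by_cases hyD : y ∈ D
          swap
          · linarith [ih j hj y, hexit (m + 1) hm y hyD]
          by_cases hyN : y ∈ N
          · cases j with
            | zero => simpa [expectedStay] using hbd (m + 1) hm y hyD
            | succ j =>
              simp only [expectedStay, Set.indicator_of_mem hyN]
              exact step j m (by omega) (ihm (by omega) j (by omega)) y hyD
          · have : expectedStay Q N j y = 0 := by
              cases j <;> simp [expectedStay, hyN]
            rw [this]
            linarith [hbd (m + 1) hm y hyD]
      have := step n T le_rfl (claim T le_rfl n le_rfl) x haD
      simp only [expectedStay, Set.indicator_of_mem hx]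
      linarith
  exact key n n le_rfl x

end Chain

/-! ### From conditional laws to kernels. -/

section Sampling

variable {Ω X Y : Type*} [MeasurableSpace X] [MeasurableSpace Y]

/-- If the conditional law of `V` given `m` is `κ U`, then on every event of `m` the joint law of
`(U, V)` is the composition product of the law of `U` with `κ`. -/
lemma map_prodMk_restrict_eq_compProd {m mΩ : MeasurableSpace Ω} (P : Measure Ω)
    [IsProbabilityMeasure P] (hm : m ≤ mΩ) (κ : Kernel X Y) [IsMarkovKernel κ] {U : Ω → X}
    {V : Ω → Y} (hU : Measurable[m] U) (hV : Measurable V)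
    (h : ∀ C, MeasurableSet C → P⟦V ⁻¹' C | m⟧ =ᵐ[P] fun ω => (κ (U ω)).real C)
    {A : Set Ω} (hA : MeasurableSet[m] A) :
    (P.restrict A).map (fun ω => (U ω, V ω)) = ((P.restrict A).map U) ⊗ₘ κ := by
  have hU' : Measurable U := hU.mono hm le_rfl
  have hpair : Measurable fun ω => (U ω, V ω) := hU'.prodMk hV
  refine Measure.ext_prod (fun {s} {t} hs ht => ?_)
  rw [Measure.map_apply hpair (hs.prod ht), Measure.compProd_apply_prod hs ht,
    setLIntegral_map hs (Kernel.measurable_coe κ ht) hU']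
  have e1 : (fun ω => (U ω, V ω)) ⁻¹' s ×ˢ t = U ⁻¹' s ∩ V ⁻¹' t := by
    ext ω; simp
  rw [e1, Measure.restrict_apply ((hU' hs).inter (hV ht)), Measure.restrict_restrict (hU' hs)]
  -- This set lies in the conditioning σ-algebra, so integrating the conditional probability over it
  -- gives back the probability of the intersection with `V ⁻¹' t`.
  have hB : MeasurableSet[m] (U ⁻¹' s ∩ A) := (hU hs).inter hA
  have hB' := hm _ hB
  have h2 := setIntegral_condExp (μ := P) (m := m) hm
    (f := (V ⁻¹' t).indicator fun _ => (1 : ℝ))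
    ((integrable_const _).indicator (hV ht)) hB
  have h3 : ∫ ω in U ⁻¹' s ∩ A, (κ (U ω)).real t ∂P
      = P.real (U ⁻¹' s ∩ A ∩ V ⁻¹' t) := by
    rw [← setIntegral_congr_ae hB' ((h t ht).mono fun ω hω _ => hω), h2,
      setIntegral_indicator (hV ht)]
    simp
  have h4 : ∫⁻ ω in U ⁻¹' s ∩ A, κ (U ω) t ∂P
      = ENNReal.ofReal (∫ ω in U ⁻¹' s ∩ A, (κ (U ω)).real t ∂P) := by
    have hmeas : Measurable fun ω => (κ (U ω)).real t :=
      ((Kernel.measurable_coe κ ht).comp hU').ennreal_toReal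
    rw [ofReal_integral_eq_lintegral_ofReal]
    · refine lintegral_congr fun ω => ?_
      rw [ofReal_measureReal]
    · refine Integrable.of_bound hmeas.aestronglyMeasurable 1 (.of_forall fun ω => ?_)
      rw [Real.norm_eq_abs, abs_of_nonneg measureReal_nonneg]
      exact measureReal_le_one
    · exact .of_forall fun ω => measureReal_nonneg
  rw [h4, h3, ofReal_measureReal]
  congr 1
  ext ω
  simp only [Set.mem_inter_iff, Set.mem_preimage]
  tauto

end Sampling

/-! ### The staying probability of a process with prescribed one-step laws. -/

section Stay

variable {Ω X : Type*} {mΩ : MeasurableSpace Ω} [MeasurableSpace X]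

lemma integral_measure_comp {Y : Type*} [MeasurableSpace Y] (Q : Kernel X Y) [IsMarkovKernel Q]
    (μ : Measure X) [SFinite μ] {φ : Y → ℝ} (hφ : Measurable φ) (hint : Integrable φ (Q ∘ₘ μ)) :
    ∫ y, φ y ∂(Q ∘ₘ μ) = ∫ x, ∫ y, φ y ∂(Q x) ∂μ := by
  rw [← Measure.snd_compProd] at hint ⊢
  rw [Measure.snd, integral_map measurable_snd.aemeasurable hφ.aestronglyMeasurable]
  exact Measure.integral_compProd
    ((integrable_map_measure hφ.aestronglyMeasurable measurable_snd.aemeasurable).1 hint)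

/-- A process whose one-step conditional expectations are given by the kernel `Q` is a Markov chain
as far as the time spent in `N` is concerned. -/
lemma mul_measureReal_stay_le (P : Measure Ω) [IsProbabilityMeasure P] (Q : Kernel X X)
    [IsMarkovKernel Q] {N : Set X} (hN : MeasurableSet N) {θ : ℕ → Ω → X}
    (hθ : ∀ t, Measurable (θ t)) {x₀ : X} (h0 : ∀ ω, θ 0 ω = x₀)
    (hstep : ∀ t (A : Set Ω),
      MeasurableSet[⨆ i ∈ Set.Iic t, MeasurableSpace.comap (θ i) inferInstance] A →
      ((P.restrict A).map (θ (t + 1))) = Q ∘ₘ ((P.restrict A).map (θ t))) (n : ℕ) :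
    n * P.real {ω | ∀ t < n, θ t ω ∈ N} ≤ expectedStay Q N n x₀ := by
  set A : ℕ → Set Ω := fun t => {ω | ∀ i < t, θ i ω ∈ N} with hAdef
  have hAm : ∀ t, MeasurableSet[⨆ i ∈ Set.Iic t, MeasurableSpace.comap (θ i) inferInstance]
      (A (t + 1)) := by
    intro t
    have : A (t + 1) = ⋂ i ∈ Finset.range (t + 1), θ i ⁻¹' N := by
      ext ω; simp [hAdef]
    rw [this]
    refine Finset.measurableSet_biInter _ fun i hi => ?_
    have hle : MeasurableSpace.comap (θ i) inferInstance
        ≤ ⨆ i ∈ Set.Iic t, MeasurableSpace.comap (θ i) inferInstance :=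
      le_iSup₂_of_le i (by simpa [Nat.lt_succ_iff] using hi) le_rfl
    exact hle _ ⟨N, hN, rfl⟩
  have hle : ∀ t, (⨆ i ∈ Set.Iic t, MeasurableSpace.comap (θ i) inferInstance) ≤ mΩ :=
    fun t => iSup₂_le fun i _ => (hθ i).comap_le
  have hAm0 : ∀ t, MeasurableSet (A t) := by
    intro t
    cases t with
    | zero => simp [hAdef]
    | succ t => exact hle t _ (hAm t)
  -- One unfolding of the recursion along the process: a step still in `N` contributes its
  -- probability, and the rest is pushed forward by `Q`, because the event `A (t + 1)` depends only
  -- on the iterates up to `t`.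
  have hsplit : ∀ t j, ∫ ω in A t, expectedStay Q N (j + 1) (θ t ω) ∂P
      = P.real (A (t + 1)) + ∫ ω in A (t + 1), expectedStay Q N j (θ (t + 1) ω) ∂P := by
    intro t j
    have hA1 : A (t + 1) = A t ∩ θ t ⁻¹' N := by
      ext ω
      simp only [hAdef, Set.mem_ofPred_eq, Set.mem_inter_iff, Set.mem_preimage]
      constructor
      · intro h; exact ⟨fun i hi => h i (by omega), h t (by omega)⟩
      · rintro ⟨h1, h2⟩ i hi
        rcases Nat.lt_succ_iff_lt_or_eq.1 hi with h | rfl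
        exacts [h1 i h, h2]
    have e1 : ∫ ω in A t, expectedStay Q N (j + 1) (θ t ω) ∂P
        = ∫ ω in A (t + 1), (1 + ∫ y, expectedStay Q N j y ∂(Q (θ t ω))) ∂P := by
      rw [hA1, ← setIntegral_indicator (hθ t hN)]
      rfl
    have hme := measurable_expectedStay Q hN j
    have hk := (hme.stronglyMeasurable.integral_kernel (κ := Q)).measurable
    have hint : Integrable (fun ω => ∫ y, expectedStay Q N j y ∂(Q (θ t ω)))
        (P.restrict (A (t + 1))) := by
      refine Integrable.of_bound (hk.comp (hθ t)).aestronglyMeasurable j (.of_forall fun ω => ?_)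
      refine (norm_integral_le_of_norm_le_const (C := j) (.of_forall fun y => ?_)).trans ?_
      · rw [Real.norm_eq_abs, abs_of_nonneg (expectedStay_bounds Q N j y).1]
        exact (expectedStay_bounds Q N j y).2
      · simp
    rw [e1, integral_add (integrable_const _) hint]
    congr 1
    · simp
    · rw [← integral_map (φ := θ (t + 1)) (hθ _).aemeasurable hme.aestronglyMeasurable,
        hstep t _ (hAm t), integral_measure_comp Q _ hme (integrable_expectedStay Q hN j _),
        integral_map (hθ t).aemeasurable hk.aestronglyMeasurable]
  have hsum : ∀ k t, ∑ i ∈ Finset.range k, P.real (A (t + i + 1))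
      ≤ ∫ ω in A t, expectedStay Q N k (θ t ω) ∂P := by
    intro k
    induction k with
    | zero => intro t; simp [expectedStay]
    | succ k ih =>
      intro t
      rw [hsplit, Finset.sum_range_succ', add_comm]
      refine add_le_add (by simp) ?_
      refine le_trans (le_of_eq ?_) (ih (t + 1))
      refine Finset.sum_congr rfl fun i _ => ?_
      congr 2
      omega
  have hmain := hsum n 0
  have e0 : ∫ ω in A 0, expectedStay Q N n (θ 0 ω) ∂P = expectedStay Q N n x₀ := by
    have : A 0 = Set.univ := by ext; simp [hAdef]
    simp [this, h0]
  rw [e0] at hmain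
  refine le_trans ?_ hmain
  -- The events decrease in `t`, so each of the `n` terms is at least the last one.
  have : ∀ i ∈ Finset.range n, P.real (A n) ≤ P.real (A (0 + i + 1)) := by
    intro i hi
    refine measureReal_mono fun ω hω j hj => hω j ?_
    have := Finset.mem_range.1 hi
    omega
  simpa using Finset.card_nsmul_le_sum _ _ _ this

end Stay

/-! ### Likelihood ratios of paths under two parameters. -/

section ChangeOfMeasure

variable {M : ℕ} {S A : Type*} [MeasurableSpace S] [MeasurableSpace A]

instance (E : MDP S A) (π : Policy M S A) (θ : Param M) :
    IsProbabilityMeasure (pathLaw E π θ) := by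
  unfold pathLaw; infer_instance

/-- The initial segment `(s_0, a_0), …, (s_n, a_n)` of a path. -/
def initSegment {S A : Type*} (n : ℕ) (τ : ℕ → S × A) : Finset.Iic n → S × A := fun i => τ i

omit [MeasurableSpace S] [MeasurableSpace A] in
lemma initSegment_eq_frestrictLe (n : ℕ) :
    (initSegment n : (ℕ → S × A) → _) = Preorder.frestrictLe (π := fun _ => S × A) n := rfl

lemma measurable_initSegment (n : ℕ) : Measurable (initSegment (S := S) (A := A) n) :=
  measurable_pi_lambda _ fun _ => measurable_pi_apply _

lemma lintegral_policy_kernel (π : Policy M S A) (θ : Param M) (s : S)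
    {F : A → ENNReal} (hF : Measurable F) :
    ∫⁻ a, F a ∂(π.kernel θ s) = ∫⁻ a, ENNReal.ofReal (π.density θ s a) * F a ∂π.base := by
  have hm : Measurable (Function.uncurry fun s a => ENNReal.ofReal (π.density θ s a)) :=
    (π.measurable_density θ).ennreal_ofReal
  rw [Policy.kernel, Kernel.lintegral_withDensity _ hm _ hF, Kernel.const_apply]

/-- The logarithm of the likelihood ratio `π_θ(a | s) / π_θ₀(a | s)`. -/
def Policy.logRatio (π : Policy M S A) (θ₀ θ : Param M) (z : S × A) : ℝ :=
  Real.log (π.density θ z.1 z.2) - Real.log (π.density θ₀ z.1 z.2)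

lemma Policy.measurable_logRatio (π : Policy M S A) (θ₀ θ : Param M) :
    Measurable (π.logRatio θ₀ θ) :=
  (π.measurable_density θ).log.sub (π.measurable_density θ₀).log

lemma lintegral_policy_kernel_change (π : Policy M S A)
    (hpos : ∀ θ s a, 0 < π.density θ s a) (θ₀ θ : Param M) (s : S)
    {F : A → ENNReal} (hF : Measurable F) :
    ∫⁻ a, F a ∂(π.kernel θ s)
      = ∫⁻ a, F a * ENNReal.ofReal (Real.exp (π.logRatio θ₀ θ (s, a))) ∂(π.kernel θ₀ s) := by
  have hm : Measurable fun a => ENNReal.ofReal (Real.exp (π.logRatio θ₀ θ (s, a))) :=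
    ((π.measurable_logRatio θ₀ θ).comp measurable_prodMk_left).exp.ennreal_ofReal
  have hFm : Measurable fun a => F a * ENNReal.ofReal (Real.exp (π.logRatio θ₀ θ (s, a))) :=
    hF.mul hm
  rw [lintegral_policy_kernel π θ s hF, lintegral_policy_kernel π θ₀ s hFm]
  refine lintegral_congr fun a => ?_
  have : π.density θ s a = π.density θ₀ s a * Real.exp (π.logRatio θ₀ θ (s, a)) := by
    rw [Policy.logRatio, Real.exp_sub, Real.exp_log (hpos _ _ _), Real.exp_log (hpos _ _ _)]
    field_simp [(hpos θ₀ s a).ne']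
  rw [this, ENNReal.ofReal_mul (hpos _ _ _).le]
  ring

lemma lintegral_stepKernel_change (E : MDP S A) (π : Policy M S A)
    (hpos : ∀ θ s a, 0 < π.density θ s a) (θ₀ θ : Param M) (z : S × A)
    {F : S × A → ENNReal} (hF : Measurable F) :
    ∫⁻ y, F y ∂(stepKernel E π θ z)
      = ∫⁻ y, F y * ENNReal.ofReal (Real.exp (π.logRatio θ₀ θ y)) ∂(stepKernel E π θ₀ z) := by
  have hm : Measurable fun y => ENNReal.ofReal (Real.exp (π.logRatio θ₀ θ y)) :=
    (π.measurable_logRatio θ₀ θ).exp.ennreal_ofReal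
  have hFm : Measurable fun y => F y * ENNReal.ofReal (Real.exp (π.logRatio θ₀ θ y)) := hF.mul hm
  rw [stepKernel, stepKernel, Kernel.lintegral_compProd _ _ _ hF,
    Kernel.lintegral_compProd _ _ _ hFm]
  refine lintegral_congr fun s => ?_
  simp only [Kernel.prodMkLeft_apply]
  exact lintegral_policy_kernel_change π hpos θ₀ θ s (hF.comp measurable_prodMk_left)

lemma lintegral_init_change (E : MDP S A) (π : Policy M S A)
    (hpos : ∀ θ s a, 0 < π.density θ s a) (θ₀ θ : Param M)
    {F : S × A → ENNReal} (hF : Measurable F) :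
    ∫⁻ y, F y ∂(E.init ⊗ₘ π.kernel θ)
      = ∫⁻ y, F y * ENNReal.ofReal (Real.exp (π.logRatio θ₀ θ y)) ∂(E.init ⊗ₘ π.kernel θ₀) := by
  have hm : Measurable fun y => ENNReal.ofReal (Real.exp (π.logRatio θ₀ θ y)) :=
    (π.measurable_logRatio θ₀ θ).exp.ennreal_ofReal
  have hFm : Measurable fun y => F y * ENNReal.ofReal (Real.exp (π.logRatio θ₀ θ y)) := hF.mul hm
  rw [Measure.lintegral_compProd hF, Measure.lintegral_compProd hFm]
  exact lintegral_congr fun s =>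
    lintegral_policy_kernel_change π hpos θ₀ θ s (hF.comp measurable_prodMk_left)

lemma lintegral_pathLaw_zero (E : MDP S A) (π : Policy M S A) (θ : Param M)
    {F : (Finset.Iic 0 → S × A) → ENNReal} (hF : Measurable F) :
    ∫⁻ τ, F (initSegment 0 τ) ∂(pathLaw E π θ)
      = ∫⁻ z, F (fun _ => z) ∂(E.init ⊗ₘ π.kernel θ) := by
  rw [← lintegral_map hF (measurable_initSegment 0), initSegment_eq_frestrictLe, pathLaw,
    Kernel.trajMeasure, Measure.map_comp _ _ (by fun_prop), Kernel.traj_map_frestrictLe,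
    Kernel.partialTraj_zero, Measure.deterministic_comp_eq_map, lintegral_map hF (Preorder.measurable_frestrictLe₂ _)]
  have hF' : Measurable fun y : Finset.Iic 0 → S × A =>
      F (Preorder.frestrictLe₂ (π := fun _ => S × A) le_rfl y) :=
    hF.comp (Preorder.measurable_frestrictLe₂ _)
  rw [lintegral_map hF' (by fun_prop)]
  rfl

/-- A segment extended by one more state-action pair. -/
def extendSegment {S A : Type*} (n : ℕ) (p : (Finset.Iic n → S × A) × (S × A)) :
    Finset.Iic (n + 1) → S × A :=
  fun i => if h : (i : ℕ) ≤ n then p.1 ⟨i, Finset.mem_Iic.2 h⟩ else p.2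

lemma measurable_extendSegment (n : ℕ) : Measurable (extendSegment (S := S) (A := A) n) := by
  refine measurable_pi_lambda _ fun i => ?_
  unfold extendSegment
  split_ifs with h
  · exact (measurable_pi_apply _).comp measurable_fst
  · exact measurable_snd

omit [MeasurableSpace S] [MeasurableSpace A] in
lemma extendSegment_initSegment (n : ℕ) (τ : ℕ → S × A) :
    extendSegment n (initSegment n τ, τ (n + 1)) = initSegment (n + 1) τ := by
  funext i
  have hi := Finset.mem_Iic.1 i.2
  unfold extendSegment initSegment
  split_ifs with h
  · rfl
  · have : (i : ℕ) = n + 1 := by omega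
    rw [this]

lemma lintegral_pathLaw_succ (E : MDP S A) (π : Policy M S A) (θ : Param M) (n : ℕ)
    {F : (Finset.Iic n → S × A) × (S × A) → ENNReal} (hF : Measurable F) :
    ∫⁻ τ, F (initSegment n τ, τ (n + 1)) ∂(pathLaw E π θ)
      = ∫⁻ τ, ∫⁻ z, F (initSegment n τ, z) ∂(stepKernel E π θ (τ n)) ∂(pathLaw E π θ) := by
  have hm : Measurable fun τ : ℕ → S × A => (initSegment n τ, τ (n + 1)) :=
    (measurable_initSegment n).prodMk (measurable_pi_apply _)
  have h := Kernel.map_frestrictLe_trajMeasure_compProd_eq_map_trajMeasure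
    (X := fun _ => S × A) (μ₀ := E.init ⊗ₘ π.kernel θ) (κ := pastKernel E π θ) (a := n)
  have e1 : ∫⁻ τ, F (initSegment n τ, τ (n + 1)) ∂(pathLaw E π θ)
      = ∫⁻ p, F p ∂((pathLaw E π θ).map fun τ : ℕ → S × A => (initSegment n τ, τ (n + 1))) :=
    (lintegral_map hF hm).symm
  have h' : (pathLaw E π θ).map (fun τ : ℕ → S × A => (initSegment n τ, τ (n + 1)))
      = (pathLaw E π θ).map (initSegment n) ⊗ₘ pastKernel E π θ n := h.symm
  rw [e1, h', Measure.lintegral_compProd hF, lintegral_map _ (measurable_initSegment n)]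
  · rfl
  · exact hF.lintegral_kernel_prod_right'

/-- The log-likelihood ratio of the first `n` state-action pairs. -/
def pathLogRatio (π : Policy M S A) (n : ℕ) (θ₀ θ : Param M) (τ : ℕ → S × A) : ℝ :=
  ∑ h ∈ Finset.range n, π.logRatio θ₀ θ (τ h)

lemma measurable_pathLogRatio (π : Policy M S A) (n : ℕ) (θ₀ θ : Param M) :
    Measurable (pathLogRatio π n θ₀ θ) :=
  Finset.measurable_sum _ fun _ _ => (π.measurable_logRatio θ₀ θ).comp (measurable_pi_apply _)

/-- The initial law and the transitions do not depend on the parameter, so only the policy densities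
remain in the ratio. The induction peels off the last state-action pair and applies the hypothesis
to the conditional expectation given the earlier ones. -/
lemma lintegral_pathLaw_change (E : MDP S A) (π : Policy M S A)
    (hpos : ∀ θ s a, 0 < π.density θ s a) (θ₀ θ : Param M) (n : ℕ)
    {F : (Finset.Iic n → S × A) → ENNReal} (hF : Measurable F) :
    ∫⁻ τ, F (initSegment n τ) ∂(pathLaw E π θ)
      = ∫⁻ τ, F (initSegment n τ) * ENNReal.ofReal (Real.exp (pathLogRatio π (n + 1) θ₀ θ τ))
          ∂(pathLaw E π θ₀) := by
  have hr : Measurable fun y => ENNReal.ofReal (Real.exp (π.logRatio θ₀ θ y)) :=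
    (π.measurable_logRatio θ₀ θ).exp.ennreal_ofReal
  induction n with
  | zero =>
    have hm : Measurable fun y : Finset.Iic 0 → S × A =>
        F y * ENNReal.ofReal (Real.exp (π.logRatio θ₀ θ (y ⟨0, Finset.mem_Iic.2 le_rfl⟩))) :=
      hF.mul (hr.comp (measurable_pi_apply _))
    have e := lintegral_pathLaw_zero E π θ₀ hm
    have hF0 : Measurable fun z : S × A => F fun _ => z := hF.comp (by fun_prop)
    rw [lintegral_pathLaw_zero E π θ hF, lintegral_init_change E π hpos θ₀ θ
      hF0, ← e]
    simp [pathLogRatio, initSegment]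
  | succ n ih =>
    have hG : Measurable fun p : (Finset.Iic n → S × A) × (S × A) => F (extendSegment n p) :=
      hF.comp (measurable_extendSegment n)
    have hG' : Measurable fun p : (Finset.Iic n → S × A) × (S × A) =>
        F (extendSegment n p) * ENNReal.ofReal (Real.exp (π.logRatio θ₀ θ p.2)) :=
      hG.mul (hr.comp measurable_snd)
    have hw : Measurable fun y : Finset.Iic n → S × A => ENNReal.ofReal (Real.exp
        (∑ h : Finset.Iic n, π.logRatio θ₀ θ (y h))) :=
      (Finset.measurable_sum _ fun _ _ =>
        (π.measurable_logRatio θ₀ θ).comp (measurable_pi_apply _)).exp.ennreal_ofReal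
    have hsum : ∀ τ : ℕ → S × A, ∑ h : Finset.Iic n, π.logRatio θ₀ θ (initSegment n τ h)
        = pathLogRatio π (n + 1) θ₀ θ τ := by
      intro τ
      have e : Finset.range (n + 1) = Finset.Iic n := by ext; simp
      rw [pathLogRatio, e]
      exact Finset.sum_coe_sort (Finset.Iic n) fun h => π.logRatio θ₀ θ (τ h)
    have hK : Measurable fun y : Finset.Iic n → S × A => ∫⁻ z, F (extendSegment n (y, z)) *
        ENNReal.ofReal (Real.exp (π.logRatio θ₀ θ z))
          ∂(stepKernel E π θ₀ (y ⟨n, Finset.mem_Iic.2 le_rfl⟩)) :=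
      Measurable.lintegral_kernel_prod_right' (κ := pastKernel E π θ₀ n) hG'
    calc ∫⁻ τ, F (initSegment (n + 1) τ) ∂(pathLaw E π θ)
        = ∫⁻ τ, ∫⁻ z, F (extendSegment n (initSegment n τ, z))
            ∂(stepKernel E π θ (τ n)) ∂(pathLaw E π θ) := by
          rw [← lintegral_pathLaw_succ E π θ n hG]
          simp only [extendSegment_initSegment]
      _ = ∫⁻ τ, ∫⁻ z, F (extendSegment n (initSegment n τ, z)) *
            ENNReal.ofReal (Real.exp (π.logRatio θ₀ θ z))
            ∂(stepKernel E π θ₀ (τ n)) ∂(pathLaw E π θ) := by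
          refine lintegral_congr fun τ => ?_
          exact lintegral_stepKernel_change E π hpos θ₀ θ (τ n) (hG.comp measurable_prodMk_left)
      _ = ∫⁻ τ, (∫⁻ z, F (extendSegment n (initSegment n τ, z)) *
            ENNReal.ofReal (Real.exp (π.logRatio θ₀ θ z)) ∂(stepKernel E π θ₀ (τ n))) *
            ENNReal.ofReal (Real.exp (pathLogRatio π (n + 1) θ₀ θ τ)) ∂(pathLaw E π θ₀) := ih hK
      _ = ∫⁻ τ, ∫⁻ z, F (extendSegment n (initSegment n τ, z)) *
            ENNReal.ofReal (Real.exp (π.logRatio θ₀ θ z)) * ENNReal.ofReal (Real.exp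
              (∑ h : Finset.Iic n, π.logRatio θ₀ θ (initSegment n τ h)))
            ∂(stepKernel E π θ₀ (τ n)) ∂(pathLaw E π θ₀) := by
          refine lintegral_congr fun τ => ?_
          have hz : Measurable fun z => F (extendSegment n (initSegment n τ, z)) *
              ENNReal.ofReal (Real.exp (π.logRatio θ₀ θ z)) := hG'.comp measurable_prodMk_left
          rw [lintegral_mul_const _ hz, hsum]
      _ = ∫⁻ τ, F (extendSegment n (initSegment n τ, τ (n + 1))) *
            ENNReal.ofReal (Real.exp (π.logRatio θ₀ θ (τ (n + 1)))) * ENNReal.ofReal (Real.exp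
              (∑ h : Finset.Iic n, π.logRatio θ₀ θ (initSegment n τ h))) ∂(pathLaw E π θ₀) :=
          (lintegral_pathLaw_succ E π θ₀ n (hG'.mul (hw.comp measurable_fst))).symm
      _ = _ := by
          refine lintegral_congr fun τ => ?_
          rw [extendSegment_initSegment, hsum, mul_assoc, ← ENNReal.ofReal_mul (Real.exp_pos _).le,
            ← Real.exp_add]
          congr 3
          rw [pathLogRatio, pathLogRatio, Finset.sum_range_succ _ (n + 1), add_comm]

end ChangeOfMeasure

/-! ### Measurability of derivatives in an auxiliary variable. -/

section DerivativeMeasurability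

variable {M : ℕ} {Z V : Type*} [MeasurableSpace Z] [NormedAddCommGroup V] [NormedSpace ℝ V]

lemma clm_eq_sum_smulRight (T : Param M →L[ℝ] V) :
    T = ∑ i, (EuclideanSpace.proj i : Param M →L[ℝ] ℝ).smulRight
      (T (EuclideanSpace.single i 1)) := by
  ext v
  conv_lhs => rw [← (EuclideanSpace.basisFun (Fin M) ℝ).sum_repr v]
  simp

/-- The derivative of a family of functions with respect to a parameter depends measurably on the
index of the family. -/
lemma stronglyMeasurable_fderiv_param {f : Param M → Z → V} (hf : ∀ θ, StronglyMeasurable (f θ))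
    (hd : ∀ z, Differentiable ℝ fun θ => f θ z) (θ : Param M) :
    StronglyMeasurable fun z => fderiv ℝ (fun η => f η z) θ := by
  have hv : ∀ v, StronglyMeasurable fun z => fderiv ℝ (fun η => f η z) θ v := by
    intro v
    -- A directional derivative is the limit of difference quotients with steps `1 / (n + 1)`;
    -- finitely many directions then determine the whole derivative.
    refine stronglyMeasurable_of_tendsto (u := Filter.atTop)
      (f := fun (n : ℕ) z => ((n : ℝ) + 1) • (f (θ + ((n : ℝ) + 1)⁻¹ • v) z - f θ z))
      (fun n => ((hf _).sub (hf _)).const_smul _) ?_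
    rw [tendsto_pi_nhds]
    intro z
    have h1 := (hd z θ).hasFDerivAt.hasLineDerivAt v
    have h2 := h1.tendsto_slope_zero
    have h3 : Filter.Tendsto (fun n : ℕ => ((n : ℝ) + 1)⁻¹) Filter.atTop (nhdsWithin 0 {0}ᶜ) := by
      refine tendsto_nhdsWithin_iff.2 ⟨?_, .of_forall fun n => ?_⟩
      · simpa using tendsto_one_div_add_atTop_nhds_zero_nat (𝕜 := ℝ)
      · have : (0 : ℝ) < ((n : ℝ) + 1)⁻¹ := by positivity
        exact this.ne'
    refine (h2.comp h3).congr fun n => ?_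
    simp
  have he : (fun z => fderiv ℝ (fun η => f η z) θ) = fun z => ∑ i,
      ContinuousLinearMap.smulRightL ℝ (Param M) V (EuclideanSpace.proj i : Param M →L[ℝ] ℝ)
      (fderiv ℝ (fun η => f η z) θ (EuclideanSpace.single i 1)) := by
    funext z
    exact clm_eq_sum_smulRight _
  rw [he]
  refine Finset.stronglyMeasurable_fun_sum _ fun i _ => ?_
  exact (ContinuousLinearMap.continuous _).comp_stronglyMeasurable (hv _)

end DerivativeMeasurability

/-! ### Scores of paths and differentiation under the path law. -/

section Path

variable {M : ℕ} {S A : Type*} [MeasurableSpace S] [MeasurableSpace A]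

lemma Policy.stronglyMeasurable_score (π : Policy M S A)
    (hd : ∀ s a, Differentiable ℝ fun θ => Real.log (π.density θ s a)) (θ : Param M) :
    StronglyMeasurable fun z : S × A => π.score θ z.1 z.2 := by
  have h := stronglyMeasurable_fderiv_param (f := fun θ (z : S × A) =>
    Real.log (π.density θ z.1 z.2)) (fun θ => (π.measurable_density θ).log.stronglyMeasurable)
    (fun z => hd z.1 z.2) θ
  exact (InnerProductSpace.toDual ℝ (Param M)).symm.continuous.comp_stronglyMeasurable h

lemma Policy.stronglyMeasurable_fderiv_score (π : Policy M S A)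
    (hd : ∀ s a, Differentiable ℝ fun θ => Real.log (π.density θ s a))
    (hs : ∀ s a, Differentiable ℝ fun θ => π.score θ s a) (θ : Param M) :
    StronglyMeasurable fun z : S × A => fderiv ℝ (fun η => π.score η z.1 z.2) θ :=
  stronglyMeasurable_fderiv_param (f := fun θ (z : S × A) => π.score θ z.1 z.2)
    (π.stronglyMeasurable_score hd) (fun z => hs z.1 z.2) θ

/-- The σ-algebra of the first `n + 1` state-action pairs. -/
abbrev pathSigma (S A : Type*) [MeasurableSpace S] [MeasurableSpace A] (n : ℕ) :
    MeasurableSpace (ℕ → S × A) :=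
  MeasurableSpace.comap (initSegment n) inferInstance

lemma pathSigma_le (n : ℕ) : pathSigma S A n ≤ MeasurableSpace.pi :=
  (measurable_initSegment n).comap_le

lemma measurable_coord {n h : ℕ} (hn : h ≤ n) :
    Measurable[pathSigma S A n] fun τ : ℕ → S × A => τ h := by
  have : (fun τ : ℕ → S × A => τ h)
      = (fun y => y ⟨h, Finset.mem_Iic.2 hn⟩) ∘ initSegment n := rfl
  rw [this]
  exact (measurable_pi_apply _).comp (comap_measurable _)

/-- The likelihood ratio relates the two path laws only on the σ-algebra of the first `n + 1` pairs,
so the comparison is made between trimmed measures and lifted to vector-valued integrands. -/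
lemma integral_pathLaw_change (E : MDP S A) (π : Policy M S A)
    (hpos : ∀ θ s a, 0 < π.density θ s a) (θ₀ θ : Param M) (n : ℕ)
    {V : Type*} [NormedAddCommGroup V] [NormedSpace ℝ V] {F : (ℕ → S × A) → V}
    (hF : StronglyMeasurable[pathSigma S A n] F) :
    ∫ τ, F τ ∂(pathLaw E π θ)
      = ∫ τ, Real.exp (pathLogRatio π (n + 1) θ₀ θ τ) • F τ ∂(pathLaw E π θ₀) := by
  have hw : Measurable fun τ => ENNReal.ofReal (Real.exp (pathLogRatio π (n + 1) θ₀ θ τ)) :=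
    (measurable_pathLogRatio π (n + 1) θ₀ θ).exp.ennreal_ofReal
  have hle := pathSigma_le (S := S) (A := A) n
  have htrim : (pathLaw E π θ).trim hle = ((pathLaw E π θ₀).withDensity fun τ =>
      ENNReal.ofReal (Real.exp (pathLogRatio π (n + 1) θ₀ θ τ))).trim hle := by
    refine @Measure.ext _ (pathSigma S A n) _ _ fun s hs => ?_
    rw [trim_measurableSet_eq _ hs, trim_measurableSet_eq _ hs, withDensity_apply _ (hle _ hs)]
    obtain ⟨B, hB, rfl⟩ := hs
    have h := lintegral_pathLaw_change E π hpos θ₀ θ n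
      (F := B.indicator 1) (measurable_one.indicator hB)
    rw [← lintegral_indicator (measurable_initSegment n hB)]
    have e1 : ∫⁻ τ, B.indicator 1 (initSegment n τ) ∂(pathLaw E π θ)
        = pathLaw E π θ (initSegment n ⁻¹' B) := by
      rw [← lintegral_indicator_one (measurable_initSegment n hB)]
      rfl
    rw [← e1, h]
    refine lintegral_congr fun τ => ?_
    by_cases hτ : initSegment n τ ∈ B <;> simp [hτ]
  rw [integral_trim hle hF, htrim, ← integral_trim hle hF,
    integral_withDensity_eq_integral_toReal_smul hw (.of_forall fun _ => ENNReal.ofReal_lt_top)]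
  refine integral_congr_ae (.of_forall fun τ => ?_)
  simp [ENNReal.toReal_ofReal (Real.exp_pos _).le]

/-- The score of the first `n` actions of a path. -/
def pathScore (π : Policy M S A) (n : ℕ) (θ : Param M) (τ : ℕ → S × A) : Param M :=
  ∑ h ∈ Finset.range n, π.score θ (τ h).1 (τ h).2

/-- The Jacobian of the score of the first `n` actions of a path. -/
def pathJacobian (π : Policy M S A) (n : ℕ) (θ : Param M) (τ : ℕ → S × A) :
    Param M →L[ℝ] Param M :=
  ∑ h ∈ Finset.range n, fderiv ℝ (fun η => π.score η (τ h).1 (τ h).2) θ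

variable {E : MDP S A} {π : Policy M S A} {Rmax G B ι : ℝ}

lemma Regular.hasFDerivAt_log (hr : Regular E π Rmax G B ι) (θ : Param M) (s : S) (a : A) :
    HasFDerivAt (fun η => Real.log (π.density η s a)) (innerSL ℝ (π.score θ s a)) θ :=
  (hr.log_differentiable s a θ).hasGradientAt.hasFDerivAt

lemma Regular.abs_logRatio_le (hr : Regular E π Rmax G B ι) (θ₀ θ : Param M) (z : S × A) :
    |π.logRatio θ₀ θ z| ≤ G * ‖θ - θ₀‖ := by
  refine Convex.norm_image_sub_le_of_norm_hasFDerivWithin_le (𝕜 := ℝ)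
    (f := fun η => Real.log (π.density η z.1 z.2)) (s := Set.univ)
    (fun x _ => (hr.hasFDerivAt_log x z.1 z.2).hasFDerivWithinAt) (fun x _ => ?_) convex_univ
    (Set.mem_univ _) (Set.mem_univ _)
  rw [innerSL_apply_norm]
  exact hr.score_le x z.1 z.2

lemma Regular.abs_pathLogRatio_le (hr : Regular E π Rmax G B ι) (n : ℕ) (θ₀ θ : Param M)
    (τ : ℕ → S × A) : |pathLogRatio π n θ₀ θ τ| ≤ n * (G * ‖θ - θ₀‖) := by
  refine (Finset.abs_sum_le_sum_abs _ _).trans ?_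
  simpa using Finset.sum_le_card_nsmul (Finset.range n) _ _
    fun h _ => hr.abs_logRatio_le θ₀ θ (τ h)

lemma Regular.hasFDerivAt_pathLogRatio (hr : Regular E π Rmax G B ι) (n : ℕ) (θ₀ θ : Param M)
    (τ : ℕ → S × A) : HasFDerivAt (fun η => pathLogRatio π n θ₀ η τ)
      (innerSL ℝ (pathScore π n θ τ)) θ := by
  unfold pathLogRatio pathScore
  rw [map_sum]
  exact HasFDerivAt.fun_sum fun h _ => (hr.hasFDerivAt_log θ (τ h).1 (τ h).2).sub_const _

lemma Regular.hasFDerivAt_pathScore (hr : Regular E π Rmax G B ι) (n : ℕ) (θ : Param M)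
    (τ : ℕ → S × A) : HasFDerivAt (fun η => pathScore π n η τ) (pathJacobian π n θ τ) θ :=
  HasFDerivAt.fun_sum fun h _ => (hr.score_differentiable (τ h).1 (τ h).2 θ).hasFDerivAt

lemma Regular.norm_pathScore_le (hr : Regular E π Rmax G B ι) (n : ℕ) (θ : Param M)
    (τ : ℕ → S × A) : ‖pathScore π n θ τ‖ ≤ n * G := by
  refine (norm_sum_le _ _).trans ?_
  simpa using Finset.sum_le_card_nsmul (Finset.range n) _ _
    fun h _ => hr.score_le θ (τ h).1 (τ h).2

lemma Regular.norm_pathJacobian_le (hr : Regular E π Rmax G B ι) (n : ℕ) (θ : Param M)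
    (τ : ℕ → S × A) : ‖pathJacobian π n θ τ‖ ≤ n * B := by
  refine (norm_sum_le _ _).trans ?_
  simpa using Finset.sum_le_card_nsmul (Finset.range n) _ _
    fun h _ => (hr.jacobian_lt θ (τ h).1 (τ h).2).le

lemma Regular.norm_pathJacobian_sub_le (hr : Regular E π Rmax G B ι) (n : ℕ) (θ₁ θ₂ : Param M)
    (τ : ℕ → S × A) :
    ‖pathJacobian π n θ₁ τ - pathJacobian π n θ₂ τ‖ ≤ n * (ι * ‖θ₁ - θ₂‖) := by
  unfold pathJacobian
  rw [← Finset.sum_sub_distrib]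
  refine (norm_sum_le _ _).trans ?_
  simpa using Finset.sum_le_card_nsmul (Finset.range n) _ _
    fun h _ => hr.jacobian_lipschitz θ₁ θ₂ (τ h).1 (τ h).2

lemma Regular.norm_pathScore_sub_le (hr : Regular E π Rmax G B ι) (n : ℕ) (θ₁ θ₂ : Param M)
    (τ : ℕ → S × A) : ‖pathScore π n θ₁ τ - pathScore π n θ₂ τ‖ ≤ n * B * ‖θ₁ - θ₂‖ :=
  Convex.norm_image_sub_le_of_norm_hasFDerivWithin_le (𝕜 := ℝ)
    (f := fun η => pathScore π n η τ) (s := Set.univ)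
    (fun x _ => (hr.hasFDerivAt_pathScore n x τ).hasFDerivWithinAt)
    (fun x _ => hr.norm_pathJacobian_le n x τ) convex_univ (Set.mem_univ _) (Set.mem_univ _)

lemma Regular.stronglyMeasurable_pathScore (hr : Regular E π Rmax G B ι) (n : ℕ) (θ : Param M) :
    StronglyMeasurable[pathSigma S A n] (pathScore π (n + 1) θ) :=
  Finset.stronglyMeasurable_fun_sum _ fun _ hh =>
    (π.stronglyMeasurable_score hr.log_differentiable θ).comp_measurable
      (measurable_coord (Nat.lt_succ_iff.1 (Finset.mem_range.1 hh)))

lemma Regular.stronglyMeasurable_pathJacobian (hr : Regular E π Rmax G B ι) (n : ℕ)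
    (θ : Param M) : StronglyMeasurable[pathSigma S A n] (pathJacobian π (n + 1) θ) :=
  Finset.stronglyMeasurable_fun_sum _ fun _ hh =>
    (π.stronglyMeasurable_fderiv_score hr.log_differentiable hr.score_differentiable
      θ).comp_measurable (measurable_coord (Nat.lt_succ_iff.1 (Finset.mem_range.1 hh)))

/-- The score-function identity: the derivative of the expectation, over the first `n + 1`
state-action pairs, of a function that may itself depend on the parameter. -/
theorem Regular.hasFDerivAt_integral_pathLaw (hr : Regular E π Rmax G B ι) (hG : 0 ≤ G) (n : ℕ)
    {V : Type*} [NormedAddCommGroup V] [NormedSpace ℝ V]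
    {F : Param M → (ℕ → S × A) → V} {F' : Param M → (ℕ → S × A) → Param M →L[ℝ] V} {C C' : ℝ}
    (hF : ∀ θ, StronglyMeasurable[pathSigma S A n] (F θ))
    (hF' : ∀ θ, StronglyMeasurable[pathSigma S A n] (F' θ))
    (hC : ∀ θ τ, ‖F θ τ‖ ≤ C) (hC' : ∀ θ τ, ‖F' θ τ‖ ≤ C')
    (hd : ∀ θ τ, HasFDerivAt (fun η => F η τ) (F' θ τ) θ) (θ₀ : Param M) :
    HasFDerivAt (fun θ => ∫ τ, F θ τ ∂(pathLaw E π θ))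
      (∫ τ, (F' θ₀ τ + (innerSL ℝ (pathScore π (n + 1) θ₀ τ)).smulRight (F θ₀ τ))
        ∂(pathLaw E π θ₀)) θ₀ := by
  have hle := pathSigma_le (S := S) (A := A) n
  -- Freezing the law at `θ₀` moves the dependence on the parameter into this weight. It equals `1`
  -- at `θ₀`, its derivative is the weight times the path score, and it is bounded on the unit ball
  -- around `θ₀`, which gives the domination.
  set w : Param M → (ℕ → S × A) → ℝ :=
    fun θ τ => Real.exp (pathLogRatio π (n + 1) θ₀ θ τ) with hw
  have hwd : ∀ θ τ, HasFDerivAt (fun η => w η τ)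
      (w θ τ • innerSL ℝ (pathScore π (n + 1) θ τ)) θ := fun θ τ =>
    (hr.hasFDerivAt_pathLogRatio (n + 1) θ₀ θ τ).exp
  have hwm : ∀ θ, StronglyMeasurable (w θ) := fun θ =>
    (measurable_pathLogRatio π (n + 1) θ₀ θ).exp.stronglyMeasurable
  have hw0 : ∀ τ, w θ₀ τ = 1 := fun τ => by simp [hw, pathLogRatio, Policy.logRatio]
  have hfun : (fun θ => ∫ τ, F θ τ ∂(pathLaw E π θ))
      = fun θ => ∫ τ, w θ τ • F θ τ ∂(pathLaw E π θ₀) := by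
    funext θ
    exact integral_pathLaw_change E π hr.density_pos θ₀ θ n (hF θ)
  set D : Param M → (ℕ → S × A) → Param M →L[ℝ] V := fun θ τ =>
    w θ τ • F' θ τ + (w θ τ • innerSL ℝ (pathScore π (n + 1) θ τ)).smulRight (F θ τ) with hD
  have hD0 : (fun τ => F' θ₀ τ + (innerSL ℝ (pathScore π (n + 1) θ₀ τ)).smulRight (F θ₀ τ))
      = D θ₀ := by
    funext τ
    simp [hD, hw0]
  have hmD : StronglyMeasurable (D θ₀) := by
    have h1 : StronglyMeasurable fun τ => (innerSL ℝ (pathScore π (n + 1) θ₀ τ)) :=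
      (innerSL ℝ (E := Param M)).continuous.comp_stronglyMeasurable
        ((hr.stronglyMeasurable_pathScore n θ₀).mono hle)
    have h2 : StronglyMeasurable fun τ =>
        (innerSL ℝ (pathScore π (n + 1) θ₀ τ)).smulRight (F θ₀ τ) :=
      (ContinuousLinearMap.smulRightL ℝ (Param M) V).continuous₂.comp_stronglyMeasurable
        (h1.prodMk ((hF θ₀).mono hle))
    rw [← hD0]
    exact ((hF' θ₀).mono hle).add h2
  rw [hfun]
  have hD0' : (∫ τ, (F' θ₀ τ + (innerSL ℝ (pathScore π (n + 1) θ₀ τ)).smulRight (F θ₀ τ))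
        ∂(pathLaw E π θ₀)) = ∫ τ, D θ₀ τ ∂(pathLaw E π θ₀) := by rw [← hD0]
  rw [hD0']
  have hwb : ∀ τ, ∀ θ ∈ Metric.ball θ₀ 1, w θ τ ≤ Real.exp ((n + 1) * G) := by
    intro τ θ hθ
    refine Real.exp_le_exp.2 ((le_abs_self _).trans ((hr.abs_pathLogRatio_le _ _ _ _).trans ?_))
    have : ‖θ - θ₀‖ ≤ 1 := (mem_ball_iff_norm.1 hθ).le
    push_cast
    gcongr
    nlinarith
  refine hasFDerivAt_integral_of_dominated_of_fderiv_le (F := fun θ τ => w θ τ • F θ τ)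
    (F' := D) (bound := fun _ => Real.exp ((n + 1) * G) * (C' + (n + 1) * G * C))
    (Metric.ball_mem_nhds θ₀ one_pos) ?_ ?_ hmD.aestronglyMeasurable ?_ (integrable_const _) ?_
  · exact .of_forall fun θ => ((hwm θ).smul ((hF θ).mono hle)).aestronglyMeasurable
  · refine Integrable.of_bound ((hwm θ₀).smul ((hF θ₀).mono hle)).aestronglyMeasurable C
      (.of_forall fun τ => ?_)
    simpa [hw0] using hC θ₀ τ
  · refine .of_forall fun τ θ hθ => ?_
    have h1 : ‖w θ τ • F' θ τ‖ ≤ Real.exp ((n + 1) * G) * C' := by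
      rw [norm_smul, Real.norm_of_nonneg (Real.exp_pos _).le]
      exact mul_le_mul (hwb τ θ hθ) (hC' θ τ) (norm_nonneg _) (Real.exp_pos _).le
    have h2 : ‖(w θ τ • innerSL ℝ (pathScore π (n + 1) θ τ)).smulRight (F θ τ)‖
        ≤ Real.exp ((n + 1) * G) * ((n + 1) * G * C) := by
      rw [ContinuousLinearMap.norm_smulRight_apply, norm_smul, innerSL_apply_norm,
        Real.norm_of_nonneg (Real.exp_pos _).le, mul_assoc]
      have h3 := hr.norm_pathScore_le (n + 1) θ τ
      push_cast at h3
      refine mul_le_mul (hwb τ θ hθ) ?_ (by positivity) (Real.exp_pos _).le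
      exact mul_le_mul h3 (hC θ τ) (norm_nonneg _) ((norm_nonneg _).trans h3)
    calc ‖D θ τ‖ ≤ _ := norm_add_le _ _
      _ ≤ _ := add_le_add h1 h2
      _ = _ := by ring
  · exact .of_forall fun τ θ _ => (hwd θ τ).smul (hd θ τ)

/-- The expectation of a bounded function of the first `n + 1` state-action pairs is a Lipschitz
function of the parameter. -/
theorem Regular.norm_integral_pathLaw_sub_le (hr : Regular E π Rmax G B ι) (hG : 0 ≤ G) (n : ℕ)
    {V : Type*} [NormedAddCommGroup V] [NormedSpace ℝ V] {F : (ℕ → S × A) → V} {C : ℝ}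
    (hF : StronglyMeasurable[pathSigma S A n] F) (hC : ∀ τ, ‖F τ‖ ≤ C) (θ₁ θ₂ : Param M) :
    ‖∫ τ, F τ ∂(pathLaw E π θ₁) - ∫ τ, F τ ∂(pathLaw E π θ₂)‖
      ≤ (n + 1) * G * C * ‖θ₁ - θ₂‖ := by
  have h := hr.hasFDerivAt_integral_pathLaw hG n (F := fun _ => F) (F' := fun _ _ => 0) (C' := 0)
    (fun _ => hF) (fun _ => stronglyMeasurable_const) (fun _ => hC) (fun _ _ => by simp)
    (fun θ τ => hasFDerivAt_const _ _)
  refine Convex.norm_image_sub_le_of_norm_hasFDerivWithin_le (𝕜 := ℝ) (s := Set.univ)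
    (f := fun θ => ∫ τ, F τ ∂(pathLaw E π θ))
    (fun x _ => (h x).hasFDerivWithinAt) (fun x _ => ?_) convex_univ
    (Set.mem_univ _) (Set.mem_univ _)
  refine (norm_integral_le_of_norm_le_const (C := (n + 1) * G * C) (.of_forall fun τ => ?_)).trans
    (by simp)
  rw [zero_add, ContinuousLinearMap.norm_smulRight_apply, innerSL_apply_norm]
  have h3 := hr.norm_pathScore_le (n + 1) x τ
  push_cast at h3
  exact mul_le_mul h3 (hC τ) (norm_nonneg _) ((norm_nonneg _).trans h3)

end Path

/-! ### Power series behind the constants `σ` and `L`. -/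

section Series

lemma summable_succ_pow_mul_geometric {γ : ℝ} (h0 : 0 < γ) (h1 : γ < 1) (j : ℕ) :
    Summable fun k : ℕ => ((k : ℝ) + 1) ^ j * γ ^ k := by
  have h := summable_pow_mul_geometric_of_norm_lt_one (R := ℝ) j (r := γ)
    (by rwa [Real.norm_of_nonneg h0.le])
  have h2 := ((summable_nat_add_iff 1).2 h).mul_left γ⁻¹
  refine h2.congr fun k => ?_
  push_cast
  rw [pow_succ]
  field_simp

lemma tsum_succ_mul_geometric {γ : ℝ} (h0 : 0 < γ) (h1 : γ < 1) :
    ∑' k : ℕ, ((k : ℝ) + 1) * γ ^ k = 1 / (1 - γ) ^ 2 := by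
  have h := tsum_choose_mul_geometric_of_norm_lt_one (𝕜 := ℝ) 1 (r := γ)
    (by rwa [Real.norm_of_nonneg h0.le])
  simpa using h

lemma tsum_succ_sq_mul_geometric {γ : ℝ} (h0 : 0 < γ) (h1 : γ < 1) :
    ∑' k : ℕ, ((k : ℝ) + 1) ^ 2 * γ ^ k = (1 + γ) / (1 - γ) ^ 3 := by
  have hn : ‖γ‖ < 1 := by rwa [Real.norm_of_nonneg h0.le]
  have h := tsum_choose_mul_geometric_of_norm_lt_one (𝕜 := ℝ) 2 (r := γ) hn
  have hs := summable_choose_mul_geometric_of_norm_lt_one (R := ℝ) 2 (r := γ) hn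
  have hs1 := summable_succ_pow_mul_geometric h0 h1 1
  -- The square is reduced to binomial coefficients by `(k + 1)² = 2 * choose (k + 2) 2 - (k + 1)`.
  have e : ∀ k : ℕ, ((k : ℝ) + 1) ^ 2 * γ ^ k
      = 2 * (((k + 2).choose 2 : ℕ) * γ ^ k) - ((k : ℝ) + 1) ^ 1 * γ ^ k := by
    intro k
    have : (((k + 2).choose 2 : ℕ) : ℝ) = (k + 2) * (k + 1) / 2 := by
      rw [Nat.cast_choose_two]
      push_cast
      ring
    rw [this]
    ring
  simp_rw [e]
  rw [(hs.mul_left 2).tsum_sub hs1, tsum_mul_left, h]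
  simp only [pow_one]
  rw [tsum_succ_mul_geometric h0 h1]
  have : 1 - γ ≠ 0 := by linarith
  field_simp
  ring

end Series

/-! ### Gradient, Hessian and Hessian-Lipschitz bound of the objective. -/

section Objective

variable {M : ℕ} {S A : Type*} [MeasurableSpace S] [MeasurableSpace A]

/-- The expected reward at time `k`. -/
def expReward (E : MDP S A) (π : Policy M S A) (k : ℕ) (θ : Param M) : ℝ :=
  ∫ τ, E.reward (τ k).1 (τ k).2 ∂(pathLaw E π θ)

/-- The gradient of the expected reward at time `k`. -/
def expRewardGrad (E : MDP S A) (π : Policy M S A) (k : ℕ) (θ : Param M) : Param M :=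
  ∫ τ, E.reward (τ k).1 (τ k).2 • pathScore π (k + 1) θ τ ∂(pathLaw E π θ)

/-- The integrand in the formula for the Hessian of the expected reward at time `k`. -/
def hessIntegrand (E : MDP S A) (π : Policy M S A) (k : ℕ) (θ : Param M) (τ : ℕ → S × A) :
    Param M →L[ℝ] Param M :=
  E.reward (τ k).1 (τ k).2 • pathJacobian π (k + 1) θ τ +
    (innerSL ℝ (pathScore π (k + 1) θ τ)).smulRight
      (E.reward (τ k).1 (τ k).2 • pathScore π (k + 1) θ τ)

/-- The Hessian of the expected reward at time `k`. -/
def expRewardHess (E : MDP S A) (π : Policy M S A) (k : ℕ) (θ : Param M) :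
    Param M →L[ℝ] Param M :=
  ∫ τ, hessIntegrand E π k θ τ ∂(pathLaw E π θ)

variable {E : MDP S A} {π : Policy M S A} {Rmax G B ι γ : ℝ}

lemma stronglyMeasurable_reward (E : MDP S A) (k : ℕ) :
    StronglyMeasurable[pathSigma S A k] fun τ : ℕ → S × A => E.reward (τ k).1 (τ k).2 :=
  E.measurable_reward.stronglyMeasurable.comp_measurable (measurable_coord le_rfl)

lemma Regular.Rmax_nonneg (hr : Regular E π Rmax G B ι) (τ : ℕ → S × A) : 0 ≤ Rmax :=
  (abs_nonneg _).trans (hr.reward_le (τ 0).1 (τ 0).2)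

lemma Regular.B_nonneg (hr : Regular E π Rmax G B ι) (τ : ℕ → S × A) : 0 ≤ B :=
  (norm_nonneg _).trans (hr.jacobian_lt 0 (τ 0).1 (τ 0).2).le

lemma Regular.norm_reward_smul_score_le (hr : Regular E π Rmax G B ι) (k : ℕ) (θ : Param M)
    (τ : ℕ → S × A) :
    ‖E.reward (τ k).1 (τ k).2 • pathScore π (k + 1) θ τ‖ ≤ Rmax * ((k + 1) * G) := by
  have h := hr.norm_pathScore_le (k + 1) θ τ
  push_cast at h
  rw [norm_smul]
  exact mul_le_mul (hr.reward_le _ _) h (norm_nonneg _) (hr.Rmax_nonneg τ)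

lemma Regular.norm_expRewardGrad_le (hr : Regular E π Rmax G B ι) (k : ℕ) (θ : Param M) :
    ‖expRewardGrad E π k θ‖ ≤ Rmax * ((k + 1) * G) :=
  (norm_integral_le_of_norm_le_const (.of_forall (hr.norm_reward_smul_score_le k θ))).trans
    (by simp)

/-- The reward at time `k` is a function of the first `k + 1` pairs, so only their scores enter;
this is the policy gradient theorem term by term. -/
lemma Regular.hasFDerivAt_expReward (hr : Regular E π Rmax G B ι) (hG : 0 ≤ G) (k : ℕ)
    (θ : Param M) :
    HasFDerivAt (expReward E π k) (innerSL ℝ (expRewardGrad E π k θ)) θ := by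
  have h := hr.hasFDerivAt_integral_pathLaw hG k
    (F := fun _ τ => E.reward (τ k).1 (τ k).2) (F' := fun _ _ => 0) (C := Rmax) (C' := 0)
    (fun _ => stronglyMeasurable_reward E k) (fun _ => stronglyMeasurable_const)
    (fun _ τ => hr.reward_le _ _) (fun _ _ => by simp) (fun θ τ => hasFDerivAt_const _ _) θ
  have hint : Integrable (fun τ => E.reward (τ k).1 (τ k).2 • pathScore π (k + 1) θ τ)
      (pathLaw E π θ) :=
    Integrable.of_bound (((stronglyMeasurable_reward E k).smul
      (hr.stronglyMeasurable_pathScore k θ)).mono (pathSigma_le k)).aestronglyMeasurable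
      _ (.of_forall (hr.norm_reward_smul_score_le k θ))
  have e : innerSL ℝ (expRewardGrad E π k θ) = ∫ τ, (0 +
      (innerSL ℝ (pathScore π (k + 1) θ τ)).smulRight (E.reward (τ k).1 (τ k).2))
        ∂(pathLaw E π θ) := by
    rw [expRewardGrad, ← ContinuousLinearMap.integral_comp_comm _ hint]
    refine integral_congr_ae (.of_forall fun τ => ?_)
    ext v
    beta_reduce
    rw [zero_add, ContinuousLinearMap.smulRight_apply, smul_eq_mul, mul_comm]
    exact real_inner_smul_left (pathScore π (k + 1) θ τ) v _
  rw [e]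
  exact h

lemma Regular.norm_hessIntegrand_le (hr : Regular E π Rmax G B ι) (k : ℕ) (θ : Param M)
    (τ : ℕ → S × A) :
    ‖hessIntegrand E π k θ τ‖ ≤ Rmax * ((k + 1) * B) + Rmax * ((k + 1) ^ 2 * G ^ 2) := by
  have h1 := hr.norm_pathScore_le (k + 1) θ τ
  have h2 := hr.norm_pathJacobian_le (k + 1) θ τ
  have h3 := hr.norm_reward_smul_score_le k θ τ
  push_cast at h1 h2
  refine (norm_add_le _ _).trans (add_le_add ?_ ?_)
  · rw [norm_smul]
    exact mul_le_mul (hr.reward_le _ _) h2 (norm_nonneg _) (hr.Rmax_nonneg τ)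
  · rw [ContinuousLinearMap.norm_smulRight_apply, innerSL_apply_norm]
    refine (mul_le_mul h1 h3 (norm_nonneg _) ((norm_nonneg _).trans h1)).trans_eq ?_
    ring

lemma Regular.stronglyMeasurable_hessIntegrand (hr : Regular E π Rmax G B ι) (k : ℕ)
    (θ : Param M) : StronglyMeasurable[pathSigma S A k] (hessIntegrand E π k θ) := by
  have h0 := stronglyMeasurable_reward E k
  have h1 := hr.stronglyMeasurable_pathScore k θ
  refine (h0.smul (hr.stronglyMeasurable_pathJacobian k θ)).add ?_
  exact (ContinuousLinearMap.smulRightL ℝ (Param M) (Param M)).continuous₂.comp_stronglyMeasurable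
    (((innerSL ℝ (E := Param M)).continuous.comp_stronglyMeasurable h1).prodMk (h0.smul h1))

lemma Regular.norm_expRewardHess_le (hr : Regular E π Rmax G B ι) (k : ℕ) (θ : Param M) :
    ‖expRewardHess E π k θ‖ ≤ Rmax * ((k + 1) * B) + Rmax * ((k + 1) ^ 2 * G ^ 2) :=
  (norm_integral_le_of_norm_le_const (.of_forall (hr.norm_hessIntegrand_le k θ))).trans
    (by simp)

lemma Regular.hasFDerivAt_expRewardGrad (hr : Regular E π Rmax G B ι) (hG : 0 ≤ G) (k : ℕ)
    (θ : Param M) : HasFDerivAt (expRewardGrad E π k) (expRewardHess E π k θ) θ := by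
  refine hr.hasFDerivAt_integral_pathLaw hG k
    (F := fun θ τ => E.reward (τ k).1 (τ k).2 • pathScore π (k + 1) θ τ)
    (F' := fun θ τ => E.reward (τ k).1 (τ k).2 • pathJacobian π (k + 1) θ τ)
    (C' := Rmax * ((k + 1) * B))
    (fun θ => (stronglyMeasurable_reward E k).smul (hr.stronglyMeasurable_pathScore k θ))
    (fun θ => (stronglyMeasurable_reward E k).smul (hr.stronglyMeasurable_pathJacobian k θ))
    (hr.norm_reward_smul_score_le k) (fun θ τ => ?_)
    (fun θ τ => (hr.hasFDerivAt_pathScore (k + 1) θ τ).fun_const_smul _) θ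
  have h2 := hr.norm_pathJacobian_le (k + 1) θ τ
  push_cast at h2
  rw [norm_smul]
  exact mul_le_mul (hr.reward_le _ _) h2 (norm_nonneg _) (hr.Rmax_nonneg τ)

/-- The rank-one part is split as `u₁ ⊗ u₁ - u₂ ⊗ u₂ = (u₁ - u₂) ⊗ u₁ + u₂ ⊗ (u₁ - u₂)`; the path
score is Lipschitz because its Jacobian is bounded. -/
lemma Regular.norm_hessIntegrand_sub_le (hr : Regular E π Rmax G B ι) (k : ℕ)
    (θ₁ θ₂ : Param M) (τ : ℕ → S × A) :
    ‖hessIntegrand E π k θ₁ τ - hessIntegrand E π k θ₂ τ‖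
      ≤ Rmax * ((k + 1) * |ι| + 2 * (k + 1) ^ 2 * G * B) * ‖θ₁ - θ₂‖ := by
  set R := E.reward (τ k).1 (τ k).2
  set u₁ := pathScore π (k + 1) θ₁ τ
  set u₂ := pathScore π (k + 1) θ₂ τ
  have hR : |R| ≤ Rmax := hr.reward_le _ _
  have h1 := hr.norm_pathScore_le (k + 1) θ₁ τ
  have h2 := hr.norm_pathScore_le (k + 1) θ₂ τ
  have h3 := hr.norm_pathScore_sub_le (k + 1) θ₁ θ₂ τ
  have h4 := hr.norm_pathJacobian_sub_le (k + 1) θ₁ θ₂ τ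
  push_cast at h1 h2 h3 h4
  have hB := hr.B_nonneg τ
  have e : hessIntegrand E π k θ₁ τ - hessIntegrand E π k θ₂ τ
      = R • ((pathJacobian π (k + 1) θ₁ τ - pathJacobian π (k + 1) θ₂ τ)
        + (innerSL ℝ (u₁ - u₂)).smulRight u₁ + (innerSL ℝ u₂).smulRight (u₁ - u₂)) := by
    ext1 v
    simp only [hessIntegrand, sub_apply, add_apply,
      smul_apply, ContinuousLinearMap.smulRight_apply, innerSL_apply_apply,
      inner_sub_left, R, u₁, u₂]
    module
  have hn : ‖(pathJacobian π (k + 1) θ₁ τ - pathJacobian π (k + 1) θ₂ τ)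
        + (innerSL ℝ (u₁ - u₂)).smulRight u₁ + (innerSL ℝ u₂).smulRight (u₁ - u₂)‖
      ≤ ((k + 1) * |ι| + 2 * (k + 1) ^ 2 * G * B) * ‖θ₁ - θ₂‖ := by
    refine (norm_add₃_le).trans ?_
    rw [ContinuousLinearMap.norm_smulRight_apply, ContinuousLinearMap.norm_smulRight_apply,
      innerSL_apply_norm, innerSL_apply_norm]
    have a1 : ((k : ℝ) + 1) * (ι * ‖θ₁ - θ₂‖) ≤ (k + 1) * (|ι| * ‖θ₁ - θ₂‖) := by
      gcongr
      exact le_abs_self ι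
    have a2 : ‖u₁ - u₂‖ * ‖u₁‖ ≤ (k + 1) * B * ‖θ₁ - θ₂‖ * ((k + 1) * G) :=
      mul_le_mul h3 h1 (norm_nonneg _) ((norm_nonneg _).trans h3)
    have a3 : ‖u₂‖ * ‖u₁ - u₂‖ ≤ (k + 1) * G * ((k + 1) * B * ‖θ₁ - θ₂‖) :=
      mul_le_mul h2 h3 (norm_nonneg _) ((norm_nonneg _).trans h2)
    calc _ ≤ (k + 1) * (|ι| * ‖θ₁ - θ₂‖) + (k + 1) * B * ‖θ₁ - θ₂‖ * ((k + 1) * G)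
          + (k + 1) * G * ((k + 1) * B * ‖θ₁ - θ₂‖) := by
            gcongr
            exact h4.trans a1
      _ = _ := by ring
  rw [e, norm_smul, mul_assoc]
  exact mul_le_mul hR hn (norm_nonneg _) (hr.Rmax_nonneg τ)

/-- Two effects add up: the integrand changes with the parameter, and so does the law of the path.
The constant is cubic in `k + 1`, hence summable against `γ ^ k`. -/
lemma Regular.norm_expRewardHess_sub_le (hr : Regular E π Rmax G B ι) (hG : 0 ≤ G) (k : ℕ)
    (θ₁ θ₂ : Param M) :
    ‖expRewardHess E π k θ₁ - expRewardHess E π k θ₂‖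
      ≤ (Rmax * ((k + 1) * |ι| + 2 * (k + 1) ^ 2 * G * B) + (k + 1) * G *
        (Rmax * ((k + 1) * B) + Rmax * ((k + 1) ^ 2 * G ^ 2))) * ‖θ₁ - θ₂‖ := by
  have hint : ∀ θ θ', Integrable (hessIntegrand E π k θ) (pathLaw E π θ') := fun θ θ' =>
    Integrable.of_bound ((hr.stronglyMeasurable_hessIntegrand k θ).mono
      (pathSigma_le k)).aestronglyMeasurable _ (.of_forall (hr.norm_hessIntegrand_le k θ))
  have e : expRewardHess E π k θ₁ - expRewardHess E π k θ₂
      = ∫ τ, (hessIntegrand E π k θ₁ τ - hessIntegrand E π k θ₂ τ) ∂(pathLaw E π θ₁)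
        + (∫ τ, hessIntegrand E π k θ₂ τ ∂(pathLaw E π θ₁)
          - ∫ τ, hessIntegrand E π k θ₂ τ ∂(pathLaw E π θ₂)) := by
    rw [integral_sub (hint _ _) (hint _ _)]
    simp only [expRewardHess]
    abel
  rw [e, add_mul]
  refine (norm_add_le _ _).trans (add_le_add ?_ ?_)
  · exact (norm_integral_le_of_norm_le_const
      (.of_forall (hr.norm_hessIntegrand_sub_le k θ₁ θ₂))).trans (by simp)
  · exact hr.norm_integral_pathLaw_sub_le hG k (hr.stronglyMeasurable_hessIntegrand k θ₂)
      (hr.norm_hessIntegrand_le k θ₂) θ₁ θ₂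

lemma Regular.hasSum_objective (hr : Regular E π Rmax G B ι) (h0 : 0 < γ) (h1 : γ < 1)
    (θ : Param M) : HasSum (fun k => γ ^ k * expReward E π k θ) (objective E π γ θ) := by
  have hm : ∀ k, StronglyMeasurable fun τ : ℕ → S × A => γ ^ k * E.reward (τ k).1 (τ k).2 :=
    fun k => ((stronglyMeasurable_reward E k).mono (pathSigma_le k)).const_mul _
  have hb : ∀ (k : ℕ) (τ : ℕ → S × A), ‖γ ^ k * E.reward (τ k).1 (τ k).2‖ ≤ γ ^ k * Rmax := by
    intro k τ
    rw [norm_mul, Real.norm_of_nonneg (by positivity)]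
    exact mul_le_mul_of_nonneg_left (hr.reward_le _ _) (by positivity)
  have h := hasSum_integral_of_summable_integral_norm (μ := pathLaw E π θ)
    (F := fun k τ => γ ^ k * E.reward (τ k).1 (τ k).2)
    (fun k => Integrable.of_bound (hm k).aestronglyMeasurable _ (.of_forall (hb k))) ?_
  · simp only [integral_const_mul] at h
    exact h
  · refine Summable.of_nonneg_of_le (fun k => integral_nonneg fun τ => norm_nonneg _)
      (fun k => ?_) ((summable_geometric_of_lt_one h0.le h1).mul_right Rmax)
    refine (integral_mono_of_nonneg (.of_forall fun τ => norm_nonneg _) (integrable_const _)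
      (.of_forall (hb k))).trans (by simp)

lemma Regular.abs_objective_le (hr : Regular E π Rmax G B ι) (h0 : 0 < γ) (h1 : γ < 1)
    (θ : Param M) : |objective E π γ θ| ≤ Rmax / (1 - γ) := by
  rw [← (hr.hasSum_objective h0 h1 θ).tsum_eq, ← Real.norm_eq_abs]
  refine tsum_of_norm_bounded (g := fun k => Rmax * γ ^ k) ?_ fun k => ?_
  · rw [div_eq_mul_inv]
    exact (hasSum_geometric_of_lt_one h0.le h1).mul_left Rmax
  · rw [norm_mul, Real.norm_of_nonneg (by positivity), mul_comm]
    refine mul_le_mul_of_nonneg_right ?_ (by positivity)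
    exact (norm_integral_le_of_norm_le_const (.of_forall fun τ => hr.reward_le _ _)).trans
      (by simp)

/-- The same series bounds the gradient, the estimator and, after a shift, the truncation bias. -/
lemma Regular.hasSum_gradient_bound (h0 : 0 < γ) (h1 : γ < 1) :
    HasSum (fun k : ℕ => γ ^ k * (Rmax * ((k + 1) * G))) (G * Rmax / (1 - γ) ^ 2) := by
  have h := ((summable_succ_pow_mul_geometric h0 h1 1).hasSum).mul_left (G * Rmax)
  simp only [pow_one, tsum_succ_mul_geometric h0 h1] at h
  have e : G * Rmax / (1 - γ) ^ 2 = G * Rmax * (1 / (1 - γ) ^ 2) := by ring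
  rw [e]
  exact h.congr_fun fun k => by ring

/-- The gradient of the objective as a series. -/
def gradSeries (E : MDP S A) (π : Policy M S A) (γ : ℝ) (θ : Param M) : Param M :=
  ∑' k : ℕ, γ ^ k • expRewardGrad E π k θ

/-- The Hessian of the objective as a series. -/
def hessSeries (E : MDP S A) (π : Policy M S A) (γ : ℝ) (θ : Param M) : Param M →L[ℝ] Param M :=
  ∑' k : ℕ, γ ^ k • expRewardHess E π k θ

lemma Regular.norm_smul_expRewardGrad_le (hr : Regular E π Rmax G B ι) (h0 : 0 < γ) (k : ℕ)
    (θ : Param M) : ‖γ ^ k • expRewardGrad E π k θ‖ ≤ γ ^ k * (Rmax * ((k + 1) * G)) := by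
  rw [norm_smul, Real.norm_of_nonneg (by positivity)]
  exact mul_le_mul_of_nonneg_left (hr.norm_expRewardGrad_le k θ) (by positivity)

lemma Regular.summable_grad (hr : Regular E π Rmax G B ι) (h0 : 0 < γ) (h1 : γ < 1)
    (θ : Param M) : Summable fun k => γ ^ k • expRewardGrad E π k θ :=
  Summable.of_norm_bounded (Regular.hasSum_gradient_bound h0 h1).summable
    fun k => hr.norm_smul_expRewardGrad_le h0 k θ

lemma Regular.hasFDerivAt_objective (hr : Regular E π Rmax G B ι) (hG : 0 ≤ G) (h0 : 0 < γ)
    (h1 : γ < 1) (θ : Param M) :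
    HasFDerivAt (objective E π γ) (innerSL ℝ (gradSeries E π γ θ)) θ := by
  have hfun : objective E π γ = fun θ => ∑' k : ℕ, γ ^ k * expReward E π k θ := by
    funext θ
    exact (hr.hasSum_objective h0 h1 θ).tsum_eq.symm
  have h := hasFDerivAt_tsum (𝕜 := ℝ) (f := fun (k : ℕ) θ => γ ^ k * expReward E π k θ)
    (f' := fun (k : ℕ) θ => innerSL ℝ (γ ^ k • expRewardGrad E π k θ)) (x₀ := θ)
    (Regular.hasSum_gradient_bound (Rmax := Rmax) (G := G) h0 h1).summable
    (fun k θ => ?_) (fun k θ => ?_) (hr.hasSum_objective h0 h1 θ).summable θ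
  · rw [hfun, gradSeries, ContinuousLinearMap.map_tsum _ (hr.summable_grad h0 h1 θ)]
    exact h
  · rw [map_smul]
    exact (hr.hasFDerivAt_expReward hG k θ).const_mul _
  · rw [innerSL_apply_norm]
    exact hr.norm_smul_expRewardGrad_le h0 k θ

lemma Regular.gradient_objective (hr : Regular E π Rmax G B ι) (hG : 0 ≤ G) (h0 : 0 < γ)
    (h1 : γ < 1) : ∇ (objective E π γ) = gradSeries E π γ := by
  funext θ
  have h : HasGradientAt (objective E π γ) (gradSeries E π γ θ) θ :=
    hr.hasFDerivAt_objective hG h0 h1 θ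
  exact h.gradient

lemma Regular.hasSum_hess_bound (h0 : 0 < γ) (h1 : γ < 1) :
    HasSum (fun k : ℕ => γ ^ k * (Rmax * ((k + 1) * B) + Rmax * ((k + 1) ^ 2 * G ^ 2)))
      (smoothConst Rmax G B γ) := by
  have h := (((summable_succ_pow_mul_geometric h0 h1 1).hasSum).mul_left (Rmax * B)).add
    (((summable_succ_pow_mul_geometric h0 h1 2).hasSum).mul_left (Rmax * G ^ 2))
  simp only [pow_one, tsum_succ_mul_geometric h0 h1, tsum_succ_sq_mul_geometric h0 h1] at h
  have e : smoothConst Rmax G B γ = Rmax * B * (1 / (1 - γ) ^ 2)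
      + Rmax * G ^ 2 * ((1 + γ) / (1 - γ) ^ 3) := by
    unfold smoothConst
    ring
  rw [e]
  exact h.congr_fun fun k => by ring

lemma Regular.norm_smul_expRewardHess_le (hr : Regular E π Rmax G B ι) (h0 : 0 < γ) (k : ℕ)
    (θ : Param M) : ‖γ ^ k • expRewardHess E π k θ‖
      ≤ γ ^ k * (Rmax * ((k + 1) * B) + Rmax * ((k + 1) ^ 2 * G ^ 2)) := by
  rw [norm_smul, Real.norm_of_nonneg (by positivity)]
  exact mul_le_mul_of_nonneg_left (hr.norm_expRewardHess_le k θ) (by positivity)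

lemma Regular.hasFDerivAt_gradient (hr : Regular E π Rmax G B ι) (hG : 0 ≤ G) (h0 : 0 < γ)
    (h1 : γ < 1) (θ : Param M) :
    HasFDerivAt (gradSeries E π γ) (hessSeries E π γ θ) θ :=
  hasFDerivAt_tsum (𝕜 := ℝ) (f := fun (k : ℕ) θ => γ ^ k • expRewardGrad E π k θ)
    (f' := fun (k : ℕ) θ => γ ^ k • expRewardHess E π k θ) (x₀ := θ)
    (Regular.hasSum_hess_bound (Rmax := Rmax) (G := G) (B := B) h0 h1).summable
    (fun k θ => (hr.hasFDerivAt_expRewardGrad hG k θ).fun_const_smul _)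
    (fun k θ => hr.norm_smul_expRewardHess_le h0 k θ) (hr.summable_grad h0 h1 θ) θ

lemma Regular.hessian_objective (hr : Regular E π Rmax G B ι) (hG : 0 ≤ G) (h0 : 0 < γ)
    (h1 : γ < 1) (θ : Param M) : hessian (objective E π γ) θ = hessSeries E π γ θ := by
  rw [hessian, hr.gradient_objective hG h0 h1]
  exact (hr.hasFDerivAt_gradient hG h0 h1 θ).fderiv

/-- A Lipschitz constant of the Hessian of the objective. -/
def hessLipConst (Rmax G B ι γ : ℝ) : ℝ :=
  Rmax * (|ι| + 3 * G * B + G ^ 3) * ∑' k : ℕ, ((k : ℝ) + 1) ^ 3 * γ ^ k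

lemma Regular.norm_hessSeries_sub_le (hr : Regular E π Rmax G B ι) (hR : 0 ≤ Rmax) (hG : 0 ≤ G)
    (hB : 0 ≤ B) (h0 : 0 < γ) (h1 : γ < 1) (θ₁ θ₂ : Param M) :
    ‖hessSeries E π γ θ₁ - hessSeries E π γ θ₂‖ ≤ hessLipConst Rmax G B ι γ * ‖θ₁ - θ₂‖ := by
  have hs : ∀ θ, Summable fun k => γ ^ k • expRewardHess E π k θ := fun θ =>
    Summable.of_norm_bounded (Regular.hasSum_hess_bound h0 h1).summable
      fun k => hr.norm_smul_expRewardHess_le h0 k θ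
  rw [hessSeries, hessSeries, ← (hs θ₁).tsum_sub (hs θ₂)]
  refine tsum_of_norm_bounded (g := fun k : ℕ => Rmax * (|ι| + 3 * G * B + G ^ 3) *
    (((k : ℝ) + 1) ^ 3 * γ ^ k) * ‖θ₁ - θ₂‖) ?_ fun k => ?_
  · exact ((summable_succ_pow_mul_geometric h0 h1 3).hasSum.mul_left _).mul_right _
  have es : γ ^ k • expRewardHess E π k θ₁ - γ ^ k • expRewardHess E π k θ₂
      = γ ^ k • (expRewardHess E π k θ₁ - expRewardHess E π k θ₂) := (smul_sub _ _ _).symm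
  rw [es, norm_smul, Real.norm_of_nonneg (by positivity)]
  have hk : (1 : ℝ) ≤ (k : ℝ) + 1 := by linarith [k.cast_nonneg (α := ℝ)]
  have hle : Rmax * ((k + 1) * |ι| + 2 * (k + 1) ^ 2 * G * B) + (k + 1) * G *
        (Rmax * ((k + 1) * B) + Rmax * ((k + 1) ^ 2 * G ^ 2))
      ≤ Rmax * (|ι| + 3 * G * B + G ^ 3) * ((k : ℝ) + 1) ^ 3 := by
    set x : ℝ := (k : ℝ) + 1
    have e1 : x ≤ x ^ 3 := le_self_pow₀ hk (by norm_num)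
    have e2 : x ^ 2 ≤ x ^ 3 := pow_le_pow_right₀ hk (by norm_num)
    have i1 : Rmax * |ι| * x ≤ Rmax * |ι| * x ^ 3 := by gcongr
    have i2 : 3 * (Rmax * G * B) * x ^ 2 ≤ 3 * (Rmax * G * B) * x ^ 3 := by gcongr
    nlinarith
  calc γ ^ k * ‖expRewardHess E π k θ₁ - expRewardHess E π k θ₂‖
      ≤ γ ^ k * (Rmax * (|ι| + 3 * G * B + G ^ 3) * ((k : ℝ) + 1) ^ 3 * ‖θ₁ - θ₂‖) := by
        gcongr
        exact (hr.norm_expRewardHess_sub_le hG k θ₁ θ₂).trans (by gcongr)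
    _ = _ := by ring

lemma Regular.norm_hessSeries_le (hr : Regular E π Rmax G B ι) (h0 : 0 < γ) (h1 : γ < 1)
    (θ : Param M) : ‖hessSeries E π γ θ‖ ≤ smoothConst Rmax G B γ :=
  tsum_of_norm_bounded (Regular.hasSum_hess_bound h0 h1)
    fun k => hr.norm_smul_expRewardHess_le h0 k θ

lemma Regular.contDiff_objective (hr : Regular E π Rmax G B ι) (hR : 0 ≤ Rmax) (hG : 0 ≤ G)
    (hB : 0 ≤ B) (h0 : 0 < γ) (h1 : γ < 1) : ContDiff ℝ 2 (objective E π γ) := by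
  have hcont : Continuous (hessSeries E π γ) :=
    (LipschitzWith.of_dist_le_mul (K := (hessLipConst Rmax G B ι γ).toNNReal)
      fun x y => by
        rw [dist_eq_norm, dist_eq_norm]
        refine (hr.norm_hessSeries_sub_le hR hG hB h0 h1 x y).trans ?_
        gcongr
        exact Real.le_coe_toNNReal _).continuous
  have hgrad : ContDiff ℝ 1 (gradSeries E π γ) := by
    rw [contDiff_one_iff_fderiv]
    refine ⟨fun θ => (hr.hasFDerivAt_gradient hG h0 h1 θ).differentiableAt, ?_⟩
    have : fderiv ℝ (gradSeries E π γ) = hessSeries E π γ := by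
      funext θ
      exact (hr.hasFDerivAt_gradient hG h0 h1 θ).fderiv
    rw [this]
    exact hcont
  have e : (2 : WithTop ℕ∞) = 1 + 1 := by norm_num
  rw [e, contDiff_succ_iff_fderiv]
  refine ⟨fun θ => (hr.hasFDerivAt_objective hG h0 h1 θ).differentiableAt, by simp, ?_⟩
  have : fderiv ℝ (objective E π γ) = fun θ => innerSL ℝ (gradSeries E π γ θ) := by
    funext θ
    exact (hr.hasFDerivAt_objective hG h0 h1 θ).fderiv
  rw [this]
  exact (innerSL ℝ (E := Param M)).contDiff.comp hgrad

lemma Regular.isSymmetric_hessSeries (hr : Regular E π Rmax G B ι) (hG : 0 ≤ G)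
    (h0 : 0 < γ) (h1 : γ < 1) (θ : Param M) :
    (hessSeries E π γ θ : Param M →ₗ[ℝ] Param M).IsSymmetric := by
  intro v w
  have hd : HasFDerivAt (fun θ => innerSL ℝ (gradSeries E π γ θ))
      ((innerSL ℝ (E := Param M)).comp (hessSeries E π γ θ)) θ :=
    (innerSL ℝ (E := Param M)).hasFDerivAt.comp θ (hr.hasFDerivAt_gradient hG h0 h1 θ)
  have h := second_derivative_symmetric (𝕜 := ℝ)
    (fun θ => hr.hasFDerivAt_objective hG h0 h1 θ) hd v w
  simp only [ContinuousLinearMap.comp_apply, innerSL_apply_apply] at h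
  simp only [ContinuousLinearMap.coe_coe]
  rw [h, real_inner_comm]

end Objective

/-! ### The gradient estimator: size, bias, and the kernel of one update. -/

section Estimator

variable {M : ℕ} {S A : Type*} [MeasurableSpace S] [MeasurableSpace A]
  {E : MDP S A} {π : Policy M S A} {Rmax G B ι γ : ℝ}

/-- Grouped by reward instead of by score, each reward multiplies the scores of the actions up to
its own time. In this form the estimator is term by term a truncation of the gradient series. -/
lemma gpomdp_eq_sum (E : MDP S A) (π : Policy M S A) (γ : ℝ) (H : ℕ) (θ : Param M)
    (τ : Fin H → S × A) :
    gpomdp E π γ H θ τ = ∑ i : Fin H, (γ ^ (i : ℕ) * E.reward (τ i).1 (τ i).2) •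
      ∑ h ∈ Finset.Iic i, π.score θ (τ h).1 (τ h).2 := by
  simp only [gpomdp, Finset.sum_smul, Finset.smul_sum]
  exact Finset.sum_comm' (by simp)

lemma Regular.norm_gpomdp_le (hr : Regular E π Rmax G B ι) (hR : 0 ≤ Rmax) (hG : 0 ≤ G)
    (h0 : 0 < γ) (h1 : γ < 1) (H : ℕ) (θ : Param M) (τ : Fin H → S × A) :
    ‖gpomdp E π γ H θ τ‖ ≤ sigmaConst Rmax G γ := by
  have hs := Regular.hasSum_gradient_bound (Rmax := Rmax) (G := G) h0 h1
  rw [gpomdp_eq_sum, sigmaConst]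
  refine (norm_sum_le _ _).trans ?_
  calc ∑ i : Fin H, ‖(γ ^ (i : ℕ) * E.reward (τ i).1 (τ i).2) •
        ∑ h ∈ Finset.Iic i, π.score θ (τ h).1 (τ h).2‖
      ≤ ∑ i : Fin H, γ ^ (i : ℕ) * (Rmax * (((i : ℕ) + 1) * G)) := by
        refine Finset.sum_le_sum fun i _ => ?_
        rw [norm_smul, norm_mul, Real.norm_of_nonneg (by positivity), mul_assoc]
        refine mul_le_mul_of_nonneg_left ?_ (by positivity)
        refine mul_le_mul (hr.reward_le _ _) ?_ (norm_nonneg _) hR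
        refine (norm_sum_le _ _).trans ((Finset.sum_le_card_nsmul _ _ G
          fun h _ => hr.score_le θ (τ h).1 (τ h).2).trans_eq ?_)
        simp
    _ = ∑ i ∈ Finset.range H, γ ^ i * (Rmax * ((i + 1) * G)) :=
        Fin.sum_univ_eq_sum_range (fun i : ℕ => γ ^ i * (Rmax * (((i : ℝ) + 1) * G))) H
    _ ≤ _ := sum_le_hasSum _ (fun i _ => by positivity) hs

lemma gpomdp_restrict (E : MDP S A) (π : Policy M S A) (γ : ℝ) (H : ℕ) (θ : Param M)
    (τ : ℕ → S × A) :
    gpomdp E π γ H θ (fun h => τ h) = ∑ i ∈ Finset.range H,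
      γ ^ i • (E.reward (τ i).1 (τ i).2 • pathScore π (i + 1) θ τ) := by
  rw [gpomdp_eq_sum, ← Fin.sum_univ_eq_sum_range
    (fun i : ℕ => γ ^ i • (E.reward (τ i).1 (τ i).2 • pathScore π (i + 1) θ τ)) H]
  refine Finset.sum_congr rfl fun i _ => ?_
  rw [smul_smul]
  congr 1
  unfold pathScore
  refine Finset.sum_nbij (fun h => (h : ℕ)) (fun h hh => ?_) (fun a _ b _ h => Fin.ext h)
    (fun n hn => ?_) (fun _ _ => rfl)
  · have := Finset.mem_Iic.1 hh
    exact Finset.mem_range.2 (Nat.lt_succ_of_le this)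
  · have hn' : n < i + 1 := Finset.mem_range.1 hn
    exact ⟨⟨n, by omega⟩, Finset.mem_coe.2 (Finset.mem_Iic.2 (Nat.lt_succ_iff.1 hn')), rfl⟩

lemma measurable_restrict (H : ℕ) :
    Measurable fun (τ : ℕ → S × A) (h : Fin H) => τ h :=
  measurable_pi_lambda _ fun _ => measurable_pi_apply _

instance (E : MDP S A) (π : Policy M S A) (H : ℕ) (θ : Param M) :
    IsProbabilityMeasure (trajLaw E π H θ) :=
  Measure.isProbabilityMeasure_map (measurable_restrict H).aemeasurable

lemma Regular.measurable_score (hr : Regular E π Rmax G B ι) :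
    Measurable fun p : Param M × (S × A) => π.score p.1 p.2.1 p.2.2 :=
  measurable_uncurry_of_continuous_of_measurable
    (u := fun (θ : Param M) (z : S × A) => π.score θ z.1 z.2)
    (fun z => (hr.score_differentiable z.1 z.2).continuous)
    (fun θ => (π.stronglyMeasurable_score hr.log_differentiable θ).measurable)

lemma Regular.measurable_gpomdp (hr : Regular E π Rmax G B ι) (H : ℕ) :
    Measurable fun p : Param M × (Fin H → S × A) => gpomdp E π γ H p.1 p.2 := by
  have hc : ∀ i : Fin H, Measurable fun p : Param M × (Fin H → S × A) => p.2 i :=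
    fun i => (measurable_pi_apply i).comp measurable_snd
  have hrew : ∀ i : Fin H, Measurable fun p : Param M × (Fin H → S × A) =>
      E.reward (p.2 i).1 (p.2 i).2 := fun i => E.measurable_reward.comp (hc i)
  have hsc : ∀ i : Fin H, Measurable fun p : Param M × (Fin H → S × A) =>
      π.score p.1 (p.2 i).1 (p.2 i).2 :=
    fun i => hr.measurable_score.comp (measurable_fst.prodMk (hc i))
  unfold gpomdp
  exact Finset.measurable_fun_sum _ fun h _ =>
    (Finset.measurable_fun_sum _ fun i _ => (hrew i).const_mul _).smul (hsc h)

lemma Regular.measurable_gpomdp_right (hr : Regular E π Rmax G B ι) (H : ℕ) (θ : Param M) :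
    Measurable fun τ => gpomdp E π γ H θ τ := by
  have h := hr.measurable_gpomdp (γ := γ) H
  have hm : Measurable fun τ : Fin H → S × A => (θ, τ) := measurable_prodMk_left
  have h2 := h.comp hm
  simp only [Function.comp_def] at h2
  exact h2

lemma Regular.integral_gpomdp (hr : Regular E π Rmax G B ι) (H : ℕ) (θ : Param M) :
    ∫ τ, gpomdp E π γ H θ τ ∂(trajLaw E π H θ)
      = ∑ i ∈ Finset.range H, γ ^ i • expRewardGrad E π i θ := by
  rw [trajLaw, integral_map (measurable_restrict H).aemeasurable
    (hr.measurable_gpomdp_right H θ).aestronglyMeasurable]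
  simp only [gpomdp_restrict]
  rw [integral_finsetSum]
  · simp only [integral_smul, expRewardGrad]
  · intro k _
    exact (Integrable.of_bound (((stronglyMeasurable_reward E k).smul
      (hr.stronglyMeasurable_pathScore k θ)).mono (pathSigma_le k)).aestronglyMeasurable
      _ (.of_forall (hr.norm_reward_smul_score_le k θ))).smul (γ ^ k)

/-- The bias of the estimator with horizon `H`. -/
lemma Regular.norm_integral_gpomdp_sub_le (hr : Regular E π Rmax G B ι) (hR : 0 ≤ Rmax)
    (hG : 0 ≤ G) (h0 : 0 < γ) (h1 : γ < 1) (H : ℕ) (θ : Param M) :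
    ‖∫ τ, gpomdp E π γ H θ τ ∂(trajLaw E π H θ) - gradSeries E π γ θ‖
      ≤ sigmaConst Rmax G γ * ((H + 1) * γ ^ H) := by
  rw [hr.integral_gpomdp, gradSeries, ← (hr.summable_grad h0 h1 θ).sum_add_tsum_nat_add H,
    sub_add_cancel_left, norm_neg]
  have hs := Regular.hasSum_gradient_bound (Rmax := Rmax) (G := G) h0 h1
  refine tsum_of_norm_bounded (hs.mul_right ((H + 1) * γ ^ H)) fun k => ?_
  refine (hr.norm_smul_expRewardGrad_le h0 (k + H) θ).trans ?_
  push_cast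
  -- This inequality factors the tail from `H` on into `(H + 1) * γ ^ H` times the full series.
  have hk : (k : ℝ) + H + 1 ≤ (k + 1) * (H + 1) := by
    nlinarith [k.cast_nonneg (α := ℝ), H.cast_nonneg (α := ℝ)]
  calc γ ^ (k + H) * (Rmax * ((k + H + 1) * G))
      ≤ γ ^ (k + H) * (Rmax * ((k + 1) * (H + 1) * G)) := by gcongr
    _ = _ := by ring

/-- The probability of a fixed event is a Lipschitz function of the parameter, so the trajectory
laws form a kernel although no measurability of the density in the parameter is assumed. -/
lemma Regular.measurable_trajLaw (hr : Regular E π Rmax G B ι) (hG : 0 ≤ G) (H : ℕ) :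
    Measurable (trajLaw E π H) := by
  refine Measure.measurable_of_measurable_coe _ fun C hC => ?_
  have hpre : MeasurableSet[pathSigma S A H] ((fun (τ : ℕ → S × A) (h : Fin H) => τ h) ⁻¹' C) :=
    (@measurable_pi_lambda _ _ _ (pathSigma S A H) _ _
      fun h : Fin H => measurable_coord h.2.le) hC
  set F : (ℕ → S × A) → ℝ :=
    ((fun (τ : ℕ → S × A) (h : Fin H) => τ h) ⁻¹' C).indicator fun _ => 1 with hF
  have hFm : StronglyMeasurable[pathSigma S A H] F := stronglyMeasurable_const.indicator hpre
  have hcont : Continuous fun θ => ∫ τ, F τ ∂(pathLaw E π θ) :=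
    (LipschitzWith.of_dist_le_mul (K := (((H : ℝ) + 1) * G * 1).toNNReal) fun x y => by
      rw [dist_eq_norm, dist_eq_norm]
      refine (hr.norm_integral_pathLaw_sub_le hG H hFm (C := 1) (fun τ => ?_) x y).trans ?_
      · simp only [hF, Set.indicator]
        split_ifs <;> simp
      · gcongr
        exact Real.le_coe_toNNReal _).continuous
  have e : (fun θ => trajLaw E π H θ C)
      = fun θ => ENNReal.ofReal (∫ τ, F τ ∂(pathLaw E π θ)) := by
    funext θ
    rw [hF, integral_indicator_const _ (pathSigma_le H _ hpre), smul_eq_mul, mul_one,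
      ofReal_measureReal, trajLaw, Measure.map_apply (measurable_restrict H) hC]
  rw [e]
  exact hcont.measurable.ennreal_ofReal

/-- The law of the sampled trajectory as a kernel. -/
def Regular.trajKernel (hr : Regular E π Rmax G B ι) (hG : 0 ≤ G) (H : ℕ) :
    Kernel (Param M) (Fin H → S × A) where
  toFun := trajLaw E π H
  measurable' := hr.measurable_trajLaw hG H

instance (hr : Regular E π Rmax G B ι) (hG : 0 ≤ G) (H : ℕ) :
    IsMarkovKernel (hr.trajKernel hG H) :=
  ⟨fun θ => inferInstanceAs (IsProbabilityMeasure (trajLaw E π H θ))⟩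

/-- One step of policy gradient as a kernel. -/
def Regular.updateKernel (hr : Regular E π Rmax G B ι) (hG : 0 ≤ G) (γ : ℝ) (H : ℕ) (μ : ℝ) :
    Kernel (Param M) (Param M) :=
  (Kernel.id ×ₖ hr.trajKernel hG H).map fun p => p.1 + μ • gpomdp E π γ H p.1 p.2

lemma Regular.measurable_update (hr : Regular E π Rmax G B ι) (γ : ℝ) (H : ℕ) (μ : ℝ) :
    Measurable fun p : Param M × (Fin H → S × A) => p.1 + μ • gpomdp E π γ H p.1 p.2 :=
  measurable_fst.add ((hr.measurable_gpomdp H).const_smul μ)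

instance (hr : Regular E π Rmax G B ι) (hG : 0 ≤ G) (γ : ℝ) (H : ℕ) (μ : ℝ) :
    IsMarkovKernel (hr.updateKernel hG γ H μ) :=
  Kernel.IsMarkovKernel.map _ (hr.measurable_update γ H μ)

lemma Regular.updateKernel_apply (hr : Regular E π Rmax G B ι) (hG : 0 ≤ G) (γ : ℝ) (H : ℕ)
    (μ : ℝ) (θ : Param M) : hr.updateKernel hG γ H μ θ
      = (trajLaw E π H θ).map fun τ => θ + μ • gpomdp E π γ H θ τ := by
  rw [updateKernel, Kernel.map_apply _ (hr.measurable_update γ H μ), Kernel.prod_apply,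
    Kernel.id_apply, Measure.dirac_prod, Measure.map_map (hr.measurable_update γ H μ)
      measurable_prodMk_left]
  rfl

theorem Regular.mul_measureReal_stay_le (hr : Regular E π Rmax G B ι) (hG : 0 ≤ G) {H : ℕ}
    {μ : ℝ} {θ₀ : Param M} {Ω : Type*} [MeasurableSpace Ω] (P : Measure Ω)
    [IsProbabilityMeasure P] {θ : ℕ → Ω → Param M} {τ : ℕ → Ω → Fin H → S × A}
    (hrun : IsRun E π γ H μ θ₀ P θ τ) {N : Set (Param M)} (hN : MeasurableSet N) (n : ℕ) :
    n * P.real {ω | ∀ t < n, θ t ω ∈ N}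
      ≤ expectedStay (hr.updateKernel hG γ H μ) N n θ₀ := by
  refine PolicyGradient.mul_measureReal_stay_le P _ hN hrun.measurable_param hrun.init ?_ n
  intro t U hU
  have hle : (⨆ i ∈ Set.Iic t, MeasurableSpace.comap (θ i) inferInstance)
      ≤ (inferInstance : MeasurableSpace Ω) :=
    iSup₂_le fun i _ => (hrun.measurable_param i).comap_le
  have hθt : Measurable[⨆ i ∈ Set.Iic t, MeasurableSpace.comap (θ i) inferInstance] (θ t) :=
    (comap_measurable (θ t)).mono
      (le_iSup₂_of_le (f := fun i (_ : i ∈ Set.Iic t) =>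
        MeasurableSpace.comap (θ i) inferInstance) t Set.self_mem_Iic le_rfl) le_rfl
  have h := map_prodMk_restrict_eq_compProd P hle (hr.trajKernel hG H) hθt
    (hrun.measurable_traj t) (hrun.sample t) hU
  have e : θ (t + 1) = (fun p : Param M × (Fin H → S × A) =>
      p.1 + μ • gpomdp E π γ H p.1 p.2) ∘ fun ω => (θ t ω, τ t ω) := by
    funext ω
    exact hrun.update t ω
  rw [e, ← Measure.map_map (hr.measurable_update γ H μ)
    ((hrun.measurable_param t).prodMk (hrun.measurable_traj t)), h, updateKernel,
    Measure.compProd_eq_comp_prod, Measure.map_comp _ _ (hr.measurable_update γ H μ)]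

end Estimator

/-! ### One stochastic step: quadratic functions and the sixth-moment function. -/

section OneStep

variable {M : ℕ} {ν : Measure (Param M)} [IsProbabilityMeasure ν] {σ : ℝ}

lemma integrable_of_continuous_of_ae_norm_le {V : Type*} [NormedAddCommGroup V]
    (hν : ∀ᵐ v ∂ν, ‖v‖ ≤ σ) {φ : Param M → V} (hφ : Continuous φ) : Integrable φ ν := by
  obtain ⟨C, hC⟩ := (isCompact_closedBall (0 : Param M) σ).exists_bound_of_continuousOn
    hφ.continuousOn
  refine Integrable.of_bound hφ.aestronglyMeasurable C ?_
  filter_upwards [hν] with v hv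
  exact hC v (by simpa using hv)

/-- The variance of the law `ν` in the direction `e`. -/
def dirVar (ν : Measure (Param M)) (e : Param M) : ℝ :=
  ∫ v, ⟪e, v⟫ ^ 2 ∂ν - ⟪e, ∫ v, v ∂ν⟫ ^ 2

lemma integral_inner_eq (hν : ∀ᵐ v ∂ν, ‖v‖ ≤ σ) (e : Param M) :
    ∫ v, ⟪e, v⟫ ∂ν = ⟪e, ∫ v, v ∂ν⟫ :=
  integral_inner (integrable_of_continuous_of_ae_norm_le hν continuous_id) e

lemma dirVar_eq_integral_sq (hν : ∀ᵐ v ∂ν, ‖v‖ ≤ σ) (e : Param M) :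
    dirVar ν e = ∫ v, ⟪e, v - ∫ v', v' ∂ν⟫ ^ 2 ∂ν := by
  set m := ∫ v, v ∂ν with hm
  have h1 : Integrable (fun v => ⟪e, v⟫ ^ 2) ν :=
    integrable_of_continuous_of_ae_norm_le hν (by fun_prop)
  have h2 : Integrable (fun v => 2 * ⟪e, m⟫ * ⟪e, v⟫) ν :=
    integrable_of_continuous_of_ae_norm_le hν (by fun_prop)
  have h12 : Integrable (fun v => ⟪e, v⟫ ^ 2 - 2 * ⟪e, m⟫ * ⟪e, v⟫) ν := h1.sub h2
  have e1 : ∀ v, ⟪e, v - m⟫ ^ 2 = ⟪e, v⟫ ^ 2 - 2 * ⟪e, m⟫ * ⟪e, v⟫ + ⟪e, m⟫ ^ 2 := by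
    intro v
    rw [inner_sub_right]
    ring
  simp_rw [e1]
  rw [integral_add h12 (integrable_const _), integral_sub h1 h2, integral_const_mul,
    integral_inner_eq hν, integral_const, probReal_univ, one_smul, dirVar, ← hm]
  ring

lemma dirVar_nonneg (hν : ∀ᵐ v ∂ν, ‖v‖ ≤ σ) (e : Param M) : 0 ≤ dirVar ν e := by
  rw [dirVar_eq_integral_sq hν]
  exact integral_nonneg fun v => sq_nonneg _

lemma dirVar_le (hν : ∀ᵐ v ∂ν, ‖v‖ ≤ σ) {e : Param M} (he : ‖e‖ = 1) :
    dirVar ν e ≤ σ ^ 2 := by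
  have h1 : Integrable (fun v => ⟪e, v⟫ ^ 2) ν :=
    integrable_of_continuous_of_ae_norm_le hν (by fun_prop)
  have h2 : ∫ v, ⟪e, v⟫ ^ 2 ∂ν ≤ ∫ _, σ ^ 2 ∂ν := by
    refine integral_mono_ae h1 (integrable_const _) ?_
    filter_upwards [hν] with v hv
    have h3 : |⟪e, v⟫| ≤ σ := (abs_real_inner_le_norm e v).trans (by rw [he, one_mul]; exact hv)
    exact sq_le_sq.2 (h3.trans (le_abs_self σ))
  rw [integral_const, probReal_univ, one_smul] at h2
  rw [dirVar]
  linarith [sq_nonneg ⟪e, ∫ v, v ∂ν⟫]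

/-- The expected change of a one-dimensional quadratic function in one step. -/
lemma quad_step_le (hν : ∀ᵐ v ∂ν, ‖v‖ ≤ σ) {μ : ℝ} (hμ : 0 < μ) (e : Param M) {lam : ℝ}
    (hlam : |lam| * μ ≤ 1 / 4) (g y : ℝ) :
    (1 + μ * lam) * (g * y + lam / 2 * y ^ 2) + μ / 2 * g ^ 2
        - 2 * μ * (⟪e, ∫ v, v ∂ν⟫ - (g + lam * y)) ^ 2 + μ ^ 2 / 2 * lam * dirVar ν e
      ≤ ∫ v, (g * (y + μ * ⟪e, v⟫) + lam / 2 * (y + μ * ⟪e, v⟫) ^ 2) ∂ν := by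
  set m := ⟪e, ∫ v, v ∂ν⟫ with hm
  have h1 : Integrable (fun v => ⟪e, v⟫ ^ 2) ν :=
    integrable_of_continuous_of_ae_norm_le hν (by fun_prop)
  have h2 : Integrable (fun v => ⟪e, v⟫) ν :=
    integrable_of_continuous_of_ae_norm_le hν (by fun_prop)
  have e1 : ∀ v, g * (y + μ * ⟪e, v⟫) + lam / 2 * (y + μ * ⟪e, v⟫) ^ 2
      = (g * y + lam / 2 * y ^ 2) + μ * (g + lam * y) * ⟪e, v⟫ + lam / 2 * μ ^ 2 * ⟪e, v⟫ ^ 2 := by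
    intro v; ring
  have h12 : Integrable (fun v => (g * y + lam / 2 * y ^ 2) + μ * (g + lam * y) * ⟪e, v⟫) ν :=
    (integrable_const _).add (h2.const_mul _)
  have e2 : ∫ v, ⟪e, v⟫ ^ 2 ∂ν = dirVar ν e + m ^ 2 := by rw [dirVar]; ring
  simp_rw [e1]
  rw [integral_add h12 (h1.const_mul _),
    integral_add (integrable_const _) (h2.const_mul _), integral_const, probReal_univ, one_smul,
    integral_const_mul, integral_const_mul, integral_inner_eq hν, ← hm, e2]
  set u := g + lam * y with hu
  set r := m - u with hr
  have hmr : m = u + r := by rw [hr]; ring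
  have hl : -(1 / 4) ≤ lam * μ := by
    have := neg_abs_le (lam * μ)
    rw [abs_mul, abs_of_pos hμ] at this
    linarith
  -- Here `u` is the derivative of the quadratic at `y`, and `u² = g² + 2 λ q` with `q` its value.
  -- Half of the first-order gain `μ u²` thus produces the growth `μ λ q` and the drift gain `μ g² /
  -- 2`; the other half absorbs the bias and, as `λ μ ≥ -1/4`, the squared mean in the second-order
  -- term.
  have key : 0 ≤ u ^ 2 / 2 + u * r + 2 * r ^ 2 + lam * μ / 2 * (u + r) ^ 2 := by
    nlinarith [mul_nonneg (by linarith : 0 ≤ lam * μ + 1 / 4) (sq_nonneg (u + r)),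
      sq_nonneg (u + 2 * r), sq_nonneg (u - r), sq_nonneg r]
  have hu2 : u ^ 2 = g ^ 2 + 2 * lam * (g * y + lam / 2 * y ^ 2) := by rw [hu]; ring
  have hkey := mul_nonneg hμ.le key
  rw [hmr]
  nlinarith

/-- The sixth-moment function that controls the distance from the anchor of an episode. -/
def momentFun (m₀ : ℝ) (d : Param M) : ℝ := (1 + ‖d‖ ^ 2 / m₀ ^ 2) ^ 3

/-- With `X = ‖d‖² / m₀²` the increment `Δ` of `X` has mean at most `7 μ s (1 + X)` and square at
most `10 μ s (1 + X)²`. In particular `Δ ≤ 1 + X`, so the quadratic and cubic terms of `(1 + X +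
Δ)³` cost at most `4 (1 + X) Δ²`, and `3 * 7 + 4 * 10 = 61`. -/
lemma momentFun_step_le (hν : ∀ᵐ v ∂ν, ‖v‖ ≤ σ) {μ s m₀ : ℝ} (hμ : 0 < μ) (hs : 0 < s)
    (hm₀ : 0 < m₀) (hμs : 10 * (μ * s) ≤ 1) (hσ : μ * σ ^ 2 ≤ s * m₀ ^ 2)
    (d : Param M)
    (hdrift : 2 * ⟪d, ∫ v, v ∂ν⟫ + μ * σ ^ 2 ≤ 7 * s * (‖d‖ ^ 2 + m₀ ^ 2)) :
    ∫ v, momentFun m₀ (d + μ • v) ∂ν ≤ (1 + 61 * (μ * s)) * momentFun m₀ d := by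
  set X := ‖d‖ ^ 2 / m₀ ^ 2 with hX
  have hX0 : 0 ≤ X := by positivity
  set Δ : Param M → ℝ := fun v => (2 * μ * ⟪d, v⟫ + μ ^ 2 * ‖v‖ ^ 2) / m₀ ^ 2 with hΔ
  have hW : ∀ v, momentFun m₀ (d + μ • v) = (1 + X + Δ v) ^ 3 := by
    intro v
    rw [momentFun, norm_add_sq_real, norm_smul, Real.norm_of_nonneg hμ.le, inner_smul_right]
    simp only [hX, hΔ]
    ring
  have hdm : ‖d‖ ^ 2 = X * m₀ ^ 2 := by rw [hX]; field_simp
  have hΔ2 : ∀ᵐ v ∂ν, Δ v ^ 2 ≤ 10 * (μ * s) * (1 + X) ^ 2 := by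
    filter_upwards [hν] with v hv
    have h1 : |⟪d, v⟫| ≤ ‖d‖ * σ :=
      (abs_real_inner_le_norm d v).trans (mul_le_mul_of_nonneg_left hv (norm_nonneg d))
    have h1' : ⟪d, v⟫ ^ 2 ≤ (‖d‖ * σ) ^ 2 :=
      sq_le_sq.2 (h1.trans (le_abs_self _))
    have h2 : ‖v‖ ^ 2 ≤ σ ^ 2 := pow_le_pow_left₀ (norm_nonneg v) hv 2
    have h3 : (2 * μ * ⟪d, v⟫ + μ ^ 2 * ‖v‖ ^ 2) ^ 2
        ≤ 10 * (μ * s) * (1 + X) ^ 2 * (m₀ ^ 2) ^ 2 := by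
      have a1 : (2 * μ * ⟪d, v⟫ + μ ^ 2 * ‖v‖ ^ 2) ^ 2
          ≤ 8 * μ ^ 2 * ⟪d, v⟫ ^ 2 + 2 * (μ ^ 2 * ‖v‖ ^ 2) ^ 2 := by
        nlinarith [sq_nonneg (2 * μ * ⟪d, v⟫ - μ ^ 2 * ‖v‖ ^ 2)]
      have a0 : μ ^ 2 * σ ^ 2 ≤ μ * s * m₀ ^ 2 := by nlinarith
      have a2 : 8 * μ ^ 2 * ⟪d, v⟫ ^ 2 ≤ 8 * (μ * s) * X * (m₀ ^ 2) ^ 2 := by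
        calc 8 * μ ^ 2 * ⟪d, v⟫ ^ 2 ≤ 8 * μ ^ 2 * (‖d‖ * σ) ^ 2 := by gcongr
          _ = 8 * ‖d‖ ^ 2 * (μ ^ 2 * σ ^ 2) := by ring
          _ ≤ 8 * ‖d‖ ^ 2 * (μ * s * m₀ ^ 2) := by gcongr
          _ = _ := by rw [hdm]; ring
      have a3 : (μ ^ 2 * ‖v‖ ^ 2) ^ 2 ≤ (μ * s * m₀ ^ 2) ^ 2 :=
        pow_le_pow_left₀ (by positivity)
          ((mul_le_mul_of_nonneg_left h2 (by positivity)).trans a0) 2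
      have hμs0 : 0 < μ * s := by positivity
      have a4 : (μ * s * m₀ ^ 2) ^ 2 ≤ μ * s * (m₀ ^ 2) ^ 2 := by
        have : (μ * s) ^ 2 ≤ μ * s := by nlinarith
        calc (μ * s * m₀ ^ 2) ^ 2 = (μ * s) ^ 2 * (m₀ ^ 2) ^ 2 := by ring
          _ ≤ _ := by gcongr
      have a5 : 8 * (μ * s) * X + 2 * (μ * s) ≤ 10 * (μ * s) * (1 + X) ^ 2 := by
        nlinarith [mul_nonneg hμs0.le hX0, mul_nonneg hμs0.le (sq_nonneg X)]
      calc _ ≤ 8 * (μ * s) * X * (m₀ ^ 2) ^ 2 + 2 * (μ * s * (m₀ ^ 2) ^ 2) := by linarith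
        _ = (8 * (μ * s) * X + 2 * (μ * s)) * (m₀ ^ 2) ^ 2 := by ring
        _ ≤ _ := by gcongr
    rw [hΔ]
    simp only
    rw [div_pow, div_le_iff₀ (by positivity)]
    exact h3
  have hΔc : Continuous Δ := by
    rw [hΔ]
    fun_prop
  have hint : Integrable (fun v => (1 + X) ^ 3 + 3 * (1 + X) ^ 2 * Δ v
      + 40 * (μ * s) * (1 + X) ^ 3) ν :=
    integrable_of_continuous_of_ae_norm_le hν (by fun_prop)
  have hpt : ∀ᵐ v ∂ν, momentFun m₀ (d + μ • v)
      ≤ (1 + X) ^ 3 + 3 * (1 + X) ^ 2 * Δ v + 40 * (μ * s) * (1 + X) ^ 3 := by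
    filter_upwards [hΔ2] with v hv
    rw [hW]
    have h1 : Δ v ^ 2 ≤ (1 + X) ^ 2 := hv.trans (by nlinarith [sq_nonneg (1 + X)])
    have h2 : Δ v ≤ 1 + X := abs_le_of_sq_le_sq' h1 (by linarith) |>.2
    nlinarith [mul_nonneg (sq_nonneg (Δ v)) (by linarith : 0 ≤ 1 + X - Δ v),
      mul_le_mul_of_nonneg_left hv (by linarith : 0 ≤ 4 * (1 + X))]
  have hmean : ∫ v, Δ v ∂ν ≤ 7 * (μ * s) * (1 + X) := by
    have h1 : Integrable (fun v => ⟪d, v⟫) ν :=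
      integrable_of_continuous_of_ae_norm_le hν (by fun_prop)
    have h2 : Integrable (fun v : Param M => ‖v‖ ^ 2) ν :=
      integrable_of_continuous_of_ae_norm_le hν (by fun_prop)
    have h3 : ∫ v, ‖v‖ ^ 2 ∂ν ≤ σ ^ 2 := by
      have : ∫ v, ‖v‖ ^ 2 ∂ν ≤ ∫ _, σ ^ 2 ∂ν := by
        refine integral_mono_ae h2 (integrable_const _) ?_
        filter_upwards [hν] with v hv
        exact pow_le_pow_left₀ (norm_nonneg v) hv 2
      simpa using this
    rw [hΔ]
    rw [integral_div, integral_add (h1.const_mul _) (h2.const_mul _), integral_const_mul,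
      integral_const_mul, integral_inner_eq hν, div_le_iff₀ (by positivity)]
    have h4 := mul_le_mul_of_nonneg_left h3 (by positivity : 0 ≤ μ ^ 2)
    have h5 := mul_le_mul_of_nonneg_left hdrift hμ.le
    rw [hdm] at h5
    nlinarith
  calc ∫ v, momentFun m₀ (d + μ • v) ∂ν
      ≤ ∫ v, ((1 + X) ^ 3 + 3 * (1 + X) ^ 2 * Δ v + 40 * (μ * s) * (1 + X) ^ 3) ∂ν :=
        integral_mono_ae (integrable_of_continuous_of_ae_norm_le hν (by
          unfold momentFun; fun_prop)) hint hpt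
    _ = (1 + X) ^ 3 + 3 * (1 + X) ^ 2 * ∫ v, Δ v ∂ν + 40 * (μ * s) * (1 + X) ^ 3 := by
        have hi : Integrable Δ ν := integrable_of_continuous_of_ae_norm_le hν hΔc
        have hi' : Integrable (fun v => (1 + X) ^ 3 + 3 * (1 + X) ^ 2 * Δ v) ν :=
          (integrable_const _).add (hi.const_mul _)
        rw [integral_add hi' (integrable_const _),
          integral_add (integrable_const _) (hi.const_mul _), integral_const_mul]
        simp
    _ ≤ (1 + X) ^ 3 + 3 * (1 + X) ^ 2 * (7 * (μ * s) * (1 + X))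
          + 40 * (μ * s) * (1 + X) ^ 3 := by gcongr
    _ = (1 + 61 * (μ * s)) * momentFun m₀ d := by rw [momentFun]; ring

lemma norm_pow_le_momentFun {m₀ : ℝ} (hm₀ : 0 < m₀) (d : Param M) :
    ‖d‖ ^ 3 ≤ m₀ ^ 3 * momentFun m₀ d ∧ ‖d‖ ^ 4 ≤ m₀ ^ 4 * momentFun m₀ d ∧
      ‖d‖ ^ 6 ≤ m₀ ^ 6 * momentFun m₀ d := by
  set t := ‖d‖ / m₀ with ht
  have ht0 : 0 ≤ t := by positivity
  have hd : ‖d‖ = t * m₀ := by rw [ht]; field_simp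
  have hW : momentFun m₀ d = (1 + t ^ 2) ^ 3 := by rw [momentFun, ht, div_pow]
  rw [hW, hd]
  have e3 : t ^ 3 ≤ (1 + t ^ 2) ^ 3 := pow_le_pow_left₀ ht0 (by nlinarith [sq_nonneg (t - 1)]) 3
  have e4 : t ^ 4 ≤ (1 + t ^ 2) ^ 3 := by nlinarith [sq_nonneg t, sq_nonneg (t ^ 2), sq_nonneg (t^3)]
  have e6 : t ^ 6 ≤ (1 + t ^ 2) ^ 3 := by nlinarith [sq_nonneg t, sq_nonneg (t ^ 2)]
  refine ⟨?_, ?_, ?_⟩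
  · rw [mul_pow, mul_comm]; gcongr
  · rw [mul_pow, mul_comm]; gcongr
  · rw [mul_pow, mul_comm]; gcongr

end OneStep

/-! ### The episode at a strict saddle: data, drift and error estimates. -/

/-- The local data of a stochastic gradient ascent at a strict saddle point `a`: `ν x` is the law of
the stochastic gradient at `x`, `g` and `H` are the gradient and the Hessian of `f` at `a`, and
`μ * T` is of the order of the reciprocal of the rate `s`, which is large enough both for the
largest eigenvalue `lam top` and for the drift caused by `g`. -/
structure Saddle (M : ℕ) where
  ν : Param M → Measure (Param M)
  f : Param M → ℝ
  a : Param M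
  g : Param M
  H : Param M →L[ℝ] Param M
  e : OrthonormalBasis (Fin M) ℝ (Param M)
  lam : Fin M → ℝ
  top : Fin M
  μ : ℝ
  s : ℝ
  σ : ℝ
  b : ℝ
  ρ : ℝ
  L : ℝ
  C : ℝ
  K : ℝ
  σl : ℝ
  β : ℝ
  κ : ℝ
  fmax : ℝ
  T : ℕ
  prob : ∀ x, IsProbabilityMeasure (ν x)
  bounded : ∀ x, ∀ᵐ v ∂(ν x), ‖v‖ ≤ σ
  mean : ∀ x, ‖∫ v, v ∂(ν x) - (g + H (x - a))‖ ≤ ρ * ‖x - a‖ ^ 2 + b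
  taylor : ∀ x, |f x - f a - ⟪g, x - a⟫ - ⟪x - a, H (x - a)⟫ / 2| ≤ ρ * ‖x - a‖ ^ 3
  le_fmax : ∀ x, f x ≤ fmax
  eig : ∀ i d, ⟪e i, H d⟫ = lam i * ⟪e i, d⟫
  noise : ∀ x, 3 / 4 * σl ^ 2 - β * ‖x - a‖ ^ 4 ≤ dirVar (ν x) (e top)
  μ_pos : 0 < μ
  s_pos : 0 < s
  ρ_pos : 0 < ρ
  L_nonneg : 0 ≤ L
  C_nonneg : 0 ≤ C
  K_ge : 1 ≤ K
  β_nonneg : 0 ≤ β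
  κ_nonneg : 0 ≤ κ
  lam_le : ∀ i, lam i ≤ s
  abs_lam_le : ∀ i, |lam i| ≤ L
  top_pos : 0 < lam top
  -- The bound limits the drift that `g` causes over an episode. The alternative after it names the
  -- source of the gain: the noise along `top`, or that very drift.
  rate_le : ∑ i, ⟪e i, g⟫ ^ 2 / (s + |lam i|) ≤ C * μ
  rate_eq : s = lam top ∨ ∑ i, ⟪e i, g⟫ ^ 2 / (s + |lam i|) = C * μ
  C_ge : M * σ ^ 2 / 2 + 1 ≤ C / 2
  K_gain : M * σ ^ 2 / 2 + 1 ≤ 3 / 8 * σl ^ 2 * K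
  T_ge : K ≤ μ * s * T
  T_le : μ * s * T ≤ K + 1
  step_rate : 10 * (μ * s) ≤ 1
  step_L : L * μ ≤ 1 / 4
  -- Each smallness condition pays for one error: Taylor remainder, drift and covariance error, exit
  -- from the region, size of the gradient, total gain, radius of the region, bias, and the demanded
  -- gain `κ`.
  small_cubic : 16 * Real.exp (62 * (K + 1)) ^ 2 * ρ ^ 2 * (C + 1 + σ ^ 2) ^ 3 * μ ≤ s ^ 3
  small_quartic : 2 * Real.exp (62 * (K + 1)) ^ 2 * (4 * ρ ^ 2 + μ * β * s / 2)
    * (C + 1 + σ ^ 2) ^ 2 * μ ≤ s ^ 3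
  small_exit : 4 * Real.exp (62 * (K + 1)) * (Real.exp (62 * (K + 1)) * (1 + L) + 1)
    * (C + 1 + σ ^ 2) ^ 3 * ρ ^ 4 * μ ^ 2 ≤ s ^ 7
  small_grad : ρ * ‖g‖ ≤ s
  small_gain : ρ ^ 2 * (K + 1) * Real.exp (62 * (K + 1)) * (‖g‖ ^ 2 + μ * s * σl ^ 2) ≤ 2 * s ^ 3
  small_radius : (Real.exp (62 * (K + 1)) * (1 + L) + 1) * s ^ 2 ≤ ρ ^ 2
  small_bias : 16 * (K + 1) * Real.exp (62 * (K + 1)) * b ^ 2 ≤ s * μ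
  small_gap : 4 * (K + 1) * κ ≤ μ ^ 2 * s

namespace Saddle

variable {M : ℕ} (W : Saddle M)

attribute [instance] Saddle.prob

/-- The growth factor over the length of the episode. -/
def E₁ : ℝ := Real.exp (62 * (W.K + 1))

/-- The typical distance travelled in an episode. -/
def m₀ : ℝ := √((W.C + 1 + W.σ ^ 2) * W.μ / W.s)

/-- The coefficient of the moment function. -/
def κ₀ : ℝ := W.μ / (2 * W.E₁)

/-- The weighted quadratic model of the objective when `m` steps remain. -/
def quad (m : ℕ) (d : Param M) : ℝ :=
  ∑ i, (1 + W.μ * W.lam i) ^ m * (⟪W.e i, W.g⟫ * ⟪W.e i, d⟫ + W.lam i / 2 * ⟪W.e i, d⟫ ^ 2)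

/-- The expected gain in the step after which `j` steps remain. -/
def gain (j : ℕ) : ℝ :=
  W.μ / 2 * ∑ i, (1 + W.μ * W.lam i) ^ j * ⟪W.e i, W.g⟫ ^ 2
    + W.μ ^ 2 / 2 * ((1 + W.μ * W.lam W.top) ^ j * W.lam W.top * (3 / 4 * W.σl ^ 2)
      - ∑ i, (1 + W.μ * W.lam i) ^ j * max (-W.lam i) 0 * W.σ ^ 2)
    - 4 * W.μ * W.E₁ * W.b ^ 2 - W.κ

/-- The lower bound for the value of the stopped process when `m` steps remain. -/
def Ψ (m : ℕ) (x : Param M) : ℝ :=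
  W.f W.a + W.quad m (x - W.a) + ∑ j ∈ Finset.range m, W.gain j
    - W.κ₀ * (1 + 62 * (W.μ * W.s)) ^ m * momentFun W.m₀ (x - W.a)

lemma E₁_pos : 0 < W.E₁ := Real.exp_pos _

lemma one_le_E₁ : 1 ≤ W.E₁ := Real.one_le_exp (by linarith [W.K_ge])

lemma κ₀_pos : 0 < W.κ₀ := div_pos W.μ_pos (by linarith [W.E₁_pos])

lemma μs_pos : 0 < W.μ * W.s := mul_pos W.μ_pos W.s_pos

lemma A_pos : 0 < W.C + 1 + W.σ ^ 2 := by linarith [W.C_nonneg, sq_nonneg W.σ]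

lemma m₀_sq : W.m₀ ^ 2 = (W.C + 1 + W.σ ^ 2) * W.μ / W.s :=
  Real.sq_sqrt (div_nonneg (mul_nonneg W.A_pos.le W.μ_pos.le) W.s_pos.le)

lemma m₀_pos : 0 < W.m₀ := Real.sqrt_pos.2 (div_pos (mul_pos W.A_pos W.μ_pos) W.s_pos)

lemma growth_le {m : ℕ} (hm : m ≤ W.T) : (1 + 62 * (W.μ * W.s)) ^ m ≤ W.E₁ := by
  have h0 := W.μs_pos
  have h1 : 1 + 62 * (W.μ * W.s) ≤ Real.exp (62 * (W.μ * W.s)) := by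
    linarith [Real.add_one_le_exp (62 * (W.μ * W.s))]
  calc (1 + 62 * (W.μ * W.s)) ^ m ≤ (1 + 62 * (W.μ * W.s)) ^ W.T :=
        pow_le_pow_right₀ (by linarith) hm
    _ ≤ Real.exp (62 * (W.μ * W.s)) ^ W.T := pow_le_pow_left₀ (by linarith) h1 _
    _ = Real.exp (62 * (W.μ * W.s * W.T)) := by rw [← Real.exp_nat_mul]; ring_nf
    _ ≤ W.E₁ := Real.exp_le_exp.2 (by linarith [W.T_le])

lemma abs_mul_le (i : Fin M) : |W.lam i| * W.μ ≤ 1 / 4 :=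
  (mul_le_mul_of_nonneg_right (W.abs_lam_le i) W.μ_pos.le).trans W.step_L

lemma factor_pos (i : Fin M) : 0 < 1 + W.μ * W.lam i := by
  have h := W.abs_mul_le i
  have h2 := neg_abs_le (W.lam i)
  nlinarith [W.μ_pos]

lemma factor_pow_le {m : ℕ} (hm : m ≤ W.T) (i : Fin M) : (1 + W.μ * W.lam i) ^ m ≤ W.E₁ := by
  refine (pow_le_pow_left₀ (W.factor_pos i).le ?_ m).trans (W.growth_le hm)
  nlinarith [mul_le_mul_of_nonneg_left (W.lam_le i) W.μ_pos.le, W.μs_pos]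

lemma sum_sq_inner (d : Param M) : ∑ i, ⟪W.e i, d⟫ ^ 2 = ‖d‖ ^ 2 := by
  have := W.e.sum_sq_norm_inner_right d
  simpa using this

lemma inner_eq_sum (x y : Param M) : ⟪x, y⟫ = ∑ i, ⟪W.e i, x⟫ * ⟪W.e i, y⟫ := by
  rw [← W.e.sum_inner_mul_inner x y]
  exact Finset.sum_congr rfl fun i _ => by rw [real_inner_comm]

lemma quad_zero (d : Param M) : W.quad 0 d = ⟪W.g, d⟫ + ⟪d, W.H d⟫ / 2 := by
  rw [quad, W.inner_eq_sum W.g d, W.inner_eq_sum d (W.H d), Finset.sum_div,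
    ← Finset.sum_add_distrib]
  refine Finset.sum_congr rfl fun i _ => ?_
  rw [W.eig]
  ring

/-- The expected motion in one step inside the region where the quadratic model is accurate. -/
lemma drift_le {d : Param M} (hd : W.ρ * ‖d‖ ≤ W.s) {m : Param M}
    (hm : ‖m - (W.g + W.H d)‖ ≤ W.ρ * ‖d‖ ^ 2 + W.b) :
    2 * ⟪d, m⟫ + W.μ * W.σ ^ 2 ≤ 7 * W.s * (‖d‖ ^ 2 + W.m₀ ^ 2) := by
  have hs := W.s_pos
  have hμ := W.μ_pos
  have h1 : 2 * ⟪d, W.g + W.H d⟫ ≤ 4 * W.s * ‖d‖ ^ 2 + W.C * W.μ := by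
    rw [W.inner_eq_sum, Finset.mul_sum, ← W.sum_sq_inner, Finset.mul_sum]
    refine le_trans ?_ (add_le_add_right W.rate_le _)
    rw [← Finset.sum_add_distrib]
    refine Finset.sum_le_sum fun i _ => ?_
    rw [inner_add_right, W.eig]
    set γ' := ⟪W.e i, W.g⟫
    set y := ⟪W.e i, d⟫
    have hp : 0 < W.s + |W.lam i| := by positivity
    -- Young's inequality with weight `s + |λ_i|`, so that the constant terms sum to the left side
    -- of `rate_le`. As `λ_i ≤ s`, the quadratic part stays below `4 s y²`.
    have h2 : 2 * (y * γ') ≤ (W.s + |W.lam i|) * y ^ 2 + γ' ^ 2 / (W.s + |W.lam i|) := by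
      have e : (W.s + |W.lam i|) * y ^ 2 + γ' ^ 2 / (W.s + |W.lam i|) - 2 * (y * γ')
          = ((W.s + |W.lam i|) * y - γ') ^ 2 / (W.s + |W.lam i|) := by
        field_simp
        ring
      have : 0 ≤ ((W.s + |W.lam i|) * y - γ') ^ 2 / (W.s + |W.lam i|) := by positivity
      linarith
    have h3 : |W.lam i| + 2 * W.lam i ≤ 3 * W.s := by
      rcases abs_cases (W.lam i) with ⟨h, _⟩ | ⟨h, _⟩ <;> rw [h] <;> linarith [W.lam_le i]
    nlinarith [sq_nonneg y]
  have h2 : 2 * ⟪d, m - (W.g + W.H d)⟫ ≤ 3 * W.s * ‖d‖ ^ 2 + W.μ := by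
    have a1 : ⟪d, m - (W.g + W.H d)⟫ ≤ ‖d‖ * (W.ρ * ‖d‖ ^ 2 + W.b) :=
      (real_inner_le_norm _ _).trans (mul_le_mul_of_nonneg_left hm (norm_nonneg d))
    have a2 : W.ρ * ‖d‖ * ‖d‖ ^ 2 ≤ W.s * ‖d‖ ^ 2 := by gcongr
    have hb : W.b ^ 2 ≤ W.s * W.μ := by
      have h := W.small_bias
      have hE : 1 ≤ Real.exp (62 * (W.K + 1)) := W.one_le_E₁
      have hK := W.K_ge
      have : 1 ≤ 16 * (W.K + 1) * Real.exp (62 * (W.K + 1)) := by nlinarith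
      nlinarith [sq_nonneg W.b]
    have a3 : 2 * (‖d‖ * W.b) ≤ W.s * ‖d‖ ^ 2 + W.μ := by
      have e : W.s * (W.s * ‖d‖ ^ 2 + W.μ - 2 * (‖d‖ * W.b))
          = (W.s * ‖d‖ - W.b) ^ 2 + (W.s * W.μ - W.b ^ 2) := by ring
      have : 0 ≤ W.s * (W.s * ‖d‖ ^ 2 + W.μ - 2 * (‖d‖ * W.b)) := by
        rw [e]; nlinarith [sq_nonneg (W.s * ‖d‖ - W.b)]
      nlinarith [nonneg_of_mul_nonneg_right this hs]
    nlinarith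
  have h3 : ⟪d, m⟫ = ⟪d, W.g + W.H d⟫ + ⟪d, m - (W.g + W.H d)⟫ := by
    rw [← inner_add_right]
    congr 1
    abel
  have h4 : W.s * W.m₀ ^ 2 = (W.C + 1 + W.σ ^ 2) * W.μ := by
    rw [W.m₀_sq]
    field_simp
  have h5 : 0 ≤ W.C * W.μ := mul_nonneg W.C_nonneg hμ.le
  have h6 : 0 ≤ W.σ ^ 2 * W.μ := by positivity
  nlinarith

lemma integral_momentFun_le {d : Param M} (hd : W.ρ * ‖d‖ ≤ W.s) :
    ∫ v, momentFun W.m₀ (d + W.μ • v) ∂(W.ν (W.a + d))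
      ≤ (1 + 61 * (W.μ * W.s)) * momentFun W.m₀ d := by
  refine momentFun_step_le (W.bounded _) W.μ_pos W.s_pos W.m₀_pos W.step_rate ?_ d
    (W.drift_le hd (by simpa using W.mean (W.a + d)))
  have h4 : W.s * W.m₀ ^ 2 = (W.C + 1 + W.σ ^ 2) * W.μ := by
    rw [W.m₀_sq]
    field_simp [W.s_pos.ne']
  rw [h4]
  nlinarith [W.C_nonneg, W.μ_pos]

lemma m₀_pow_four : W.m₀ ^ 4 = (W.C + 1 + W.σ ^ 2) ^ 2 * W.μ ^ 2 / W.s ^ 2 := by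
  have : W.m₀ ^ 4 = (W.m₀ ^ 2) ^ 2 := by ring
  rw [this, W.m₀_sq]
  ring

lemma m₀_pow_six : W.m₀ ^ 6 = (W.C + 1 + W.σ ^ 2) ^ 3 * W.μ ^ 3 / W.s ^ 3 := by
  have : W.m₀ ^ 6 = (W.m₀ ^ 2) ^ 3 := by ring
  rw [this, W.m₀_sq]
  ring

/-- Half of the penalty covers the Taylor remainder at the end of the episode; the other half is
left for an early exit. -/
lemma cubic_le (d : Param M) : W.ρ * ‖d‖ ^ 3 ≤ W.κ₀ / 2 * momentFun W.m₀ d := by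
  have hs := W.s_pos
  have hμ := W.μ_pos
  have hE := W.E₁_pos
  have h : W.ρ * W.m₀ ^ 3 ≤ W.κ₀ / 2 := by
    refine abs_le_of_sq_le_sq' ?_ (by linarith [W.κ₀_pos]) |>.2
    have e1 : (W.ρ * W.m₀ ^ 3) ^ 2 = W.ρ ^ 2 * W.m₀ ^ 6 := by ring
    rw [e1, W.m₀_pow_six, κ₀]
    have h := W.small_cubic
    change 16 * W.E₁ ^ 2 * W.ρ ^ 2 * (W.C + 1 + W.σ ^ 2) ^ 3 * W.μ ≤ W.s ^ 3 at h
    have h2 := mul_le_mul_of_nonneg_right h (sq_nonneg W.μ)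
    rw [div_div, div_pow, ← mul_div_assoc, div_le_div_iff₀ (by positivity) (by positivity)]
    nlinarith
  have h0 : 0 ≤ momentFun W.m₀ d := by unfold momentFun; positivity
  calc W.ρ * ‖d‖ ^ 3 ≤ W.ρ * (W.m₀ ^ 3 * momentFun W.m₀ d) :=
        mul_le_mul_of_nonneg_left (norm_pow_le_momentFun W.m₀_pos d).1 W.ρ_pos.le
    _ = W.ρ * W.m₀ ^ 3 * momentFun W.m₀ d := by ring
    _ ≤ _ := mul_le_mul_of_nonneg_right h h0

/-- The per-step errors of the mean and of the covariance are quartic in the distance. They fit into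
the surplus between the factor `1 + 62 μ s` in `Ψ` and the actual growth `1 + 61 μ s` of the moment
function. -/
lemma quartic_le (d : Param M) :
    W.E₁ * (4 * W.μ * W.ρ ^ 2 + W.μ ^ 2 / 2 * W.s * W.β) * ‖d‖ ^ 4
      ≤ W.κ₀ * (W.μ * W.s) * momentFun W.m₀ d := by
  have hs := W.s_pos
  have hμ := W.μ_pos
  have hE := W.E₁_pos
  have hβ := W.β_nonneg
  have h : W.E₁ * (4 * W.μ * W.ρ ^ 2 + W.μ ^ 2 / 2 * W.s * W.β) * W.m₀ ^ 4
      ≤ W.κ₀ * (W.μ * W.s) := by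
    have e : W.κ₀ * (W.μ * W.s) = W.μ ^ 2 * W.s / (2 * W.E₁) := by rw [κ₀]; ring
    rw [W.m₀_pow_four, e]
    have h := W.small_quartic
    change 2 * W.E₁ ^ 2 * (4 * W.ρ ^ 2 + W.μ * W.β * W.s / 2)
      * (W.C + 1 + W.σ ^ 2) ^ 2 * W.μ ≤ W.s ^ 3 at h
    have h2 := mul_le_mul_of_nonneg_right h (sq_nonneg W.μ)
    rw [← mul_div_assoc, div_le_div_iff₀ (by positivity) (by positivity)]
    nlinarith
  have h0 : 0 ≤ momentFun W.m₀ d := by unfold momentFun; positivity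
  calc _ ≤ W.E₁ * (4 * W.μ * W.ρ ^ 2 + W.μ ^ 2 / 2 * W.s * W.β)
        * (W.m₀ ^ 4 * momentFun W.m₀ d) :=
        mul_le_mul_of_nonneg_left (norm_pow_le_momentFun W.m₀_pos d).2.1 (by positivity)
    _ = W.E₁ * (4 * W.μ * W.ρ ^ 2 + W.μ ^ 2 / 2 * W.s * W.β) * W.m₀ ^ 4
        * momentFun W.m₀ d := by ring
    _ ≤ _ := mul_le_mul_of_nonneg_right h h0

/-- Outside the region `‖d‖² ≤ (ρ / s)⁴ ‖d‖⁶`, so the sixth-order growth of the penalty dominates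
every quadratic quantity. This is why a sixth moment is used. -/
lemma exit_le {d : Param M} (hd : W.s ≤ W.ρ * ‖d‖) :
    (W.E₁ * (1 + W.L) + 1) * ‖d‖ ^ 2 ≤ W.κ₀ / 2 * momentFun W.m₀ d := by
  have hs := W.s_pos
  have hμ := W.μ_pos
  have hE := W.E₁_pos
  have hL := W.L_nonneg
  have h0 : 0 ≤ momentFun W.m₀ d := by unfold momentFun; positivity
  have h4 : W.s ^ 4 ≤ W.ρ ^ 4 * ‖d‖ ^ 4 := by
    rw [← mul_pow]
    exact pow_le_pow_left₀ hs.le hd 4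
  have h : (W.E₁ * (1 + W.L) + 1) * W.ρ ^ 4 * W.m₀ ^ 6 ≤ W.κ₀ / 2 * W.s ^ 4 := by
    rw [W.m₀_pow_six, κ₀]
    have h := W.small_exit
    change 4 * W.E₁ * (W.E₁ * (1 + W.L) + 1) * (W.C + 1 + W.σ ^ 2) ^ 3 * W.ρ ^ 4 * W.μ ^ 2
      ≤ W.s ^ 7 at h
    have h2 := mul_le_mul_of_nonneg_right h hμ.le
    rw [← mul_div_assoc, div_div, div_mul_eq_mul_div,
      div_le_div_iff₀ (by positivity) (by positivity)]
    nlinarith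
  have h5 : W.s ^ 4 * ((W.E₁ * (1 + W.L) + 1) * ‖d‖ ^ 2)
      ≤ W.s ^ 4 * (W.κ₀ / 2 * momentFun W.m₀ d) := by
    calc W.s ^ 4 * ((W.E₁ * (1 + W.L) + 1) * ‖d‖ ^ 2)
        ≤ (W.ρ ^ 4 * ‖d‖ ^ 4) * ((W.E₁ * (1 + W.L) + 1) * ‖d‖ ^ 2) := by gcongr
      _ = (W.E₁ * (1 + W.L) + 1) * W.ρ ^ 4 * ‖d‖ ^ 6 := by ring
      _ ≤ (W.E₁ * (1 + W.L) + 1) * W.ρ ^ 4 * (W.m₀ ^ 6 * momentFun W.m₀ d) := by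
        gcongr
        exact (norm_pow_le_momentFun W.m₀_pos d).2.2
      _ = ((W.E₁ * (1 + W.L) + 1) * W.ρ ^ 4 * W.m₀ ^ 6) * momentFun W.m₀ d := by ring
      _ ≤ (W.κ₀ / 2 * W.s ^ 4) * momentFun W.m₀ d := mul_le_mul_of_nonneg_right h h0
      _ = _ := by ring
  exact le_of_mul_le_mul_left h5 (by positivity)

end Saddle

/-! ### The episode at a strict saddle: verification of the certificate. -/

namespace Saddle

variable {M : ℕ} (W : Saddle M)

lemma continuous_quad (m : ℕ) : Continuous (W.quad m) := by
  unfold quad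
  fun_prop

lemma continuous_momentFun (m₀ : ℝ) : Continuous (momentFun (M := M) m₀) := by
  unfold momentFun
  fun_prop

lemma continuous_Ψ (m : ℕ) : Continuous (W.Ψ m) := by
  have h1 := W.continuous_quad m
  have h2 := continuous_momentFun (M := M) W.m₀
  unfold Ψ
  fun_prop

/-- The one-dimensional bound is applied in each eigendirection; its factor `1 + μ λ_i` raises the
exponent of the weight from `m` to `m + 1`, so the recursion in `m` is consistent. -/
lemma quad_step_le {m : ℕ} (hm : m ≤ W.T) (d : Param M) :
    W.quad (m + 1) d + W.gain m + W.κ - W.E₁ * (4 * W.μ * W.ρ ^ 2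
        + W.μ ^ 2 / 2 * W.s * W.β) * ‖d‖ ^ 4
      ≤ ∫ v, W.quad m (d + W.μ • v) ∂(W.ν (W.a + d)) := by
  have hμ := W.μ_pos
  have hE := W.E₁_pos
  have hν := W.bounded (W.a + d)
  set ν := W.ν (W.a + d) with hνdef
  set mv := ∫ v, v ∂ν with hmv
  set w : Fin M → ℝ := fun i => (1 + W.μ * W.lam i) ^ m with hw
  have hw0 : ∀ i, 0 ≤ w i := fun i => pow_nonneg (W.factor_pos i).le m
  have hwE : ∀ i, w i ≤ W.E₁ := fun i => W.factor_pow_le hm i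
  have hV0 : ∀ i, 0 ≤ dirVar ν (W.e i) := fun i => dirVar_nonneg hν _
  have hV1 : ∀ i, dirVar ν (W.e i) ≤ W.σ ^ 2 := fun i => dirVar_le hν (W.e.norm_eq_one i)
  set r := mv - (W.g + W.H d) with hr
  have hri : ∀ i, ⟪W.e i, mv⟫ - (⟪W.e i, W.g⟫ + W.lam i * ⟪W.e i, d⟫) = ⟪W.e i, r⟫ := by
    intro i
    rw [hr, inner_sub_right, inner_add_right, W.eig]
  have hint : ∫ v, W.quad m (d + W.μ • v) ∂ν = ∑ i, w i *
      ∫ v, (⟪W.e i, W.g⟫ * (⟪W.e i, d⟫ + W.μ * ⟪W.e i, v⟫)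
        + W.lam i / 2 * (⟪W.e i, d⟫ + W.μ * ⟪W.e i, v⟫) ^ 2) ∂ν := by
    simp only [quad, inner_add_right, inner_smul_right]
    rw [integral_finsetSum]
    · simp only [integral_const_mul, hw]
    · intro i _
      exact integrable_of_continuous_of_ae_norm_le hν (by fun_prop)
  have hsum : ∑ i, w i * ((1 + W.μ * W.lam i) * (⟪W.e i, W.g⟫ * ⟪W.e i, d⟫
        + W.lam i / 2 * ⟪W.e i, d⟫ ^ 2) + W.μ / 2 * ⟪W.e i, W.g⟫ ^ 2
        - 2 * W.μ * ⟪W.e i, r⟫ ^ 2 + W.μ ^ 2 / 2 * W.lam i * dirVar ν (W.e i))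
      ≤ ∫ v, W.quad m (d + W.μ • v) ∂ν := by
    rw [hint]
    refine Finset.sum_le_sum fun i _ => mul_le_mul_of_nonneg_left ?_ (hw0 i)
    have h := PolicyGradient.quad_step_le hν hμ (W.e i) (W.abs_mul_le i) ⟪W.e i, W.g⟫ ⟪W.e i, d⟫
    rwa [hri] at h
  have hsplit : ∑ i, w i * ((1 + W.μ * W.lam i) * (⟪W.e i, W.g⟫ * ⟪W.e i, d⟫
        + W.lam i / 2 * ⟪W.e i, d⟫ ^ 2) + W.μ / 2 * ⟪W.e i, W.g⟫ ^ 2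
        - 2 * W.μ * ⟪W.e i, r⟫ ^ 2 + W.μ ^ 2 / 2 * W.lam i * dirVar ν (W.e i))
      = W.quad (m + 1) d + W.μ / 2 * ∑ i, w i * ⟪W.e i, W.g⟫ ^ 2
        - 2 * W.μ * ∑ i, w i * ⟪W.e i, r⟫ ^ 2
        + W.μ ^ 2 / 2 * ∑ i, w i * W.lam i * dirVar ν (W.e i) := by
    rw [quad, Finset.mul_sum, Finset.mul_sum, Finset.mul_sum, ← Finset.sum_add_distrib,
      ← Finset.sum_sub_distrib, ← Finset.sum_add_distrib]
    refine Finset.sum_congr rfl fun i _ => ?_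
    simp only [hw, pow_succ]
    ring
  have hr2 : ‖r‖ ^ 2 ≤ 2 * W.ρ ^ 2 * ‖d‖ ^ 4 + 2 * W.b ^ 2 := by
    have h1 : ‖r‖ ≤ W.ρ * ‖d‖ ^ 2 + W.b := by
      have := W.mean (W.a + d)
      rwa [add_sub_cancel_left] at this
    have h2 := pow_le_pow_left₀ (norm_nonneg r) h1 2
    nlinarith [sq_nonneg (W.ρ * ‖d‖ ^ 2 - W.b)]
  have herr : ∑ i, w i * ⟪W.e i, r⟫ ^ 2 ≤ W.E₁ * (2 * W.ρ ^ 2 * ‖d‖ ^ 4 + 2 * W.b ^ 2) := by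
    calc ∑ i, w i * ⟪W.e i, r⟫ ^ 2 ≤ ∑ i, W.E₁ * ⟪W.e i, r⟫ ^ 2 :=
          Finset.sum_le_sum fun i _ => mul_le_mul_of_nonneg_right (hwE i) (sq_nonneg _)
      _ = W.E₁ * ‖r‖ ^ 2 := by rw [← Finset.mul_sum, W.sum_sq_inner]
      _ ≤ _ := mul_le_mul_of_nonneg_left hr2 hE.le
  have hnoise : w W.top * W.lam W.top * (3 / 4 * W.σl ^ 2)
        - W.E₁ * W.s * W.β * ‖d‖ ^ 4 - ∑ i, w i * max (-W.lam i) 0 * W.σ ^ 2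
      ≤ ∑ i, w i * W.lam i * dirVar ν (W.e i) := by
    -- Only the variance along `top` is bounded below. Other nonnegative eigenvalues contribute a
    -- nonnegative amount that is dropped, and negative ones are charged the maximal variance `σ²`.
    have h1 : ∑ i, (if i = W.top then w i * W.lam i * dirVar ν (W.e i) else 0)
          - ∑ i, w i * max (-W.lam i) 0 * W.σ ^ 2
        ≤ ∑ i, w i * W.lam i * dirVar ν (W.e i) := by
      rw [← Finset.sum_sub_distrib]
      refine Finset.sum_le_sum fun i _ => ?_
      have hm0 : 0 ≤ w i * max (-W.lam i) 0 := mul_nonneg (hw0 i) (le_max_right _ _)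
      split_ifs with hi
      · have : 0 ≤ w i * max (-W.lam i) 0 * W.σ ^ 2 := mul_nonneg hm0 (sq_nonneg _)
        linarith
      · have h2 : -(w i * max (-W.lam i) 0) ≤ w i * W.lam i := by
          have := mul_le_mul_of_nonneg_left (le_max_left (-W.lam i) 0) (hw0 i)
          linarith
        have h3 := mul_le_mul_of_nonneg_right h2 (hV0 i)
        have h4 := mul_le_mul_of_nonneg_left (hV1 i) hm0
        linarith
    rw [Finset.sum_ite_eq' Finset.univ W.top, if_pos (Finset.mem_univ _)] at h1
    have h2 : 3 / 4 * W.σl ^ 2 - W.β * ‖d‖ ^ 4 ≤ dirVar ν (W.e W.top) := by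
      have := W.noise (W.a + d)
      rwa [add_sub_cancel_left] at this
    have hwl : 0 ≤ w W.top * W.lam W.top := mul_nonneg (hw0 _) W.top_pos.le
    have h3 := mul_le_mul_of_nonneg_left h2 hwl
    have h4 : w W.top * W.lam W.top * (W.β * ‖d‖ ^ 4) ≤ W.E₁ * W.s * (W.β * ‖d‖ ^ 4) := by
      have h5 : w W.top * W.lam W.top ≤ W.E₁ * W.s :=
        mul_le_mul (hwE _) (W.lam_le _) W.top_pos.le hE.le
      exact mul_le_mul_of_nonneg_right h5 (mul_nonneg W.β_nonneg (by positivity))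
    linarith
  rw [hsplit] at hsum
  have e1 := mul_le_mul_of_nonneg_left herr (by positivity : 0 ≤ 2 * W.μ)
  have e2 := mul_le_mul_of_nonneg_left hnoise (by positivity : 0 ≤ W.μ ^ 2 / 2)
  simp only [gain]
  simp only [hw] at hsum e1 e2
  nlinarith

lemma step_le {m : ℕ} (hm : m ≤ W.T) {x : Param M} (hx : W.ρ * ‖x - W.a‖ ≤ W.s) :
    W.Ψ (m + 1) x + W.κ ≤ ∫ v, W.Ψ m (x + W.μ • v) ∂(W.ν x) := by
  set d := x - W.a with hd
  have hxd : x = W.a + d := by rw [hd]; abel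
  have hν := W.bounded x
  have h1 : Integrable (fun v => W.quad m (d + W.μ • v)) (W.ν x) :=
    integrable_of_continuous_of_ae_norm_le hν
      ((W.continuous_quad m).comp (by fun_prop : Continuous fun v => d + W.μ • v))
  have h2 : Integrable (fun v => momentFun W.m₀ (d + W.μ • v)) (W.ν x) :=
    integrable_of_continuous_of_ae_norm_le hν
      ((continuous_momentFun W.m₀).comp (by fun_prop : Continuous fun v => d + W.μ • v))
  have hP : ∀ v, W.Ψ m (x + W.μ • v) = (W.f W.a + ∑ j ∈ Finset.range m, W.gain j)
      + W.quad m (d + W.μ • v)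
      - W.κ₀ * (1 + 62 * (W.μ * W.s)) ^ m * momentFun W.m₀ (d + W.μ • v) := by
    intro v
    have : x + W.μ • v - W.a = d + W.μ • v := by rw [hd]; abel
    rw [Ψ, this]
    ring
  have h12 : Integrable (fun v => (W.f W.a + ∑ j ∈ Finset.range m, W.gain j)
      + W.quad m (d + W.μ • v)) (W.ν x) := (integrable_const _).add h1
  simp_rw [hP]
  rw [integral_sub h12 (h2.const_mul _), integral_add (integrable_const _) h1,
    integral_const_mul, integral_const, probReal_univ, one_smul]
  have hq := W.quad_step_le hm d
  have hmom := W.integral_momentFun_le hx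
  rw [← hxd] at hq hmom
  have hqu := W.quartic_le d
  have hW0 : 0 ≤ momentFun W.m₀ d := by unfold momentFun; positivity
  have hk := W.κ₀_pos
  have hμs := W.μs_pos
  have hg1 : 1 ≤ (1 + 62 * (W.μ * W.s)) ^ m := one_le_pow₀ (by linarith)
  have hmom' := mul_le_mul_of_nonneg_left hmom
    (by positivity : 0 ≤ W.κ₀ * (1 + 62 * (W.μ * W.s)) ^ m)
  have hgrow : W.κ₀ * (W.μ * W.s) * momentFun W.m₀ d
      ≤ W.κ₀ * (1 + 62 * (W.μ * W.s)) ^ m * ((W.μ * W.s) * momentFun W.m₀ d) := by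
    have : 0 ≤ W.κ₀ * ((W.μ * W.s) * momentFun W.m₀ d) := by positivity
    nlinarith
  rw [Ψ, ← hd, Finset.sum_range_succ, pow_succ]
  nlinarith

lemma terminal_le (x : Param M) : W.Ψ 0 x ≤ W.f x := by
  have h1 := W.cubic_le (x - W.a)
  have h2 := (abs_le.1 (W.taylor x)).1
  have hk := W.κ₀_pos
  have hW0 : 0 ≤ momentFun W.m₀ (x - W.a) := by unfold momentFun; positivity
  rw [Ψ, W.quad_zero]
  simp only [Finset.range_zero, Finset.sum_empty, pow_zero, mul_one]
  nlinarith

lemma sum_abs_le (d : Param M) (c : Fin M → ℝ) (hc : ∀ i, |c i| ≤ W.E₁) :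
    ∑ i, c i * (⟪W.e i, W.g⟫ * ⟪W.e i, d⟫ + W.lam i / 2 * ⟪W.e i, d⟫ ^ 2)
      ≤ W.E₁ * (‖W.g‖ * ‖d‖ + W.L * ‖d‖ ^ 2) := by
  have hE := W.E₁_pos
  have h1 : ∑ i, |⟪W.e i, W.g⟫| * |⟪W.e i, d⟫| ≤ ‖W.g‖ * ‖d‖ := by
    have h := Finset.sum_mul_sq_le_sq_mul_sq Finset.univ (fun i => |⟪W.e i, W.g⟫|)
      (fun i => |⟪W.e i, d⟫|)
    simp only [sq_abs] at h
    rw [W.sum_sq_inner, W.sum_sq_inner, ← mul_pow] at h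
    exact abs_le_of_sq_le_sq' h (by positivity) |>.2
  calc ∑ i, c i * (⟪W.e i, W.g⟫ * ⟪W.e i, d⟫ + W.lam i / 2 * ⟪W.e i, d⟫ ^ 2)
      ≤ ∑ i, W.E₁ * (|⟪W.e i, W.g⟫| * |⟪W.e i, d⟫| + W.L * ⟪W.e i, d⟫ ^ 2) := by
        refine Finset.sum_le_sum fun i _ => ?_
        refine (le_abs_self _).trans ?_
        rw [abs_mul]
        refine mul_le_mul (hc i) ?_ (abs_nonneg _) hE.le
        refine (abs_add_le _ _).trans ?_
        rw [abs_mul, abs_mul, abs_div, abs_two, abs_of_nonneg (sq_nonneg ⟪W.e i, d⟫)]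
        have := W.abs_lam_le i
        have h0 := abs_nonneg (W.lam i)
        gcongr
        linarith
    _ = W.E₁ * (∑ i, |⟪W.e i, W.g⟫| * |⟪W.e i, d⟫| + W.L * ‖d‖ ^ 2) := by
        rw [← Finset.mul_sum, Finset.sum_add_distrib, ← Finset.mul_sum, W.sum_sq_inner]
    _ ≤ _ := by gcongr

lemma gain_le {j : ℕ} (hj : j ≤ W.T) :
    W.gain j ≤ W.E₁ / 2 * W.μ * (‖W.g‖ ^ 2 + W.μ * W.s * W.σl ^ 2) := by
  have hμ := W.μ_pos
  have hE := W.E₁_pos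
  have hs := W.s_pos
  have h1 : ∑ i, (1 + W.μ * W.lam i) ^ j * ⟪W.e i, W.g⟫ ^ 2 ≤ W.E₁ * ‖W.g‖ ^ 2 := by
    rw [← W.sum_sq_inner, Finset.mul_sum]
    exact Finset.sum_le_sum fun i _ =>
      mul_le_mul_of_nonneg_right (W.factor_pow_le hj i) (sq_nonneg _)
  have h2 : 0 ≤ ∑ i, (1 + W.μ * W.lam i) ^ j * max (-W.lam i) 0 * W.σ ^ 2 :=
    Finset.sum_nonneg fun i _ => mul_nonneg (mul_nonneg (pow_nonneg (W.factor_pos i).le j)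
      (le_max_right _ _)) (sq_nonneg _)
  have h3 : (1 + W.μ * W.lam W.top) ^ j * W.lam W.top * (3 / 4 * W.σl ^ 2)
      ≤ W.E₁ * W.s * W.σl ^ 2 := by
    have h5 : (1 + W.μ * W.lam W.top) ^ j * W.lam W.top ≤ W.E₁ * W.s :=
      mul_le_mul (W.factor_pow_le hj _) (W.lam_le _) W.top_pos.le hE.le
    exact mul_le_mul h5 (by nlinarith [sq_nonneg W.σl]) (by positivity) (by positivity)
  have h4 : 0 ≤ 4 * W.μ * W.E₁ * W.b ^ 2 := by positivity
  have e1 := mul_le_mul_of_nonneg_left h1 (by positivity : 0 ≤ W.μ / 2)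
  have e2 := mul_le_mul_of_nonneg_left h3 (by positivity : 0 ≤ W.μ ^ 2 / 2)
  have e3 := mul_nonneg (by positivity : 0 ≤ W.μ ^ 2 / 2) h2
  rw [gain]
  nlinarith [W.κ_nonneg]

/-- This keeps the accumulated gain below `‖d‖²` at every exit point, so that `exit_le` can absorb
it. -/
lemma sum_gain_le {m : ℕ} (hm : m ≤ W.T) :
    ∑ j ∈ Finset.range m, W.gain j ≤ (W.s / W.ρ) ^ 2 := by
  have hμ := W.μ_pos
  have hE := W.E₁_pos
  have hs := W.s_pos
  have hρ := W.ρ_pos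
  set Z := ‖W.g‖ ^ 2 + W.μ * W.s * W.σl ^ 2 with hZ
  have hZ0 : 0 ≤ Z := by positivity
  have h1 : ∑ j ∈ Finset.range m, W.gain j ≤ m * (W.E₁ / 2 * W.μ * Z) := by
    simpa using Finset.sum_le_card_nsmul (Finset.range m) _ _
      fun j hj => W.gain_le ((Finset.mem_range.1 hj).le.trans hm)
  have h2 : (m : ℝ) * (W.E₁ / 2 * W.μ * Z) ≤ W.T * (W.E₁ / 2 * W.μ * Z) := by
    have : (m : ℝ) ≤ W.T := by exact_mod_cast hm
    gcongr
  refine (h1.trans h2).trans ?_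
  have h3 := W.small_gain
  change W.ρ ^ 2 * (W.K + 1) * W.E₁ * Z ≤ 2 * W.s ^ 3 at h3
  have h4 := mul_le_mul_of_nonneg_right W.T_le
    (by positivity : 0 ≤ W.ρ ^ 2 * W.E₁ * Z)
  rw [div_pow, le_div_iff₀ (by positivity)]
  have h5 : W.s * (W.T * (W.E₁ / 2 * W.μ * Z) * W.ρ ^ 2) ≤ W.s * W.s ^ 2 := by nlinarith
  exact le_of_mul_le_mul_left h5 hs

/-- Stopping early replaces `quad m` by `quad 0` and leaves the gains of the remaining steps
unrealized. Both are at most a multiple of `‖d‖²` here, because `‖g‖ ≤ ‖d‖` outside the region; half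
of the penalty pays for them and the other half for the Taylor remainder. -/
lemma exit_value_le {m : ℕ} (hm : m ≤ W.T) {x : Param M} (hx : W.s ≤ W.ρ * ‖x - W.a‖) :
    W.Ψ m x ≤ W.f x := by
  set d := x - W.a with hd
  have hρ := W.ρ_pos
  have hs := W.s_pos
  have hE := W.E₁_pos
  have hk := W.κ₀_pos
  have hμs := W.μs_pos
  have hW0 : 0 ≤ momentFun W.m₀ d := by unfold momentFun; positivity
  have h1 := W.cubic_le d
  have h2 := (abs_le.1 (W.taylor x)).1
  have h3 := W.exit_le hx
  have hr : W.s / W.ρ ≤ ‖d‖ := by rw [div_le_iff₀ hρ, mul_comm]; exact hx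
  have h4 : ∑ j ∈ Finset.range m, W.gain j ≤ ‖d‖ ^ 2 :=
    (W.sum_gain_le hm).trans (pow_le_pow_left₀ (by positivity) hr 2)
  have h5 : W.quad m d - W.quad 0 d ≤ W.E₁ * (‖W.g‖ * ‖d‖ + W.L * ‖d‖ ^ 2) := by
    have := W.sum_abs_le d (fun i => (1 + W.μ * W.lam i) ^ m - 1) fun i => by
      have ha := W.factor_pow_le hm i
      have hb := pow_pos (W.factor_pos i) m
      rw [abs_le]
      constructor <;> linarith [W.one_le_E₁]
    refine le_trans (le_of_eq ?_) this
    rw [quad, quad, ← Finset.sum_sub_distrib]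
    refine Finset.sum_congr rfl fun i _ => ?_
    ring
  have h6 : ‖W.g‖ ≤ ‖d‖ := by
    have := W.small_grad.trans hx
    exact le_of_mul_le_mul_left this hρ
  have h7 : ‖W.g‖ * ‖d‖ ≤ ‖d‖ ^ 2 := by nlinarith [norm_nonneg d]
  have h8 := mul_le_mul_of_nonneg_left h7 hE.le
  have hg1 : 1 ≤ (1 + 62 * (W.μ * W.s)) ^ m := one_le_pow₀ (by linarith)
  have h9 : W.κ₀ * momentFun W.m₀ d
      ≤ W.κ₀ * (1 + 62 * (W.μ * W.s)) ^ m * momentFun W.m₀ d := by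
    have : 0 ≤ W.κ₀ * momentFun W.m₀ d := by positivity
    nlinarith
  rw [Ψ, ← hd]
  have h10 := W.quad_zero d
  rw [← hd] at h2
  nlinarith

/-- Inside the region the model and the gains together add at most `1`, as the radius `s / ρ` is
small. This is the origin of the extra `1` in the bound of the certificate. -/
lemma value_le {m : ℕ} (hm : m ≤ W.T) {x : Param M} (hx : W.ρ * ‖x - W.a‖ ≤ W.s) :
    W.Ψ m x ≤ W.fmax + 1 := by
  set d := x - W.a with hd
  have hρ := W.ρ_pos
  have hs := W.s_pos
  have hE := W.E₁_pos
  have hk := W.κ₀_pos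
  have hL := W.L_nonneg
  have hμs := W.μs_pos
  have hW0 : 0 ≤ momentFun W.m₀ d := by unfold momentFun; positivity
  have hr : ‖d‖ ≤ W.s / W.ρ := by rw [le_div_iff₀ hρ, mul_comm]; exact hx
  have hg : ‖W.g‖ ≤ W.s / W.ρ := by rw [le_div_iff₀ hρ, mul_comm]; exact W.small_grad
  have h5 : W.quad m d ≤ W.E₁ * (‖W.g‖ * ‖d‖ + W.L * ‖d‖ ^ 2) :=
    W.sum_abs_le d (fun i => (1 + W.μ * W.lam i) ^ m) fun i => by
      rw [abs_of_pos (pow_pos (W.factor_pos i) m)]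
      exact W.factor_pow_le hm i
  have h6 : ‖W.g‖ * ‖d‖ + W.L * ‖d‖ ^ 2 ≤ (1 + W.L) * (W.s / W.ρ) ^ 2 := by
    have h1 : ‖W.g‖ * ‖d‖ ≤ (W.s / W.ρ) * (W.s / W.ρ) :=
      mul_le_mul hg hr (norm_nonneg _) (by positivity)
    have h2 := mul_le_mul_of_nonneg_left (pow_le_pow_left₀ (norm_nonneg d) hr 2) hL
    linarith
  have h7 := mul_le_mul_of_nonneg_left h6 hE.le
  have h8 := W.sum_gain_le hm
  have h9 : (W.E₁ * (1 + W.L) + 1) * (W.s / W.ρ) ^ 2 ≤ 1 := by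
    rw [div_pow, ← mul_div_assoc, div_le_one (by positivity)]
    exact W.small_radius
  have h10 : 0 ≤ W.κ₀ * (1 + 62 * (W.μ * W.s)) ^ m * momentFun W.m₀ d := by positivity
  rw [Ψ, ← hd]
  linarith [W.le_fmax W.a]

/-- The weights of the drift and noise terms, summed over an episode. -/
lemma one_le_sum_factor (i : Fin M) :
    1 ≤ W.μ * (W.s + |W.lam i|) * ∑ j ∈ Finset.range W.T, (1 + W.μ * W.lam i) ^ j := by
  have hμ := W.μ_pos
  have hs := W.s_pos
  have hT : 1 ≤ W.μ * W.s * W.T := W.K_ge.trans W.T_ge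
  set q := 1 + W.μ * W.lam i with hq
  have hq0 : 0 < q := W.factor_pos i
  rcases le_or_gt 0 (W.lam i) with h | h
  · have h1 : (W.T : ℝ) ≤ ∑ j ∈ Finset.range W.T, q ^ j := by
      have := Finset.card_nsmul_le_sum (Finset.range W.T) (fun j => q ^ j) 1
        fun j _ => one_le_pow₀ (by rw [hq]; nlinarith)
      simpa using this
    have h2 : W.μ * W.s ≤ W.μ * (W.s + |W.lam i|) := by
      have := abs_nonneg (W.lam i)
      gcongr
      linarith
    calc 1 ≤ W.μ * W.s * W.T := hT
      _ ≤ _ := mul_le_mul h2 h1 (by positivity) (by positivity)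
  · have hq1 : q ≤ 1 := by rw [hq]; nlinarith
    have h1 : (W.T : ℝ) * q ^ W.T ≤ ∑ j ∈ Finset.range W.T, q ^ j := by
      have := Finset.card_nsmul_le_sum (Finset.range W.T) (fun j => q ^ j) (q ^ W.T)
        fun j hj => pow_le_pow_of_le_one hq0.le hq1 (Finset.mem_range.1 hj).le
      simpa using this
    have h2 := mul_neg_geom_sum q W.T
    rw [abs_of_neg h]
    have h3 := mul_le_mul_of_nonneg_left h1 W.μs_pos.le
    -- For a negative eigenvalue `-μ λ ∑ q ^ j = 1 - q ^ T`; the part with `μ s` has to supply the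
    -- missing `q ^ T`, which it does since `μ s T ≥ 1`.
    have h4 : q ^ W.T ≤ W.μ * W.s * (W.T * q ^ W.T) := by
      nlinarith [pow_pos hq0 W.T]
    have h5 : 1 - q = -(W.μ * W.lam i) := by rw [hq]; ring
    rw [h5] at h2
    nlinarith

/-- The geometric sum shows that contraction in a negative direction bounds its total loss
independently of the length of the episode. -/
lemma sum_factor_neg_le (i : Fin M) :
    W.μ * max (-W.lam i) 0 * ∑ j ∈ Finset.range W.T, (1 + W.μ * W.lam i) ^ j ≤ 1 := by
  rcases le_or_gt 0 (W.lam i) with h | h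
  · rw [max_eq_right (by linarith)]
    simp
  · have h2 := mul_neg_geom_sum (1 + W.μ * W.lam i) W.T
    rw [max_eq_left (by linarith)]
    have := pow_pos (W.factor_pos i) W.T
    linarith

/-- A balance in units of `μ`: the gain is at least `M σ² / 2 + 1`; negative directions lose at most
`M σ² / 2`, the bias and the demanded gain at most `1/4` each, and the penalty at the anchor is at
most `1/2`. -/
lemma start_le : W.f W.a ≤ W.Ψ W.T W.a := by
  have hμ := W.μ_pos
  have hs := W.s_pos
  have hE := W.E₁_pos
  have hK := W.K_ge
  set Sg : Fin M → ℝ := fun i => ∑ j ∈ Finset.range W.T, (1 + W.μ * W.lam i) ^ j with hSg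
  have hSg0 : ∀ i, 0 ≤ Sg i := fun i =>
    Finset.sum_nonneg fun j _ => pow_nonneg (W.factor_pos i).le j
  have hsum : ∑ j ∈ Finset.range W.T, W.gain j
      = W.μ / 2 * ∑ i, Sg i * ⟪W.e i, W.g⟫ ^ 2
        + W.μ ^ 2 / 2 * (Sg W.top * W.lam W.top * (3 / 4 * W.σl ^ 2)
          - ∑ i, Sg i * max (-W.lam i) 0 * W.σ ^ 2)
        - W.T * (4 * W.μ * W.E₁ * W.b ^ 2) - W.T * W.κ := by
    simp only [gain, Finset.sum_sub_distrib, Finset.sum_add_distrib, ← Finset.mul_sum,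
      ← Finset.sum_mul, Finset.sum_const, Finset.card_range, nsmul_eq_mul, hSg]
    rw [Finset.sum_comm (s := Finset.range W.T), Finset.sum_comm (s := Finset.range W.T)]
    simp only [← Finset.sum_mul]
    ring
  have hloss : W.μ ^ 2 / 2 * ∑ i, Sg i * max (-W.lam i) 0 * W.σ ^ 2
      ≤ W.μ * (M * W.σ ^ 2 / 2) := by
    have h1 : ∀ i ∈ Finset.univ, W.μ * (Sg i * max (-W.lam i) 0 * W.σ ^ 2) ≤ W.σ ^ 2 := by
      intro i _
      have := mul_le_mul_of_nonneg_right (W.sum_factor_neg_le i) (sq_nonneg W.σ)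
      simp only [hSg]
      nlinarith
    have h2 := Finset.sum_le_card_nsmul _ _ _ h1
    rw [← Finset.mul_sum, Finset.card_univ, Fintype.card_fin, nsmul_eq_mul] at h2
    have h3 := mul_le_mul_of_nonneg_left h2 (by positivity : 0 ≤ W.μ / 2)
    nlinarith
  have hdrift0 : 0 ≤ W.μ / 2 * ∑ i, Sg i * ⟪W.e i, W.g⟫ ^ 2 :=
    mul_nonneg (by positivity) (Finset.sum_nonneg fun i _ => mul_nonneg (hSg0 i) (sq_nonneg _))
  have hnoise0 : 0 ≤ W.μ ^ 2 / 2 * (Sg W.top * W.lam W.top * (3 / 4 * W.σl ^ 2)) :=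
    mul_nonneg (by positivity) (mul_nonneg (mul_nonneg (hSg0 _) W.top_pos.le) (by positivity))
  have hgain : W.μ * (M * W.σ ^ 2 / 2 + 1) ≤ W.μ / 2 * ∑ i, Sg i * ⟪W.e i, W.g⟫ ^ 2
      + W.μ ^ 2 / 2 * (Sg W.top * W.lam W.top * (3 / 4 * W.σl ^ 2)) := by
    -- If `s` is the top eigenvalue, the noise along `top` is collected for `K / (μ s)` steps and
    -- `K_gain` applies. Otherwise `one_le_sum_factor` bounds the drift gain below by half of the
    -- sum in `rate_eq`, which equals `C μ`.
    rcases W.rate_eq with h | h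
    · have h1 : (W.T : ℝ) ≤ Sg W.top := by
        have := Finset.card_nsmul_le_sum (Finset.range W.T)
          (fun j => (1 + W.μ * W.lam W.top) ^ j) 1
          fun j _ => one_le_pow₀ (by nlinarith [W.top_pos])
        simpa using this
      have h2 : W.K ≤ W.μ * W.lam W.top * Sg W.top := by
        rw [← h]
        exact W.T_ge.trans (mul_le_mul_of_nonneg_left h1 W.μs_pos.le)
      have h3 := mul_le_mul_of_nonneg_left h2 (by positivity : 0 ≤ 3 / 8 * W.σl ^ 2)
      have h4 := mul_le_mul_of_nonneg_left (W.K_gain.trans h3) hμ.le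
      nlinarith
    · have h1 : ∑ i, ⟪W.e i, W.g⟫ ^ 2 / (W.s + |W.lam i|)
          ≤ W.μ * ∑ i, Sg i * ⟪W.e i, W.g⟫ ^ 2 := by
        rw [Finset.mul_sum]
        refine Finset.sum_le_sum fun i _ => ?_
        have hp : 0 < W.s + |W.lam i| := by positivity
        rw [div_le_iff₀ hp]
        have := mul_le_mul_of_nonneg_right (W.one_le_sum_factor i) (sq_nonneg ⟪W.e i, W.g⟫)
        simp only [hSg]
        nlinarith
      rw [h] at h1
      have h2 := mul_le_mul_of_nonneg_left W.C_ge hμ.le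
      nlinarith
  have hbias : W.T * (4 * W.μ * W.E₁ * W.b ^ 2) ≤ W.μ / 4 := by
    have h1 := W.small_bias
    change 16 * (W.K + 1) * W.E₁ * W.b ^ 2 ≤ W.s * W.μ at h1
    have h2 := mul_le_mul_of_nonneg_right W.T_le (by positivity : 0 ≤ 4 * W.E₁ * W.b ^ 2)
    have h3 : W.s * (W.T * (4 * W.μ * W.E₁ * W.b ^ 2)) ≤ W.s * (W.μ / 4) := by nlinarith
    exact le_of_mul_le_mul_left h3 hs
  have hgap : W.T * W.κ ≤ W.μ / 4 := by
    have h1 := W.small_gap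
    have h2 := mul_le_mul_of_nonneg_right W.T_le W.κ_nonneg
    have h3 : W.μ * W.s * (W.T * W.κ) ≤ W.μ * W.s * (W.μ / 4) := by nlinarith
    exact le_of_mul_le_mul_left h3 W.μs_pos
  have hκ : W.κ₀ * (1 + 62 * (W.μ * W.s)) ^ W.T ≤ W.μ / 2 := by
    have h1 := mul_le_mul_of_nonneg_left (W.growth_le le_rfl) W.κ₀_pos.le
    have h2 : W.κ₀ * W.E₁ = W.μ / 2 := by
      rw [κ₀]
      field_simp
    linarith
  have hq : W.quad W.T (W.a - W.a) = 0 := by simp [quad]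
  have hm : momentFun W.m₀ (W.a - W.a) = 1 := by simp [momentFun]
  rw [Ψ, hq, hm, hsum]
  nlinarith

/-- The episode that starts at a strict saddle point. -/
theorem hasEpisode (Q : ProbabilityTheory.Kernel (Param M) (Param M))
    (hQ : ∀ x, Q x = (W.ν x).map fun v => x + W.μ • v) :
    HasEpisode Q W.f W.κ (W.fmax + 1) W.a := by
  have hT : 0 < W.T := by
    rcases Nat.eq_zero_or_pos W.T with h | h
    · have h1 := W.T_ge
      rw [h] at h1
      norm_num at h1
      linarith [W.K_ge]
    · exact h
  have hmap : ∀ x, Measurable fun v : Param M => x + W.μ • v := fun x =>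
    (by fun_prop : Continuous fun v : Param M => x + W.μ • v).measurable
  have hT1 : W.T - 1 + 1 = W.T := Nat.sub_add_cancel hT
  -- The certificate starts from `Ψ (T + 1)`, so an episode of `W.T` steps is entered with `W.T -
  -- 1`.
  refine ⟨W.T - 1, {x | W.ρ * ‖x - W.a‖ ≤ W.s}, W.Ψ, ?_, ?_, ?_, ?_, W.terminal_le, ?_, ?_⟩
  · simp [W.s_pos.le]
  · intro m x _
    rw [hQ, integrable_map_measure (W.continuous_Ψ m).aestronglyMeasurable (hmap x).aemeasurable]
    exact integrable_of_continuous_of_ae_norm_le (W.bounded x)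
      ((W.continuous_Ψ m).comp (by fun_prop : Continuous fun v : Param M => x + W.μ • v))
  · rw [hT1]
    exact W.start_le
  · intro m hm x hx
    rw [hQ, integral_map (hmap x).aemeasurable (W.continuous_Ψ m).aestronglyMeasurable]
    exact W.step_le (by omega) hx
  · intro m hm x hx
    exact W.exit_value_le (by omega) (not_le.1 hx).le
  · intro m hm x hx
    exact W.value_le (by omega) hx

end Saddle

/-! ### Taylor estimates from the mean value inequality. -/

section Taylor

variable {V : Type*} [NormedAddCommGroup V] [InnerProductSpace ℝ V] {f : V → ℝ} {g : V → V}
  {H : V → V →L[ℝ] V} {L ρ : ℝ}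

lemma abs_sub_linear_le (hf : ∀ x, HasFDerivAt f (innerSL ℝ (g x)) x)
    (hg : ∀ x, HasFDerivAt g (H x) x) (hL : ∀ x, ‖H x‖ ≤ L) (a x : V) :
    |f x - f a - ⟪g a, x - a⟫| ≤ L * ‖x - a‖ ^ 2 := by
  have hL0 : 0 ≤ L := (norm_nonneg _).trans (hL a)
  have h := (convex_closedBall a ‖x - a‖).norm_image_sub_le_of_norm_hasFDerivWithin_le'
    (f := f) (f' := fun y => innerSL ℝ (g y)) (φ := innerSL ℝ (g a)) (C := L * ‖x - a‖)
    (fun y _ => (hf y).hasFDerivWithinAt) (fun y hy => ?_) (x := a) (y := x)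
    (Metric.mem_closedBall_self (norm_nonneg _)) (by simp [dist_eq_norm])
  · rw [Real.norm_eq_abs] at h
    simpa [pow_two, mul_assoc] using h
  · rw [← map_sub, innerSL_apply_norm]
    refine (convex_univ.norm_image_sub_le_of_norm_hasFDerivWithin_le
      (fun z _ => (hg z).hasFDerivWithinAt) (fun z _ => hL z) (Set.mem_univ a)
      (Set.mem_univ y)).trans ?_
    rw [Metric.mem_closedBall, dist_eq_norm] at hy
    gcongr

lemma norm_sub_linear_le (hg : ∀ x, HasFDerivAt g (H x) x)
    (hρ : ∀ x y, ‖H x - H y‖ ≤ ρ * ‖x - y‖) (hρ0 : 0 ≤ ρ) (a x : V) :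
    ‖g x - g a - H a (x - a)‖ ≤ ρ * ‖x - a‖ ^ 2 := by
  have h := (convex_closedBall a ‖x - a‖).norm_image_sub_le_of_norm_hasFDerivWithin_le'
    (f := g) (f' := H) (φ := H a) (C := ρ * ‖x - a‖)
    (fun y _ => (hg y).hasFDerivWithinAt) (fun y hy => ?_) (x := a) (y := x)
    (Metric.mem_closedBall_self (norm_nonneg _)) (by simp [dist_eq_norm])
  · simpa [pow_two, mul_assoc] using h
  · rw [Metric.mem_closedBall, dist_eq_norm] at hy
    exact (hρ y a).trans (by gcongr)

/-- Subtracting the quadratic form leaves a function whose gradient is `g y - H a (y - a)`, by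
symmetry of `H a`; the previous lemma bounds its deviation from `g a`. The sharper factor of
Taylor's formula is not needed. -/
lemma abs_sub_quadratic_le (hf : ∀ x, HasFDerivAt f (innerSL ℝ (g x)) x)
    (hg : ∀ x, HasFDerivAt g (H x) x) (hρ : ∀ x y, ‖H x - H y‖ ≤ ρ * ‖x - y‖) (hρ0 : 0 ≤ ρ)
    (hH : ∀ x, (H x : V →ₗ[ℝ] V).IsSymmetric) (a x : V) :
    |f x - f a - ⟪g a, x - a⟫ - ⟪x - a, H a (x - a)⟫ / 2| ≤ ρ * ‖x - a‖ ^ 3 := by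
  have hq : ∀ y, HasFDerivAt (fun y => f y - ⟪y - a, H a (y - a)⟫ / 2)
      (innerSL ℝ (g y - H a (y - a))) y := by
    intro y
    have h1 : HasFDerivAt (fun y : V => y - a) (ContinuousLinearMap.id ℝ V) y :=
      (hasFDerivAt_id y).sub_const a
    have h2 : HasFDerivAt (fun y : V => H a (y - a)) ((H a).comp (ContinuousLinearMap.id ℝ V)) y :=
      (H a).hasFDerivAt.comp y h1
    have h3 := (hf y).sub ((h1.inner ℝ h2).mul_const (1 / 2))
    refine (h3.congr_fderiv ?_).congr_of_eventuallyEq (.of_forall fun z => ?_)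
    · ext v
      have hs := hH a (y - a) v
      have hs' : ⟪y, H a v⟫ - ⟪a, H a v⟫ = ⟪v, H a y⟫ - ⟪v, H a a⟫ := by
        rw [← inner_sub_left, ← inner_sub_right, ← map_sub, real_inner_comm _ v]
        exact hs.symm
      simp [inner_sub_left, real_inner_comm]
      rw [inner_sub_right]
      linarith
    · simp [div_eq_mul_inv]
  have h := (convex_closedBall a ‖x - a‖).norm_image_sub_le_of_norm_hasFDerivWithin_le'
    (φ := innerSL ℝ (g a)) (C := ρ * ‖x - a‖ ^ 2)
    (fun y _ => (hq y).hasFDerivWithinAt) (fun y hy => ?_) (x := a) (y := x)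
    (Metric.mem_closedBall_self (norm_nonneg _)) (by simp [dist_eq_norm])
  · rw [Real.norm_eq_abs] at h
    simp only [sub_self, map_zero, inner_zero_right, innerSL_apply_apply, zero_div, sub_zero] at h
    refine le_trans (le_of_eq ?_) (h.trans_eq (by ring))
    congr 1
    ring
  · rw [← map_sub, innerSL_apply_norm]
    rw [Metric.mem_closedBall, dist_eq_norm] at hy
    have h4 := norm_sub_linear_le hg hρ hρ0 a y
    have e : g y - H a (y - a) - g a = g y - g a - H a (y - a) := by abel
    rw [e]
    exact h4.trans (by gcongr)

end Taylor

/-! ### Eigenbases, the largest eigenvalue, and the choice of the rate. -/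

section Spectral

variable {M : ℕ} {T : Param M →L[ℝ] Param M}

/-- Nonnegativity of `w` covers an operator without eigenvalues, for which the supremum is `0` by
convention. -/
lemma lambdaMax_le {w : ℝ} (hw : 0 ≤ w) (h : ∀ v, ⟪v, T v⟫ ≤ w * ‖v‖ ^ 2) :
    lambdaMax T ≤ w := by
  refine Real.sSup_le (fun r hr => ?_) hw
  obtain ⟨v, hv⟩ := Module.End.HasEigenvalue.exists_hasEigenvector hr
  have h1 := h v
  have h2 : T v = r • v := hv.apply_eq_smul
  rw [h2, real_inner_smul_right, real_inner_self_eq_norm_sq] at h1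
  have h3 : 0 < ‖v‖ ^ 2 := by
    have := norm_pos_iff.2 hv.2
    positivity
  exact le_of_mul_le_mul_right h1 h3

/-- A symmetric operator with a large quadratic form has an eigenbasis whose top eigenvalue is
large. -/
lemma exists_eigenbasis (hT : (T : Param M →ₗ[ℝ] Param M).IsSymmetric) {w : ℝ} {v : Param M}
    (hv : w * ‖v‖ ^ 2 < ⟪v, T v⟫) :
    ∃ (e : OrthonormalBasis (Fin M) ℝ (Param M)) (lam : Fin M → ℝ) (top : Fin M),
      (∀ i, T (e i) = lam i • e i) ∧ w < lam top ∧ (∀ i, lam i ≤ lam top) ∧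
        lambdaMax T = lam top := by
  have hn : Module.finrank ℝ (Param M) = M := finrank_euclideanSpace_fin
  set e := hT.eigenvectorBasis hn
  set lam := hT.eigenvalues hn
  have he : ∀ i, T (e i) = lam i • e i := fun i => by
    exact hT.apply_eigenvectorBasis hn i
  have hsum : ⟪v, T v⟫ = ∑ i, lam i * ⟪e i, v⟫ ^ 2 := by
    rw [← e.sum_inner_mul_inner v (T v)]
    refine Finset.sum_congr rfl fun i _ => ?_
    have h1 := hT (e i) v
    simp only [ContinuousLinearMap.coe_coe] at h1
    rw [← h1, he, real_inner_smul_left, real_inner_comm]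
    ring
  have hnorm : ‖v‖ ^ 2 = ∑ i, ⟪e i, v⟫ ^ 2 := by
    have := e.sum_sq_norm_inner_right v
    simpa using this.symm
  have hex : ∃ i, w < lam i := by
    by_contra! hcon
    refine absurd hv (not_lt.2 ?_)
    rw [hsum, hnorm, Finset.mul_sum]
    gcongr with i _
    exact hcon i
  obtain ⟨i₀, hi₀⟩ := hex
  obtain ⟨top, -, htop⟩ := Finset.exists_max_image Finset.univ lam ⟨i₀, Finset.mem_univ _⟩
  refine ⟨e, lam, top, he, hi₀.trans_le (htop _ (Finset.mem_univ _)),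
    fun i => htop i (Finset.mem_univ _), ?_⟩
  refine IsGreatest.csSup_eq ⟨hT.hasEigenvalue_eigenvalues hn top, fun r hr => ?_⟩
  obtain ⟨i, hi⟩ := hT.exists_eigenvalues_eq hn hr
  have hi' : lam i = r := hi
  rw [← hi']
  exact htop i (Finset.mem_univ _)

/-- The rate that balances the drift of the gradient with the curvature. -/
lemma exists_rate {lam q : Fin M → ℝ} {r c : ℝ} (hr : 0 < r) (hc : 0 < c) (hq : ∀ i, 0 ≤ q i) :
    ∃ s, r ≤ s ∧ s ≤ max r ((∑ i, q i) / c) ∧ ∑ i, q i / (s + |lam i|) ≤ c ∧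
      (s = r ∨ ∑ i, q i / (s + |lam i|) = c) := by
  rcases le_or_gt (∑ i, q i / (r + |lam i|)) c with h | h
  · exact ⟨r, le_rfl, le_max_left _ _, h, .inl rfl⟩
  · set R := max r ((∑ i, q i) / c) with hR
    have hrR : r ≤ R := le_max_left _ _
    have hcont : ContinuousOn (fun s => ∑ i, q i / (s + |lam i|)) (Set.Icc r R) := by
      refine continuousOn_finsetSum _ fun i _ => ContinuousOn.div continuousOn_const
        (by fun_prop) fun s hs => ?_
      have := hr.trans_le hs.1
      positivity
    have hend : ∑ i, q i / (R + |lam i|) ≤ c := by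
      calc ∑ i, q i / (R + |lam i|) ≤ ∑ i, q i / R := by
            refine Finset.sum_le_sum fun i _ => div_le_div_of_nonneg_left (hq i)
              (hr.trans_le hrR) (by linarith [abs_nonneg (lam i)])
        _ = (∑ i, q i) / R := (Finset.sum_div _ _ _).symm
        _ ≤ c := by
            rw [div_le_iff₀ (hr.trans_le hrR)]
            have := le_max_right r ((∑ i, q i) / c)
            rw [div_le_iff₀ hc] at this
            linarith
    -- The sum exceeds `c` at `r` and is at most `c` at `R`, so it equals `c` in between.
    obtain ⟨s, hs, hs2⟩ := intermediate_value_Icc' hrR hcont ⟨hend, h.le⟩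
    exact ⟨s, hs.1, hs.2, hs2.le, .inr hs2⟩

end Spectral

/-! ### Episodes for a general stochastic gradient ascent. -/

/-- A stochastic gradient ascent on a function `f` with `L`-Lipschitz gradient and `ρ`-Lipschitz
Hessian: `ν x` is the law of the stochastic gradient at `x`, bounded by `σ` and of bias at most
`b`. -/
structure AscentModel (M : ℕ) where
  f : Param M → ℝ
  g : Param M → Param M
  H : Param M → Param M →L[ℝ] Param M
  ν : Param M → Measure (Param M)
  L : ℝ
  ρ : ℝ
  σ : ℝ
  b : ℝ
  fmax : ℝ
  prob : ∀ x, IsProbabilityMeasure (ν x)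
  hasFDerivAt : ∀ x, HasFDerivAt f (innerSL ℝ (g x)) x
  hasFDerivAt_grad : ∀ x, HasFDerivAt g (H x) x
  symm : ∀ x, (H x : Param M →ₗ[ℝ] Param M).IsSymmetric
  norm_le : ∀ x, ‖H x‖ ≤ L
  lipschitz : ∀ x y, ‖H x - H y‖ ≤ ρ * ‖x - y‖
  bounded : ∀ x, ∀ᵐ v ∂(ν x), ‖v‖ ≤ σ
  bias_le : ∀ x, ‖∫ v, v ∂(ν x) - g x‖ ≤ b
  le_fmax : ∀ x, f x ≤ fmax
  ρ_pos : 0 < ρ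

/-- The length of an episode, in units of the reciprocal of the step size times the rate. -/
def episodeLength (M : ℕ) (σ σl : ℝ) : ℝ := 8 / 3 * (M * σ ^ 2 / 2 + 1) / σl ^ 2 + 1

/-- The growth factor over an episode. -/
def episodeGrowth (M : ℕ) (σ σl : ℝ) : ℝ := Real.exp (62 * (episodeLength M σ σl + 1))

/-- How small the step size has to be compared with the curvature at a saddle point. -/
def saddleThreshold (M : ℕ) (σ σl L ρ β cg : ℝ) : ℝ :=
  16 * episodeGrowth M σ σl ^ 2 * ρ ^ 2 * (M * σ ^ 2 + 2 + 1 + σ ^ 2) ^ 3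
    + 2 * episodeGrowth M σ σl ^ 2 * (4 * ρ ^ 2 + β / 20) * (M * σ ^ 2 + 2 + 1 + σ ^ 2) ^ 2
    + 4 * episodeGrowth M σ σl * (episodeGrowth M σ σl * (1 + L) + 1)
      * (M * σ ^ 2 + 2 + 1 + σ ^ 2) ^ 3 * ρ ^ 4
    + ρ ^ 2 * cg * (L + cg)
    + ρ ^ 2 * (episodeLength M σ σl + 1) * episodeGrowth M σ σl * (cg + (L + cg) * σl ^ 2)
    + 10 * (L + cg) + 4 * L + 16 * (episodeLength M σ σl + 1) * episodeGrowth M σ σl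

lemma one_le_episodeLength (M : ℕ) (σ σl : ℝ) : 1 ≤ episodeLength M σ σl := by
  rw [episodeLength, le_add_iff_nonneg_left]
  positivity

lemma episodeGrowth_pos (M : ℕ) (σ σl : ℝ) : 0 < episodeGrowth M σ σl := Real.exp_pos _

lemma episodeLength_gain (M : ℕ) (σ : ℝ) {σl : ℝ} (hσl : 0 < σl) :
    M * σ ^ 2 / 2 + 1 ≤ 3 / 8 * σl ^ 2 * episodeLength M σ σl := by
  have : 3 / 8 * σl ^ 2 * (8 / 3 * (M * σ ^ 2 / 2 + 1) / σl ^ 2 + 1)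
      = M * σ ^ 2 / 2 + 1 + 3 / 8 * σl ^ 2 := by
    field_simp
  rw [episodeLength, this]
  linarith [sq_nonneg σl]

/-- Collecting the coefficients of the smallness conditions into one nonnegative sum lets four
comparisons of step size, curvature and bias imply most of them. -/
lemma le_saddleThreshold (M : ℕ) (σ ρ : ℝ) {σl L β cg : ℝ} (hσl : 0 < σl) (hL : 0 ≤ L)
    (hβ : 0 ≤ β) (hcg : 0 ≤ cg) :
    16 * episodeGrowth M σ σl ^ 2 * ρ ^ 2 * (M * σ ^ 2 + 2 + 1 + σ ^ 2) ^ 3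
        ≤ saddleThreshold M σ σl L ρ β cg ∧
      2 * episodeGrowth M σ σl ^ 2 * (4 * ρ ^ 2 + β / 20) * (M * σ ^ 2 + 2 + 1 + σ ^ 2) ^ 2
        ≤ saddleThreshold M σ σl L ρ β cg ∧
      4 * episodeGrowth M σ σl * (episodeGrowth M σ σl * (1 + L) + 1)
        * (M * σ ^ 2 + 2 + 1 + σ ^ 2) ^ 3 * ρ ^ 4 ≤ saddleThreshold M σ σl L ρ β cg ∧
      ρ ^ 2 * cg * (L + cg) ≤ saddleThreshold M σ σl L ρ β cg ∧
      ρ ^ 2 * (episodeLength M σ σl + 1) * episodeGrowth M σ σl * (cg + (L + cg) * σl ^ 2)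
        ≤ saddleThreshold M σ σl L ρ β cg ∧
      10 * (L + cg) ≤ saddleThreshold M σ σl L ρ β cg ∧
      4 * L ≤ saddleThreshold M σ σl L ρ β cg ∧
      16 * (episodeLength M σ σl + 1) * episodeGrowth M σ σl
        ≤ saddleThreshold M σ σl L ρ β cg := by
  unfold saddleThreshold
  have hE := episodeGrowth_pos M σ σl
  have hK := one_le_episodeLength M σ σl
  generalize episodeGrowth M σ σl = E at *
  generalize episodeLength M σ σl = K at *
  have hA : 0 < M * σ ^ 2 + 2 + 1 + σ ^ 2 := by positivity
  generalize M * σ ^ 2 + 2 + 1 + σ ^ 2 = A at *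
  have z1 : 0 ≤ 16 * E ^ 2 * ρ ^ 2 * A ^ 3 := by positivity
  have z2 : 0 ≤ 2 * E ^ 2 * (4 * ρ ^ 2 + β / 20) * A ^ 2 := by positivity
  have z3 : 0 ≤ 4 * E * (E * (1 + L) + 1) * A ^ 3 * ρ ^ 4 := by positivity
  have z4 : 0 ≤ ρ ^ 2 * cg * (L + cg) := by positivity
  have z5 : 0 ≤ ρ ^ 2 * (K + 1) * E * (cg + (L + cg) * σl ^ 2) := by positivity
  have z6 : 0 ≤ 10 * (L + cg) := by positivity
  have z7 : 0 ≤ 4 * L := by positivity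
  have z8 : 0 ≤ 16 * (K + 1) * E := by positivity
  generalize 16 * E ^ 2 * ρ ^ 2 * A ^ 3 = a1 at *
  generalize 2 * E ^ 2 * (4 * ρ ^ 2 + β / 20) * A ^ 2 = a2 at *
  generalize 4 * E * (E * (1 + L) + 1) * A ^ 3 * ρ ^ 4 = a3 at *
  generalize ρ ^ 2 * cg * (L + cg) = a4 at *
  generalize ρ ^ 2 * (K + 1) * E * (cg + (L + cg) * σl ^ 2) = a5 at *
  generalize 10 * (L + cg) = a6 at *
  generalize 4 * L = a7 at *
  generalize 16 * (K + 1) * E = a8 at *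
  refine ⟨?_, ?_, ?_, ?_, ?_, ?_, ?_, ?_⟩ <;> linarith

namespace AscentModel

variable {M : ℕ} (X : AscentModel M)

attribute [instance] AscentModel.prob

lemma L_nonneg : 0 ≤ X.L := (norm_nonneg _).trans (X.norm_le 0)

lemma b_nonneg : 0 ≤ X.b := (norm_nonneg _).trans (X.bias_le 0)

lemma continuous_f : Continuous X.f :=
  continuous_iff_continuousAt.2 fun x => (X.hasFDerivAt x).continuousAt

/-- A point with a large gradient is left in a single step with an expected gain. -/
lemma hasEpisode_of_large_gradient {Q : ProbabilityTheory.Kernel (Param M) (Param M)} {μ κ : ℝ}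
    (hQ : ∀ x, Q x = (X.ν x).map fun v => x + μ • v) (hμ : 0 < μ) {a : Param M}
    (h : κ + X.L * μ ^ 2 * X.σ ^ 2 + μ * ‖X.g a‖ * X.b ≤ μ * ‖X.g a‖ ^ 2) :
    HasEpisode Q X.f κ (X.fmax + 1) a := by
  have hmap : Continuous fun v : Param M => a + μ • v := by fun_prop
  have hint : Integrable X.f (Q a) := by
    rw [hQ, integrable_map_measure X.continuous_f.aestronglyMeasurable hmap.aemeasurable]
    exact integrable_of_continuous_of_ae_norm_le (X.bounded a) (X.continuous_f.comp hmap)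
  have hgain : X.f a + κ ≤ ∫ y, X.f y ∂(Q a) := by
    rw [hQ, integral_map hmap.aemeasurable X.continuous_f.aestronglyMeasurable]
    have i1 : Integrable (fun v => μ * ⟪X.g a, v⟫) (X.ν a) :=
      integrable_of_continuous_of_ae_norm_le (X.bounded a) (by fun_prop)
    have hle : ∫ v, (X.f a - X.L * μ ^ 2 * X.σ ^ 2 + μ * ⟪X.g a, v⟫) ∂(X.ν a)
        ≤ ∫ v, X.f (a + μ • v) ∂(X.ν a) := by
      refine integral_mono_ae ((integrable_const _).add i1)
        (integrable_of_continuous_of_ae_norm_le (X.bounded a) (X.continuous_f.comp hmap)) ?_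
      filter_upwards [X.bounded a] with v hv
      have h1 := (abs_le.1 (abs_sub_linear_le X.hasFDerivAt X.hasFDerivAt_grad X.norm_le a
        (a + μ • v))).1
      rw [add_sub_cancel_left, real_inner_smul_right, norm_smul, Real.norm_of_nonneg hμ.le,
        mul_pow] at h1
      have h2 : X.L * (μ ^ 2 * ‖v‖ ^ 2) ≤ X.L * (μ ^ 2 * X.σ ^ 2) := by
        have := X.L_nonneg
        gcongr
      linarith
    rw [integral_add (integrable_const _) i1, integral_const, probReal_univ, one_smul,
      integral_const_mul, integral_inner_eq (X.bounded a)] at hle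
    refine le_trans ?_ hle
    have h3 : ⟪X.g a, ∫ v, v ∂(X.ν a)⟫
        = ‖X.g a‖ ^ 2 + ⟪X.g a, ∫ v, v ∂(X.ν a) - X.g a⟫ := by
      rw [inner_sub_right, real_inner_self_eq_norm_sq]
      ring
    have h4 : -(‖X.g a‖ * X.b) ≤ ⟪X.g a, ∫ v, v ∂(X.ν a) - X.g a⟫ := by
      refine (neg_le_neg ?_).trans (neg_abs_le _)
      exact (abs_real_inner_le_norm _ _).trans (by gcongr; exact X.bias_le a)
    rw [h3]
    nlinarith [mul_le_mul_of_nonneg_left h4 hμ.le]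
  -- An episode of a single step: the value function is the constant `f a` before the step and `f`
  -- after it, and the chain is stopped anywhere else than at `a`.
  refine ⟨0, {a}, fun m => if m = 0 then X.f else fun _ => X.f a, rfl, fun m x hx => ?_, by simp,
    fun m hm x hx => ?_, by simp, fun m hm x hx => ?_, fun m hm x hx => ?_⟩
  · rw [Set.mem_singleton_iff] at hx
    subst hx
    rcases eq_or_ne m 0 with rfl | hm
    · simpa using hint
    · simp only [hm, if_false]
      rw [hQ]
      have := Measure.isProbabilityMeasure_map (μ := X.ν x) hmap.aemeasurable
      exact integrable_const _
  · rw [Set.mem_singleton_iff] at hx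
    subst hx
    obtain rfl : m = 0 := by omega
    simpa using hgain
  · obtain rfl : m = 0 := by omega
    simp
  · obtain rfl : m = 0 := by omega
    simpa using (X.le_fmax x).trans (by linarith)

/-- A strict saddle point with a small gradient is left in an episode with an expected gain,
provided that the step size is small enough. -/
lemma hasEpisode_of_saddle {Q : ProbabilityTheory.Kernel (Param M) (Param M)} {μ κ σl β cg w : ℝ}
    (hQ : ∀ x, Q x = (X.ν x).map fun v => x + μ • v) (hμ : 0 < μ) (hσl : 0 < σl) (hβ : 0 ≤ β)
    (hcg : 0 ≤ cg) (hw : 0 < w) (hκ : 0 ≤ κ) {a : Param M} (hg : ‖X.g a‖ ^ 2 ≤ cg * μ)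
    (hcurv : ∃ v, w * ‖v‖ ^ 2 < ⟪v, X.H a v⟫)
    (hnoise : ∀ (r : ℝ) (e : Param M), 0 < r → X.H a e = r • e → ‖e‖ = 1 →
      ∀ x, 3 / 4 * σl ^ 2 - β * ‖x - a‖ ^ 4 ≤ dirVar (X.ν x) e)
    (hρ : (episodeGrowth M X.σ σl * (1 + X.L) + 1) * (X.L + cg) ^ 2 ≤ X.ρ ^ 2)
    (h1 : saddleThreshold M X.σ σl X.L X.ρ β cg * μ ≤ w ^ 3)
    (h2 : saddleThreshold M X.σ σl X.L X.ρ β cg * μ ^ 2 ≤ w ^ 7)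
    (h3 : saddleThreshold M X.σ σl X.L X.ρ β cg * μ ≤ 1)
    (h4 : saddleThreshold M X.σ σl X.L X.ρ β cg * X.b ^ 2 ≤ w * μ)
    (h5 : 4 * (episodeLength M X.σ σl + 1) * κ ≤ μ ^ 2 * w) :
    HasEpisode Q X.f κ (X.fmax + 1) a := by
  obtain ⟨v, hv⟩ := hcurv
  obtain ⟨e, lam, top, he, hwtop, htop, -⟩ := exists_eigenbasis (X.symm a) hv
  have hL := X.L_nonneg
  have hρ0 := X.ρ_pos
  set K := episodeLength M X.σ σl with hK
  set E := episodeGrowth M X.σ σl with hE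
  set A := M * X.σ ^ 2 + 2 + 1 + X.σ ^ 2 with hA
  have hE0 : 0 < E := Real.exp_pos _
  have hA0 : 0 < A := by positivity
  have hK1 : 1 ≤ K := one_le_episodeLength M X.σ σl
  have habs : ∀ i, |lam i| ≤ X.L := fun i => by
    have := (X.H a).le_of_opNorm_le (X.norm_le a) (e i)
    rw [he, norm_smul, e.norm_eq_one, mul_one, mul_one] at this
    exact this
  have htop0 : 0 < lam top := hw.trans hwtop
  have hsum : ∑ i, ⟪e i, X.g a⟫ ^ 2 = ‖X.g a‖ ^ 2 := by
    have := e.sum_sq_norm_inner_right (X.g a)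
    simpa using this
  have hC0 : 0 < (M * X.σ ^ 2 + 2) * μ := by positivity
  -- The coefficient `M σ² + 2` is the smallest one allowed by `C_ge`. Starting the search at the
  -- top eigenvalue gives `λ_i ≤ s` for all `i`.
  obtain ⟨s, hs1, hs2, hs3, hs4⟩ := exists_rate (lam := lam) (q := fun i => ⟪e i, X.g a⟫ ^ 2)
    htop0 hC0 fun i => sq_nonneg _
  have hws : w < s := hwtop.trans_le hs1
  have hs0 : 0 < s := hw.trans hws
  have hsS : s ≤ X.L + cg := by
    refine hs2.trans (max_le ?_ ?_)
    · linarith [(le_abs_self _).trans (habs top)]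
    · rw [hsum, div_le_iff₀ hC0]
      have : 0 ≤ X.L * μ * (M * X.σ ^ 2 + 2) + cg * μ * (M * X.σ ^ 2 + 1) := by positivity
      linarith
  obtain ⟨z1, z2, z3, z4, z5, z6, z7, z8⟩ :=
    le_saddleThreshold M X.σ X.ρ hσl hL hβ hcg
  simp only [← hK, ← hE, ← hA] at z1 z2 z3 z5 z8
  set Z := saddleThreshold M X.σ σl X.L X.ρ β cg with hZ
  have hs3' : w ^ 3 ≤ s ^ 3 := pow_le_pow_left₀ hw.le hws.le 3
  have hs7' : w ^ 7 ≤ s ^ 7 := pow_le_pow_left₀ hw.le hws.le 7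
  have c1 : ∀ z, z ≤ Z → z * μ ≤ s ^ 3 := fun z hz =>
    (mul_le_mul_of_nonneg_right hz hμ.le).trans (h1.trans hs3')
  have c3 : ∀ z, z ≤ Z → z * μ ≤ 1 := fun z hz =>
    (mul_le_mul_of_nonneg_right hz hμ.le).trans h3
  have hrate : 10 * (μ * s) ≤ 1 := by
    linarith only [c3 _ z6, mul_le_mul_of_nonneg_left hsS hμ.le]
  have hμs : 0 < μ * s := mul_pos hμ hs0
  have hT1 : K / (μ * s) ≤ ⌈K / (μ * s)⌉₊ := Nat.le_ceil _
  have hT2 := Nat.ceil_lt_add_one (div_nonneg (by linarith : 0 ≤ K) hμs.le)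
  rw [div_le_iff₀ hμs] at hT1
  have hT2' : μ * s * (⌈K / (μ * s)⌉₊ : ℝ) ≤ K + 1 := by
    have h6 := mul_lt_mul_of_pos_left hT2 hμs
    rw [mul_add, mul_div_cancel₀ _ hμs.ne'] at h6
    linarith only [h6, hT1, hrate]
  have small_quartic : 2 * E ^ 2 * (4 * X.ρ ^ 2 + μ * β * s / 2) * A ^ 2 * μ ≤ s ^ 3 := by
    refine le_trans ?_ (c1 _ z2)
    have h6 : μ * β * s / 2 ≤ β / 20 := by
      linarith only [mul_le_mul_of_nonneg_left hrate hβ]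
    gcongr
  have small_exit : 4 * E * (E * (1 + X.L) + 1) * A ^ 3 * X.ρ ^ 4 * μ ^ 2 ≤ s ^ 7 := by
    refine le_trans ?_ (h2.trans hs7')
    exact mul_le_mul_of_nonneg_right z3 (sq_nonneg μ)
  have small_grad : X.ρ * ‖X.g a‖ ≤ s := by
    refine abs_le_of_sq_le_sq' ?_ hs0.le |>.2
    have h6 := c1 _ z4
    have h7 : X.ρ ^ 2 * cg * μ * s ≤ s ^ 2 * s := by
      refine le_trans ?_ (h6.trans_eq (by ring))
      linarith only [mul_le_mul_of_nonneg_left hsS (by positivity : 0 ≤ X.ρ ^ 2 * cg * μ)]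
    have h8 := le_of_mul_le_mul_right h7 hs0
    rw [mul_pow]
    refine le_trans ?_ h8
    linarith only [mul_le_mul_of_nonneg_left hg (sq_nonneg X.ρ)]
  have small_gain : X.ρ ^ 2 * (K + 1) * E * (‖X.g a‖ ^ 2 + μ * s * σl ^ 2) ≤ 2 * s ^ 3 := by
    have h6 := c1 _ z5
    have h7 : ‖X.g a‖ ^ 2 + μ * s * σl ^ 2 ≤ (cg + (X.L + cg) * σl ^ 2) * μ := by
      linarith only [mul_le_mul_of_nonneg_right hsS (by positivity : 0 ≤ μ * σl ^ 2), hg]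
    have h8 := mul_le_mul_of_nonneg_left h7
      (by positivity : 0 ≤ X.ρ ^ 2 * (K + 1) * E)
    have h9 : 0 < s ^ 3 := by positivity
    linarith only [h6, h8, h9]
  have small_radius : (E * (1 + X.L) + 1) * s ^ 2 ≤ X.ρ ^ 2 := by
    refine le_trans ?_ hρ
    gcongr
  have small_bias : 16 * (K + 1) * E * X.b ^ 2 ≤ s * μ := by
    have h6 : 16 * (K + 1) * E * X.b ^ 2 ≤ Z * X.b ^ 2 :=
      mul_le_mul_of_nonneg_right z8 (sq_nonneg _)
    refine h6.trans (h4.trans ?_)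
    gcongr
  have small_gap : 4 * (K + 1) * κ ≤ μ ^ 2 * s := by
    refine h5.trans ?_
    gcongr
  let W : Saddle M :=
    { ν := X.ν
      f := X.f
      a := a
      g := X.g a
      H := X.H a
      e := e
      lam := lam
      top := top
      μ := μ
      s := s
      σ := X.σ
      b := X.b
      ρ := X.ρ
      L := X.L
      C := M * X.σ ^ 2 + 2
      K := K
      σl := σl
      β := β
      κ := κ
      fmax := X.fmax
      T := ⌈K / (μ * s)⌉₊
      prob := X.prob
      bounded := X.bounded
      mean := fun x => by
        have e1 : ∫ v, v ∂(X.ν x) - (X.g a + X.H a (x - a))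
          = (X.g x - X.g a - X.H a (x - a)) + (∫ v, v ∂(X.ν x) - X.g x) := by abel
        rw [e1]
        exact (norm_add_le _ _).trans (add_le_add
          (norm_sub_linear_le X.hasFDerivAt_grad X.lipschitz hρ0.le a x) (X.bias_le x))
      taylor := abs_sub_quadratic_le X.hasFDerivAt X.hasFDerivAt_grad X.lipschitz hρ0.le X.symm a
      le_fmax := X.le_fmax
      eig := fun i d => by
        have h6 := X.symm a (e i) d
        simp only [ContinuousLinearMap.coe_coe] at h6
        rw [← h6, he, real_inner_smul_left]
      noise := hnoise (lam top) (e top) htop0 (he top) (e.norm_eq_one top)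
      μ_pos := hμ
      s_pos := hs0
      ρ_pos := hρ0
      L_nonneg := hL
      C_nonneg := by positivity
      K_ge := hK1
      β_nonneg := hβ
      κ_nonneg := hκ
      lam_le := fun i => (htop i).trans hs1
      abs_lam_le := habs
      top_pos := htop0
      rate_le := hs3
      rate_eq := hs4
      C_ge := by linarith only
      K_gain := episodeLength_gain M X.σ hσl
      T_ge := by linarith only [hT1]
      T_le := hT2'
      step_rate := hrate
      step_L := by linarith only [c3 _ z7]
      small_cubic := c1 _ z1
      small_quartic := small_quartic
      small_exit := small_exit
      small_grad := small_grad
      small_gain := small_gain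
      small_radius := small_radius
      small_bias := small_bias
      small_gap := small_gap }
  exact W.hasEpisode Q hQ

end AscentModel

/-! ### Policy gradient as an instance, and the probability bound. -/

section PolicyGradientModel

variable {M : ℕ} {S A : Type*} [MeasurableSpace S] [MeasurableSpace A]
  {E : MDP S A} {π : Policy M S A} {Rmax G B ι γ : ℝ}

/-- The law of the gradient estimator. -/
def estimatorLaw (E : MDP S A) (π : Policy M S A) (γ : ℝ) (H : ℕ) (θ : Param M) :
    Measure (Param M) :=
  (trajLaw E π H θ).map (gpomdp E π γ H θ)

lemma Regular.isProbabilityMeasure_estimatorLaw (hr : Regular E π Rmax G B ι) (H : ℕ)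
    (θ : Param M) : IsProbabilityMeasure (estimatorLaw E π γ H θ) :=
  Measure.isProbabilityMeasure_map (hr.measurable_gpomdp_right H θ).aemeasurable

lemma Regular.ae_norm_le_estimatorLaw (hr : Regular E π Rmax G B ι) (hR : 0 ≤ Rmax) (hG : 0 ≤ G)
    (h0 : 0 < γ) (h1 : γ < 1) (H : ℕ) (θ : Param M) :
    ∀ᵐ v ∂(estimatorLaw E π γ H θ), ‖v‖ ≤ sigmaConst Rmax G γ := by
  rw [estimatorLaw, ae_map_iff (hr.measurable_gpomdp_right H θ).aemeasurable
    (measurableSet_le measurable_norm measurable_const)]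
  exact .of_forall (hr.norm_gpomdp_le hR hG h0 h1 H θ)

lemma Regular.integral_estimatorLaw (hr : Regular E π Rmax G B ι) (H : ℕ) (θ : Param M) :
    ∫ v, v ∂(estimatorLaw E π γ H θ) = ∫ τ, gpomdp E π γ H θ τ ∂(trajLaw E π H θ) := by
  rw [estimatorLaw]
  exact integral_map (hr.measurable_gpomdp_right H θ).aemeasurable aestronglyMeasurable_id

/-- The directional variance of the estimator is the quadratic form of the noise covariance. -/
lemma Regular.dirVar_estimatorLaw (hr : Regular E π Rmax G B ι) (hR : 0 ≤ Rmax) (hG : 0 ≤ G)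
    (h0 : 0 < γ) (h1 : γ < 1) (H : ℕ) (θ e : Param M) :
    dirVar (estimatorLaw E π γ H θ) e = ⟪e, noiseCov E π γ H θ e⟫ := by
  have := hr.isProbabilityMeasure_estimatorLaw (γ := γ) H θ
  have hb := hr.ae_norm_le_estimatorLaw hR hG h0 h1 H θ
  have hint : Integrable (fun v : Param M => InnerProductSpace.rankOne ℝ
      (v - ∫ u, u ∂(estimatorLaw E π γ H θ)) (v - ∫ u, u ∂(estimatorLaw E π γ H θ)))
      (estimatorLaw E π γ H θ) := by
    refine integrable_of_continuous_of_ae_norm_le hb ?_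
    have hc : Continuous fun v : Param M => v - ∫ u, u ∂(estimatorLaw E π γ H θ) := by fun_prop
    exact ((ContinuousLinearMap.smulRightL ℝ (Param M) (Param M)).continuous.comp
      ((innerSL ℝ).continuous.comp hc)).clm_apply hc
  have hcov : noiseCov E π γ H θ = ∫ v, InnerProductSpace.rankOne ℝ
      (v - ∫ u, u ∂(estimatorLaw E π γ H θ)) (v - ∫ u, u ∂(estimatorLaw E π γ H θ))
      ∂(estimatorLaw E π γ H θ) := by
    rw [hr.integral_estimatorLaw, estimatorLaw,
      integral_map (hr.measurable_gpomdp_right H θ).aemeasurable]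
    · rfl
    · have := hint.aestronglyMeasurable
      rwa [hr.integral_estimatorLaw] at this
  rw [dirVar_eq_integral_sq hb, hcov, ContinuousLinearMap.integral_apply hint,
    ← integral_inner (hint.apply_continuousLinearMap e)]
  refine integral_congr_ae (.of_forall fun v => ?_)
  simp [InnerProductSpace.rankOne_apply, inner_sub_right, real_inner_smul_right,
    real_inner_comm]
  ring

/-- Policy gradient as a stochastic gradient ascent. -/
def Regular.ascentModel (hr : Regular E π Rmax G B ι) (hR : 0 ≤ Rmax) (hG : 0 ≤ G) (hB : 0 ≤ B)
    (h0 : 0 < γ) (h1 : γ < 1) (H : ℕ) {ρ b : ℝ} (hρ : hessLipConst Rmax G B ι γ ≤ ρ)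
    (hρ0 : 0 < ρ) (hb : sigmaConst Rmax G γ * ((H + 1) * γ ^ H) ≤ b) : AscentModel M where
  f := objective E π γ
  g := gradSeries E π γ
  H := hessSeries E π γ
  ν := estimatorLaw E π γ H
  L := smoothConst Rmax G B γ
  ρ := ρ
  σ := sigmaConst Rmax G γ
  b := b
  fmax := Rmax / (1 - γ)
  prob := hr.isProbabilityMeasure_estimatorLaw H
  hasFDerivAt := hr.hasFDerivAt_objective hG h0 h1
  hasFDerivAt_grad := hr.hasFDerivAt_gradient hG h0 h1
  symm := hr.isSymmetric_hessSeries hG h0 h1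
  norm_le := hr.norm_hessSeries_le h0 h1
  lipschitz := fun x y => (hr.norm_hessSeries_sub_le hR hG hB h0 h1 x y).trans
    (mul_le_mul_of_nonneg_right hρ (norm_nonneg _))
  bounded := hr.ae_norm_le_estimatorLaw hR hG h0 h1 H
  bias_le := fun x => by
    rw [hr.integral_estimatorLaw]
    exact (hr.norm_integral_gpomdp_sub_le hR hG h0 h1 H x).trans hb
  le_fmax := fun x => (le_abs_self _).trans (hr.abs_objective_le h0 h1 x)
  ρ_pos := hρ0

lemma Regular.updateKernel_eq_map (hr : Regular E π Rmax G B ι) (hG : 0 ≤ G) (H : ℕ) (μ : ℝ)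
    (θ : Param M) : hr.updateKernel hG γ H μ θ
      = (estimatorLaw E π γ H θ).map fun v => θ + μ • v := by
  rw [hr.updateKernel_apply, estimatorLaw, Measure.map_map (by fun_prop)
    (hr.measurable_gpomdp_right H θ)]
  rfl

/-- A Hölder bound is a quartic bound up to a constant. -/
lemma exists_quartic_bound {β ν η : ℝ} (hβ : 0 < β) (hν : 0 < ν) (hν4 : ν ≤ 4) (hη : 0 < η) :
    ∃ β₁, 0 ≤ β₁ ∧ ∀ t, 0 ≤ t → β * t ^ ν ≤ η + β₁ * t ^ 4 := by
  set r := min 1 ((η / β) ^ (1 / ν)) with hr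
  have hr0 : 0 < r := lt_min one_pos (Real.rpow_pos_of_pos (div_pos hη hβ) _)
  refine ⟨β / r ^ 4, by positivity, fun t ht => ?_⟩
  rcases le_or_gt t r with h | h
  · have h1 : t ^ ν ≤ η / β := by
      calc t ^ ν ≤ ((η / β) ^ (1 / ν)) ^ ν :=
            Real.rpow_le_rpow ht (h.trans (min_le_right _ _)) hν.le
        _ = η / β := by
            rw [← Real.rpow_mul (div_pos hη hβ).le, one_div_mul_cancel hν.ne', Real.rpow_one]
    rw [le_div_iff₀ hβ] at h1
    have : 0 ≤ β / r ^ 4 * t ^ 4 := by positivity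
    linarith
  · have h1 : 1 ≤ t / r := (one_le_div hr0).2 h.le
    have h2 : t ^ ν ≤ (t / r) ^ 4 := by
      calc t ^ ν ≤ (t / r) ^ ν := Real.rpow_le_rpow ht
            (le_div_self ht hr0 (min_le_left _ _)) hν.le
        _ ≤ (t / r) ^ (4 : ℝ) := Real.rpow_le_rpow_of_exponent_le h1 hν4
        _ = (t / r) ^ 4 := by norm_cast
    have h3 := mul_le_mul_of_nonneg_left h2 hβ.le
    have e : β / r ^ 4 * t ^ 4 = β * (t / r) ^ 4 := by
      rw [div_pow]
      ring
    linarith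

/-- The points that are not second-order stationary. -/
def nonStationary (E : MDP S A) (π : Policy M S A) (γ ε w : ℝ) : Set (Param M) :=
  {θ | ε < ‖gradSeries E π γ θ‖ ∨ ∃ v, w * ‖v‖ ^ 2 < ⟪v, hessSeries E π γ θ v⟫}

/-- Expressed through the quadratic form, the curvature condition is a union of open conditions over
`v`. This gives the measurability that the chain argument needs, with no regularity of `lambdaMax`.
-/
lemma Regular.isOpen_nonStationary (hr : Regular E π Rmax G B ι) (hR : 0 ≤ Rmax) (hG : 0 ≤ G)
    (hB : 0 ≤ B) (h0 : 0 < γ) (h1 : γ < 1) (ε w : ℝ) : IsOpen (nonStationary E π γ ε w) := by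
  have hg : Continuous (gradSeries E π γ) :=
    continuous_iff_continuousAt.2 fun x => (hr.hasFDerivAt_gradient hG h0 h1 x).continuousAt
  have hH : Continuous (hessSeries E π γ) :=
    (LipschitzWith.of_dist_le' fun x y => by
      rw [dist_eq_norm, dist_eq_norm]
      exact hr.norm_hessSeries_sub_le hR hG hB h0 h1 x y).continuous
  have e : nonStationary E π γ ε w = {θ | ε < ‖gradSeries E π γ θ‖}
      ∪ ⋃ v, {θ | w * ‖v‖ ^ 2 < ⟪v, hessSeries E π γ θ v⟫} := by
    ext θ
    simp [nonStationary]
  rw [e]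
  refine (isOpen_lt continuous_const hg.norm).union ?_
  exact isOpen_iUnion fun v => isOpen_lt continuous_const (by fun_prop)

lemma Regular.isSecondOrderStationary (hr : Regular E π Rmax G B ι) (hR : 0 ≤ Rmax) (hG : 0 ≤ G)
    (hB : 0 ≤ B) (h0 : 0 < γ) (h1 : γ < 1) {χ ε : ℝ} {θ : Param M}
    (hθ : θ ∉ nonStationary E π γ ε √(χ * ε)) :
    IsSecondOrderStationary (objective E π γ) χ ε θ := by
  simp only [nonStationary, Set.mem_ofPred_eq, not_or, not_lt, not_exists] at hθ
  refine ⟨hr.contDiff_objective hR hG hB h0 h1, ?_, ?_⟩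
  · rw [hr.gradient_objective hG h0 h1]
    exact hθ.1
  · rw [hr.hessian_objective hG h0 h1]
    exact lambdaMax_le (Real.sqrt_nonneg _) hθ.2

/-- If every nonstationary point starts an episode with an expected gain, then policy gradient
meets a stationary point with high probability. -/
lemma Regular.one_sub_le_measureReal (hr : Regular E π Rmax G B ι) (hR : 0 ≤ Rmax) (hG : 0 ≤ G)
    (hB : 0 ≤ B) (h0 : 0 < γ) (h1 : γ < 1) {H n : ℕ} {μ χ ε κ δ : ℝ} {θ₀ : Param M} {Ω : Type*}
    [MeasurableSpace Ω] (P : Measure Ω) [IsProbabilityMeasure P] {θ : ℕ → Ω → Param M}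
    {τ : ℕ → Ω → Fin H → S × A} (hrun : IsRun E π γ H μ θ₀ P θ τ) (hκ : 0 < κ) (hn : 0 < n)
    (hep : ∀ a ∈ nonStationary E π γ ε √(χ * ε),
      HasEpisode (hr.updateKernel hG γ H μ) (objective E π γ) κ (Rmax / (1 - γ) + 1) a)
    (hlen : 2 * (Rmax / (1 - γ)) + 1 ≤ κ * δ * n) :
    1 - δ ≤ P.real {ω | ∃ t < n,
      IsSecondOrderStationary (objective E π γ) χ ε (θ t ω)} := by
  set N := nonStationary E π γ ε √(χ * ε) with hNdef
  have hN : MeasurableSet N := (hr.isOpen_nonStationary hR hG hB h0 h1 _ _).measurableSet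
  set stay : Set Ω := {ω | ∀ t < n, θ t ω ∈ N} with hstay
  have hstaym : MeasurableSet stay := by
    have : stay = ⋂ t, ⋂ (_ : t < n), θ t ⁻¹' N := by
      ext ω
      simp [hstay]
    rw [this]
    exact MeasurableSet.iInter fun t => MeasurableSet.iInter fun _ =>
      hrun.measurable_param t hN
  have hfle : ∀ x, |objective E π γ x| ≤ Rmax / (1 - γ) := hr.abs_objective_le h0 h1
  have i1 := hr.mul_measureReal_stay_le hG P hrun hN n
  have i2 := expectedStay_le_of_hasEpisode (hr.updateKernel hG γ H μ) hN
    (fun x => ((le_abs_self _).trans (hfle x)).trans (by linarith)) hep n θ₀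
  have i3 := (abs_le.1 (hfle θ₀)).1
  -- Markov's inequality: `κ n P(stay) ≤ κ * expectedStay`, which is at most the range of `J` plus
  -- `1`, hence at most `κ n δ`.
  have i4 : κ * n * P.real stay ≤ κ * n * δ := by
    have := mul_le_mul_of_nonneg_left i1 hκ.le
    linarith
  have i5 : P.real stay ≤ δ := le_of_mul_le_mul_left i4 (by positivity)
  have i6 : 1 - δ ≤ P.real stayᶜ := by
    rw [probReal_compl_eq_one_sub hstaym]
    linarith
  refine i6.trans (measureReal_mono fun ω hω => ?_)
  simp only [hstay, Set.mem_compl_iff, Set.mem_ofPred_eq, not_forall] at hω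
  obtain ⟨t, ht, hω⟩ := hω
  exact ⟨t, ht, hr.isSecondOrderStationary hR hG hB h0 h1 hω⟩

end PolicyGradientModel

/-! ### The case distinction at a non-stationary point. -/

section Escape

variable {M : ℕ} {S A : Type*} [MeasurableSpace S] [MeasurableSpace A]
  {E : MDP S A} {π : Policy M S A} {Rmax G B ι γ : ℝ}

lemma smoothConst_pos (hR : 0 < Rmax) (hG : 0 < G) (hB : 0 < B) (h0 : 0 < γ) (h1 : γ < 1) :
    0 < smoothConst Rmax G B γ := by
  have : 0 < 1 - γ := by linarith
  unfold smoothConst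
  positivity

lemma sigmaConst_pos (hR : 0 < Rmax) (hG : 0 < G) (h1 : γ < 1) : 0 < sigmaConst Rmax G γ := by
  have : 0 < 1 - γ := by linarith
  unfold sigmaConst
  positivity

lemma biasConst_pos (hR : 0 < Rmax) (hG : 0 < G) (h1 : γ < 1) : 0 < biasConst Rmax G γ := by
  have : 0 < 1 - γ := by linarith
  unfold biasConst
  positivity

/-- The squared gradient at a strict saddle point, in units of the step size. -/
def saddleGradConst (Rmax G B γ δ : ℝ) : ℝ :=
  smoothConst Rmax G B γ * sigmaConst Rmax G γ ^ 2 * (1 + 1 / δ)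

/-- Every nonstationary point starts an episode with an expected gain. -/
lemma Regular.hasEpisode (hr : Regular E π Rmax G B ι) (hR : 0 < Rmax) (hG : 0 < G)
    (hB : 0 < B) (h0 : 0 < γ) (h1 : γ < 1) {H : ℕ} {μ χ ε κ δ σl β ν β₁ ρ b : ℝ}
    (hμ : 0 < μ) (hδ : 0 < δ) (hδ1 : δ < 1) (hσl : 0 < σl) (hε : 0 < ε) (hχ : 0 < χ)
    (hκ : 0 ≤ κ) (hρ : hessLipConst Rmax G B ι γ ≤ ρ) (hρ0 : 0 < ρ)
    (hb : sigmaConst Rmax G γ * ((H + 1) * γ ^ H) ≤ b)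
    (hβ₁ : 0 ≤ β₁) (hβ : ∀ t, 0 ≤ t → β * t ^ ν ≤ σl ^ 2 / 4 + β₁ * t ^ 4)
    (hcov : CovLipschitz E π γ H β ν)
    (hcurv : CorrelatedCurvature E π γ H μ (ellConst Rmax G B γ μ) δ √(χ * ε) σl)
    (hstep : μ * (smoothConst Rmax G B γ * sigmaConst Rmax G γ ^ 2) ≤ ε ^ 2 * δ)
    (hell : biasConst Rmax G γ ^ 2 * μ ≤ smoothConst Rmax G B γ * sigmaConst Rmax G γ ^ 2 / 4)
    (hb1 : b ≤ (1 - δ) / 2 * ε)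
    (hb2 : ε * b ≤ μ * (smoothConst Rmax G B γ * sigmaConst Rmax G γ ^ 2) / 4)
    (hκ1 : κ ≤ μ * ε ^ 2 * (1 - δ) / 2)
    (hκ2 : κ ≤ μ ^ 2 * (smoothConst Rmax G B γ * sigmaConst Rmax G γ ^ 2) / 4)
    (hκ3 : 4 * (episodeLength M (sigmaConst Rmax G γ) σl + 1) * κ ≤ μ ^ 2 * √(χ * ε))
    (hρ2 : (episodeGrowth M (sigmaConst Rmax G γ) σl * (1 + smoothConst Rmax G B γ) + 1)
      * (smoothConst Rmax G B γ + saddleGradConst Rmax G B γ δ) ^ 2 ≤ ρ ^ 2)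
    (t1 : saddleThreshold M (sigmaConst Rmax G γ) σl (smoothConst Rmax G B γ) ρ β₁
      (saddleGradConst Rmax G B γ δ) * μ ≤ √(χ * ε) ^ 3)
    (t2 : saddleThreshold M (sigmaConst Rmax G γ) σl (smoothConst Rmax G B γ) ρ β₁
      (saddleGradConst Rmax G B γ δ) * μ ^ 2 ≤ √(χ * ε) ^ 7)
    (t3 : saddleThreshold M (sigmaConst Rmax G γ) σl (smoothConst Rmax G B γ) ρ β₁
      (saddleGradConst Rmax G B γ δ) * μ ≤ 1)
    (t4 : saddleThreshold M (sigmaConst Rmax G γ) σl (smoothConst Rmax G B γ) ρ β₁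
      (saddleGradConst Rmax G B γ δ) * b ^ 2 ≤ √(χ * ε) * μ)
    {a : Param M} (ha : a ∈ nonStationary E π γ ε √(χ * ε)) :
    HasEpisode (hr.updateKernel hG.le γ H μ) (objective E π γ) κ (Rmax / (1 - γ) + 1) a := by
  set X := hr.ascentModel hR.le hG.le hB.le h0 h1 H hρ hρ0 hb
  have hQ : ∀ x, hr.updateKernel hG.le γ H μ x = (X.ν x).map fun v => x + μ • v :=
    hr.updateKernel_eq_map hG.le H μ
  have hL := smoothConst_pos hR hG hB h0 h1
  have hσ := sigmaConst_pos hR hG h1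
  have hLσ : 0 < smoothConst Rmax G B γ * sigmaConst Rmax G γ ^ 2 := by positivity
  have hw : 0 < √(χ * ε) := Real.sqrt_pos.2 (mul_pos hχ hε)
  rcases lt_or_ge ε ‖gradSeries E π γ a‖ with hlarge | hsmall
  · refine X.hasEpisode_of_large_gradient hQ hμ ?_
    change κ + smoothConst Rmax G B γ * μ ^ 2 * sigmaConst Rmax G γ ^ 2
      + μ * ‖gradSeries E π γ a‖ * b ≤ μ * ‖gradSeries E π γ a‖ ^ 2
    -- Out of `‖g‖²`, the bias takes a share `(1 - δ) / 2`, the second-order loss at most `δ ε²`,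
    -- and `κ / μ` at most `(1 - δ) / 2 * ε²`.
    have e1 : b ≤ (1 - δ) / 2 * ‖gradSeries E π γ a‖ :=
      hb1.trans (mul_le_mul_of_nonneg_left hlarge.le (by linarith))
    have e2 := mul_le_mul_of_nonneg_left e1
      (by positivity : 0 ≤ μ * ‖gradSeries E π γ a‖)
    have e3 := mul_le_mul_of_nonneg_left hstep hμ.le
    have e4 : ε ^ 2 ≤ ‖gradSeries E π γ a‖ ^ 2 := pow_le_pow_left₀ hε.le hlarge.le 2
    have e5 := mul_le_mul_of_nonneg_left e4
      (mul_nonneg hμ.le (by linarith : 0 ≤ (1 + δ) / 2))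
    linarith
  obtain ⟨v, hv⟩ := ha.resolve_left (not_lt.2 hsmall)
  rcases le_or_gt (μ * ellConst Rmax G B γ μ * (1 + 1 / δ)) (‖gradSeries E π γ a‖ ^ 2)
    with hlarge | hsaddle
  · refine X.hasEpisode_of_large_gradient hQ hμ ?_
    change κ + smoothConst Rmax G B γ * μ ^ 2 * sigmaConst Rmax G γ ^ 2
      + μ * ‖gradSeries E π γ a‖ * b ≤ μ * ‖gradSeries E π γ a‖ ^ 2
    have hb0 : 0 ≤ b := X.b_nonneg
    -- Here `‖g‖² ≥ 3/2 * μ L σ²`, because `ℓ ≥ 3/4 * L σ²` and `1 + 1/δ ≥ 2`. The second-order loss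
    -- uses `1` of these `3/2`, the bias and `κ` use `1/4` each.
    have e1 := mul_le_mul_of_nonneg_left
      ((mul_le_mul_of_nonneg_right hsmall hb0).trans hb2) hμ.le
    have e2 : 3 / 4 * (smoothConst Rmax G B γ * sigmaConst Rmax G γ ^ 2)
        ≤ ellConst Rmax G B γ μ := by
      unfold ellConst
      linarith
    have e3 : 2 ≤ 1 + 1 / δ := by linarith [(one_le_div hδ).2 hδ1.le]
    have e4 := mul_le_mul e2 e3 (by norm_num) ((by positivity : (0 : ℝ) ≤ _).trans e2)
    have e5 := mul_le_mul_of_nonneg_left e4 (sq_nonneg μ)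
    have e6 := mul_le_mul_of_nonneg_left hlarge hμ.le
    linarith
  · have hcg : 0 ≤ saddleGradConst Rmax G B γ δ := by
      unfold saddleGradConst
      positivity
    have hgrad : ‖gradSeries E π γ a‖ ^ 2 ≤ saddleGradConst Rmax G B γ δ * μ := by
      refine hsaddle.le.trans ?_
      have e1 : ellConst Rmax G B γ μ
          ≤ smoothConst Rmax G B γ * sigmaConst Rmax G γ ^ 2 := by
        unfold ellConst
        linarith [mul_nonneg (sq_nonneg (biasConst Rmax G γ)) hμ.le]
      have e2 := mul_le_mul_of_nonneg_left e1
        (by positivity : 0 ≤ μ * (1 + 1 / δ))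
      unfold saddleGradConst
      linarith
    have hmem : a ∈ strictSaddle (objective E π γ) μ (ellConst Rmax G B γ μ) δ √(χ * ε) := by
      obtain ⟨e, lam, top, -, htop, -, hmax⟩ :=
        exists_eigenbasis (hr.isSymmetric_hessSeries hG.le h0 h1 a) hv
      refine ⟨?_, ?_⟩
      · simpa [largeGradient, hr.gradient_objective hG.le h0 h1] using hsaddle
      · rw [hr.hessian_objective hG.le h0 h1, hmax]
        exact htop.le
    refine X.hasEpisode_of_saddle hQ hμ hσl hβ₁ hcg hw hκ hgrad ⟨v, hv⟩
      (fun r e hr0 hre he x => ?_) hρ2 t1 t2 t3 t4 hκ3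
    have hre' : hessSeries E π γ a e = r • e := hre
    have c1 := hcurv a hmem e (Submodule.mem_iSup_of_mem r (Submodule.mem_iSup_of_mem hr0 (by
      rw [Module.End.mem_eigenspace_iff, hr.hessian_objective hG.le h0 h1]
      exact hre')))
    rw [he] at c1
    -- The noise level at the saddle is carried over to `x` by the Hölder condition; the quartic
    -- bound spends a quarter of `σl²` and leaves the `3/4` required by the episode.
    have c2 : |⟪e, (noiseCov E π γ H x - noiseCov E π γ H a) e⟫| ≤ β * ‖x - a‖ ^ ν := by
      refine (abs_real_inner_le_norm _ _).trans ?_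
      rw [he, one_mul]
      refine ((noiseCov E π γ H x - noiseCov E π γ H a).le_opNorm e).trans ?_
      rw [he, mul_one]
      exact hcov x a
    have c3 := (abs_le.1 (c2.trans (hβ _ (norm_nonneg _)))).1
    rw [sub_apply, inner_sub_right] at c3
    change _ ≤ dirVar (estimatorLaw E π γ H x) e
    rw [hr.dirVar_estimatorLaw hR.le hG.le h0 h1]
    linarith

end Escape

/-! ### The horizon. -/

section Horizon

/-- A horizon that is logarithmic in the accuracy makes the bias small. -/
lemma succ_mul_pow_le {γ ε : ℝ} (h0 : 0 < γ) (h1 : γ < 1) (hε : 0 < ε) {H : ℕ}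
    (hH : 4 / Real.log (1 / γ) * Real.log (1 / ε ^ 2) ≤ H) :
    (H + 1) * γ ^ H ≤ 1 / (1 - √γ) ^ 2 * ε ^ 4 := by
  have hr0 : 0 < √γ := Real.sqrt_pos.2 h0
  have hr1 : √γ < 1 := by
    rw [Real.sqrt_lt' one_pos]
    simpa using h1
  have hlog : 0 < Real.log (1 / γ) := Real.log_pos ((one_lt_div h0).2 h1)
  -- The power is split as `γ ^ H = √γ ^ H * √γ ^ H`: one factor beats `H + 1`, being a term of a
  -- convergent series, and the other is at most `ε ^ 4`.
  have e1 : (H + 1) * √γ ^ H ≤ 1 / (1 - √γ) ^ 2 := by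
    have hs := summable_succ_pow_mul_geometric hr0 hr1 1
    simp only [pow_one] at hs
    rw [← tsum_succ_mul_geometric hr0 hr1]
    exact hs.le_tsum H fun j _ => by positivity
  have e2 : √γ ^ H ≤ ε ^ 4 := by
    rw [← Real.log_le_log_iff (by positivity) (by positivity), Real.log_pow, Real.log_pow,
      Real.log_sqrt h0.le]
    rw [Real.log_div one_ne_zero h0.ne', Real.log_one, zero_sub] at hH hlog
    rw [Real.log_div one_ne_zero (by positivity), Real.log_one, zero_sub, Real.log_pow,
      div_mul_eq_mul_div, div_le_iff₀ hlog] at hH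
    push_cast at hH ⊢
    linarith
  calc (H + 1) * γ ^ H = (H + 1) * √γ ^ H * √γ ^ H := by
        rw [mul_assoc, ← mul_pow, Real.mul_self_sqrt h0.le]
    _ ≤ 1 / (1 - √γ) ^ 2 * ε ^ 4 := by gcongr

end Horizon

/-! ### How small the accuracy has to be. -/

section Accuracy

lemma eventually_mul_le (x : ℝ) {z : ℝ} (hz : 0 < z) :
    ∀ᶠ y in nhdsWithin (0 : ℝ) (Set.Ioi 0), x * y ≤ z := by
  have h : Filter.Tendsto (fun y : ℝ => x * y) (nhdsWithin 0 (Set.Ioi 0)) (nhds (x * 0)) :=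
    ((continuous_const.mul continuous_id).tendsto 0).mono_left nhdsWithin_le_nhds
  rw [mul_zero] at h
  exact (h.eventually (gt_mem_nhds hz)).mono fun y hy => le_of_lt hy

/-- For step sizes of the order `ε ^ 2`, all smallness conditions hold for small accuracies `ε`. -/
lemma exists_accuracy {χ u U Cb cκ L D Z δ : ℝ} (hχ : 0 < χ) (hu : 0 < u) (hCb : 0 ≤ Cb)
    (hcκ : 0 ≤ cκ) (hL : 0 < L) (hD : 0 ≤ D) (hZ : 0 ≤ Z) (hδ1 : δ < 1) :
    ∃ ε₀ > 0, ∀ ε, 0 < ε → ε < ε₀ → ∀ μ, u * ε ^ 2 ≤ μ → μ ≤ U * ε ^ 2 →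
      ε ≤ 1 ∧ D * μ ≤ L / 4 ∧ Cb * ε ^ 4 ≤ (1 - δ) / 2 * ε ∧ ε * (Cb * ε ^ 4) ≤ μ * L / 4 ∧
      cκ * √ε ^ 9 ≤ μ * ε ^ 2 * (1 - δ) / 2 ∧ cκ * √ε ^ 9 ≤ μ ^ 2 * L / 4 ∧
      Z * μ ≤ √(χ * ε) ^ 3 ∧ Z * μ ^ 2 ≤ √(χ * ε) ^ 7 ∧ Z * μ ≤ 1 ∧
      Z * (Cb * ε ^ 4) ^ 2 ≤ √(χ * ε) * μ := by
  have hq : 0 < √χ := Real.sqrt_pos.2 hχ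
  have hδ : 0 < (1 - δ) / 2 := by linarith
  have hev := (eventually_mul_le 1 one_pos).and <| (eventually_mul_le (D * U)
    (by positivity : 0 < L / 4)).and <| (eventually_mul_le Cb hδ).and <|
    (eventually_mul_le Cb (by positivity : 0 < u * L / 4)).and <|
    (eventually_mul_le cκ (mul_pos hu hδ)).and <|
    (eventually_mul_le cκ (by positivity : 0 < u ^ 2 * L / 4)).and <|
    (eventually_mul_le (Z * U) (by positivity : 0 < √χ ^ 3)).and <|
    (eventually_mul_le (Z * U ^ 2) (by positivity : 0 < √χ ^ 7)).and <|
    (eventually_mul_le (Z * U) one_pos).and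
    (eventually_mul_le (Z * Cb ^ 2) (by positivity : 0 < √χ * u))
  rw [Filter.eventually_iff, mem_nhdsGT_iff_exists_Ioo_subset] at hev
  obtain ⟨y₀, hy₀, hsub⟩ := hev
  have hy₀' : 0 < y₀ := hy₀
  refine ⟨y₀ ^ 2, by positivity, fun ε hε hlt μ hμ1 hμ2 => ?_⟩
  -- In terms of `y = √ε` all powers are integral: `μ` is of order `y ^ 4` and the curvature
  -- threshold of order `y`. Each condition then compares powers of `y` with at least one exponent
  -- to spare.
  obtain ⟨y, hy, rfl⟩ : ∃ y, 0 < y ∧ ε = y ^ 2 :=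
    ⟨√ε, Real.sqrt_pos.2 hε, (Real.sq_sqrt hε.le).symm⟩
  have hyy : y < y₀ := lt_of_pow_lt_pow_left₀ 2 hy₀'.le hlt
  obtain ⟨c1, c2, c3, c4, c5, c6, c7, c8, c9, c10⟩ := hsub ⟨hy, hyy⟩
  rw [one_mul] at c1
  have hsq : √(χ * y ^ 2) = √χ * y := by
    rw [Real.sqrt_mul hχ.le, Real.sqrt_sq hy.le]
  rw [hsq, Real.sqrt_sq hy.le]
  have hμ0 : 0 ≤ μ := le_trans (by positivity) hμ1
  have hU : 0 ≤ U := by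
    by_contra! h
    nlinarith [pow_pos hy 4]
  have p3 : y ^ 3 ≤ 1 := pow_le_one₀ hy.le c1
  have p5 : y ^ 5 ≤ 1 := pow_le_one₀ hy.le c1
  have hμ1' : u * y ^ 4 ≤ μ := by
    rw [← pow_mul] at hμ1
    exact hμ1
  have hμ2' : μ ≤ U * y ^ 4 := by
    rw [← pow_mul] at hμ2
    exact hμ2
  have hμsq : u ^ 2 * y ^ 8 ≤ μ ^ 2 := by
    have := pow_le_pow_left₀ (by positivity) hμ1' 2
    linarith
  have hμsq2 : μ ^ 2 ≤ U ^ 2 * y ^ 8 := by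
    have := pow_le_pow_left₀ hμ0 hμ2' 2
    linarith
  have hyk : ∀ k, 0 ≤ y ^ k := fun k => by positivity
  have scale : ∀ {x z : ℝ}, 0 ≤ x → x * y ≤ z → ∀ j k : ℕ, x * y ^ (j + k + 1) ≤ z * y ^ k := by
    intro x z hx h j k
    have h1 : y ^ (j + k + 1) ≤ y * y ^ k := by
      rw [pow_succ, pow_add, mul_comm]
      have := mul_le_of_le_one_left (hyk k) (pow_le_one₀ (n := j) hy.le c1)
      exact mul_le_mul_of_nonneg_left this hy.le
    calc x * y ^ (j + k + 1) ≤ x * (y * y ^ k) := mul_le_mul_of_nonneg_left h1 hx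
      _ = x * y * y ^ k := by ring
      _ ≤ z * y ^ k := mul_le_mul_of_nonneg_right h (hyk k)
  have d1 := scale (by positivity) c2 3 0
  have d2 := scale hCb c3 5 2
  have d3 := scale hCb c4 5 4
  have d4 := scale hcκ c5 0 8
  have d5 := scale hcκ c6 0 8
  have d6 := scale (by positivity) c7 0 3
  have d7 := scale (by positivity) c8 0 7
  have d8 := scale (by positivity) c9 3 0
  have d9 := scale (by positivity) c10 10 5
  norm_num at d1 d2 d3 d4 d5 d6 d7 d8 d9
  refine ⟨pow_le_one₀ hy.le c1, ?_, ?_, ?_, ?_, ?_, ?_, ?_, ?_, ?_⟩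
  · linarith [mul_le_mul_of_nonneg_left hμ2' hD]
  · calc Cb * (y ^ 2) ^ 4 = Cb * y ^ 8 := by ring
      _ ≤ _ := d2
  · calc y ^ 2 * (Cb * (y ^ 2) ^ 4) = Cb * y ^ 10 := by ring
      _ ≤ u * L / 4 * y ^ 4 := d3
      _ ≤ μ * L / 4 := by linarith [mul_le_mul_of_nonneg_right hμ1' hL.le]
  · refine d4.trans ?_
    have := mul_le_mul_of_nonneg_right hμ1' (mul_nonneg (hyk 4) hδ.le)
    linarith
  · refine d5.trans ?_
    linarith [mul_le_mul_of_nonneg_right hμsq hL.le]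
  · linarith [mul_le_mul_of_nonneg_left hμ2' hZ]
  · linarith [mul_le_mul_of_nonneg_left hμsq2 hZ]
  · linarith [mul_le_mul_of_nonneg_left hμ2' hZ]
  · calc Z * (Cb * (y ^ 2) ^ 4) ^ 2 = Z * Cb ^ 2 * y ^ 16 := by ring
      _ ≤ √χ * u * y ^ 5 := d9
      _ ≤ √χ * y * μ := by
        linarith [mul_le_mul_of_nonneg_left hμ1' (mul_nonneg hq.le hy.le)]

end Accuracy

end PolicyGradient

end

/-! ### Choice of constants and conclusion. -/

open PolicyGradient

theorem theorem2 (γ : ℝ) (hγ₀ : 0 < γ) (hγ₁ : γ < 1) :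
    -- the constant in `H = O(log ε⁻²)` depends on `γ` only
    ∃ CH : ℝ, 0 < CH ∧
    ∀ (M : ℕ) (Rmax G B σl χ δ c : ℝ), 0 < Rmax → 0 < G → 0 < B → 0 < σl → 0 < χ →
      0 < δ → δ < 1 → 0 < c → c < 1 →
    -- the constants in `Õ(ε^(-6.5))`
    ∃ (C : ℝ) (k : ℕ), 0 < C ∧
    ∀ ι β ν : ℝ, 0 < β → 0 < ν → ν ≤ 4 →
    ∃ ε₀ : ℝ, 0 < ε₀ ∧ ∀ ε : ℝ, 0 < ε → ε < ε₀ →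
    ∀ (S A : Type*) [MeasurableSpace S] [MeasurableSpace A]
      (E : PolicyGradient.MDP S A) (π : PolicyGradient.Policy M S A) (μ : ℝ) (H : ℕ),
      PolicyGradient.Regular E π Rmax G B ι →
      c * PolicyGradient.stepBound Rmax G B γ δ ε ≤ μ →
      μ < PolicyGradient.stepBound Rmax G B γ δ ε →
      CH * Real.log (1 / ε ^ 2) ≤ H →
      PolicyGradient.CovLipschitz E π γ H β ν →
      PolicyGradient.CorrelatedCurvature E π γ H μ (PolicyGradient.ellConst Rmax G B γ μ) δ
        (√(χ * ε)) σl →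
    ∀ (θ₀ : PolicyGradient.Param M) (Ω : Type*) [MeasurableSpace Ω] (P : Measure Ω)
      [IsProbabilityMeasure P] (θ : ℕ → Ω → PolicyGradient.Param M)
      (τ : ℕ → Ω → Fin H → S × A),
      PolicyGradient.IsRun E π γ H μ θ₀ P θ τ →
      1 - δ ≤ P.real {ω | ∃ t : ℕ,
        (t : ℝ) ≤ C * ε ^ (-(13 / 2) : ℝ) * Real.log (1 / ε) ^ k ∧
        PolicyGradient.IsSecondOrderStationary (PolicyGradient.objective E π γ) χ ε (θ t ω)} := by
  have hlogγ : 0 < Real.log (1 / γ) := Real.log_pos ((one_lt_div hγ₀).2 hγ₁)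
  refine ⟨4 / Real.log (1 / γ), by positivity, ?_⟩
  intro M Rmax G B σl χ δ c hR hG hB hσl hχ hδ hδ1 hc hc1
  have h1γ : 0 < 1 - γ := by linarith
  have hL := smoothConst_pos hR hG hB hγ₀ hγ₁
  have hσ := sigmaConst_pos hR hG hγ₁
  have hD := biasConst_pos hR hG hγ₁
  set L := smoothConst Rmax G B γ with hLdef
  set σ := sigmaConst Rmax G γ with hσdef
  set D := biasConst Rmax G γ with hDdef
  set K := episodeLength M σ σl with hKdef
  have hK : 1 ≤ K := one_le_episodeLength M σ σl
  have hq : 0 < √χ := Real.sqrt_pos.2 hχ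
  set U : ℝ := δ / (L * σ ^ 2 + D ^ 2) with hUdef
  have hU : 0 < U := by positivity
  have hbound : ∀ ε, stepBound Rmax G B γ δ ε = U * ε ^ 2 := fun ε => by
    rw [stepBound, hUdef]
    ring
  -- The gain per step is `cκ * √ε ^ 9`; this constant makes `hgap` an equality for the smallest
  -- admissible step size.
  set cκ : ℝ := (c * U) ^ 2 * √χ / (4 * (K + 1)) with hcκdef
  have hcκ : 0 < cκ := by positivity
  set F : ℝ := 2 * (Rmax / (1 - γ)) + 1 with hFdef
  have hF : 0 < F := by positivity
  refine ⟨F / (cκ * δ), 0, by positivity, ?_⟩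
  intro ι β ν hβ hν hν4
  obtain ⟨β₁, hβ₁, hquart⟩ := exists_quartic_bound hβ hν hν4 (by positivity : 0 < σl ^ 2 / 4)
  have hcg : 0 ≤ saddleGradConst Rmax G B γ δ := by
    unfold saddleGradConst
    positivity
  set cg := saddleGradConst Rmax G B γ δ with hcgdef
  set R : ℝ := (episodeGrowth M σ σl * (1 + L) + 1) * (L + cg) ^ 2 with hRdef
  have hR0 : 0 ≤ R := by
    have := episodeGrowth_pos M σ σl
    positivity
  -- Any larger Lipschitz constant of the Hessian is admissible. Adding `1 + R` makes the region
  -- around a saddle small enough for `value_le`, and affects only `ε₀`.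
  set ρ : ℝ := |hessLipConst Rmax G B ι γ| + 1 + R with hρdef
  have hρ1 : 1 ≤ ρ := by linarith [abs_nonneg (hessLipConst Rmax G B ι γ)]
  have hρ2 : R ≤ ρ ^ 2 := by
    have : R ≤ ρ := by linarith [abs_nonneg (hessLipConst Rmax G B ι γ)]
    nlinarith
  set Cb : ℝ := σ * (1 / (1 - √γ) ^ 2) with hCbdef
  have hZ : 0 ≤ saddleThreshold M σ σl L ρ β₁ cg :=
    le_trans (by positivity) (le_saddleThreshold M σ ρ hσl hL.le hβ₁ hcg).2.2.2.2.2.2.1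
  obtain ⟨ε₀, hε₀, hacc⟩ := exists_accuracy (U := U) (D := D ^ 2) hχ (mul_pos hc hU)
    (by positivity : 0 ≤ Cb) hcκ.le (by positivity : 0 < L * σ ^ 2) (sq_nonneg D) hZ hδ1
  refine ⟨ε₀, hε₀, ?_⟩
  intro ε hε hεlt S A _ _ E π μ H hr hμ1 hμ2 hH hcov hcurv θ₀ Ω _ P _ θ τ hrun
  rw [hbound] at hμ1 hμ2
  rw [← mul_assoc] at hμ1
  have hμ : 0 < μ := lt_of_lt_of_le (by positivity) hμ1
  obtain ⟨a0, a1, a2, a3, a4, a5, a6, a7, a8, a9⟩ := hacc ε hε hεlt μ hμ1 hμ2.le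
  have hy : 0 < √ε := Real.sqrt_pos.2 hε
  have hysq : √ε ^ 2 = ε := Real.sq_sqrt hε.le
  have hκ : 0 < cκ * √ε ^ 9 := by positivity
  have hb : σ * ((H + 1) * γ ^ H) ≤ Cb * ε ^ 4 := by
    rw [hCbdef, mul_assoc]
    exact mul_le_mul_of_nonneg_left (succ_mul_pow_le hγ₀ hγ₁ hε hH) hσ.le
  have hstep : μ * (L * σ ^ 2) ≤ ε ^ 2 * δ := by
    have e : U * (L * σ ^ 2 + D ^ 2) = δ := by
      rw [hUdef]
      field_simp
    have e1 := mul_le_mul_of_nonneg_right hμ2.le (by positivity : 0 ≤ L * σ ^ 2 + D ^ 2)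
    have e2 : 0 ≤ μ * D ^ 2 := by positivity
    calc μ * (L * σ ^ 2) ≤ μ * (L * σ ^ 2 + D ^ 2) := by linarith
      _ ≤ U * ε ^ 2 * (L * σ ^ 2 + D ^ 2) := e1
      _ = ε ^ 2 * (U * (L * σ ^ 2 + D ^ 2)) := by ring
      _ = ε ^ 2 * δ := by rw [e]
  have hgap : 4 * (K + 1) * (cκ * √ε ^ 9) ≤ μ ^ 2 * √(χ * ε) := by
    have e : 4 * (K + 1) * cκ = (c * U) ^ 2 * √χ := by
      rw [hcκdef]
      field_simp
    have e1 := pow_le_pow_left₀ (by positivity) hμ1 2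
    rw [Real.sqrt_mul hχ.le]
    calc 4 * (K + 1) * (cκ * √ε ^ 9) = 4 * (K + 1) * cκ * √ε ^ 9 := by ring
      _ = (c * U * (√ε ^ 2) ^ 2) ^ 2 * (√χ * √ε) := by
        rw [e]
        ring
      _ ≤ μ ^ 2 * (√χ * √ε) := by
        rw [hysq]
        gcongr
  have hep : ∀ a ∈ nonStationary E π γ ε √(χ * ε), HasEpisode (hr.updateKernel hG.le γ H μ)
      (objective E π γ) (cκ * √ε ^ 9) (Rmax / (1 - γ) + 1) a := fun a ha =>
    hr.hasEpisode hR hG hB hγ₀ hγ₁ hμ hδ hδ1 hσl hε hχ hκ.le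
      ((le_abs_self _).trans (by linarith)) (by linarith) hb hβ₁ hquart hcov hcurv
      hstep a1 a2 a3 a4 a5 hgap hρ2 a6 a7 a8 a9 ha
  -- This is the number of iterations demanded by `hlen`, of order `ε ^ (-9/2)`; it is relaxed to `ε
  -- ^ (-13/2)` at the end, using `ε ≤ 1`.
  set n : ℕ := ⌈F / (cκ * √ε ^ 9 * δ)⌉₊ with hn
  have hκδ : 0 < cκ * √ε ^ 9 * δ := by positivity
  have hn0 : 0 < n := Nat.ceil_pos.2 (by positivity)
  have hlen : F ≤ cκ * √ε ^ 9 * δ * n := by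
    have := Nat.le_ceil (F / (cκ * √ε ^ 9 * δ))
    rw [div_le_iff₀ hκδ] at this
    linarith
  refine (hr.one_sub_le_measureReal hR.le hG.le hB.le hγ₀ hγ₁ P hrun hκ hn0 hep hlen).trans
    (measureReal_mono ?_)
  rintro ω ⟨t, ht, hst⟩
  refine ⟨t, ?_, hst⟩
  rw [pow_zero, mul_one]
  have hpow : ε ^ (-(13 / 2) : ℝ) = (√ε ^ 13)⁻¹ := by
    rw [Real.rpow_neg hε.le, Real.sqrt_eq_rpow, ← Real.rpow_natCast, ← Real.rpow_mul hε.le]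
    norm_num
  have hy1 : √ε ≤ 1 := Real.sqrt_le_one.2 a0
  have hinv : (√ε ^ 9)⁻¹ ≤ (√ε ^ 13)⁻¹ :=
    inv_anti₀ (by positivity) (pow_le_pow_of_le_one hy.le hy1 (by norm_num))
  calc (t : ℝ) ≤ F / (cκ * √ε ^ 9 * δ) := (Nat.lt_ceil.1 ht).le
    _ = F / (cκ * δ) * (√ε ^ 9)⁻¹ := by field_simp
    _ ≤ F / (cκ * δ) * (√ε ^ 13)⁻¹ := mul_le_mul_of_nonneg_left hinv (by positivity)
    _ = F / (cκ * δ) * ε ^ (-(13 / 2) : ℝ) := by rw [hpow]
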